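/- Let $\Omega\subset\mathbb R^n$ be a bounded polygonal (for $n=3$ polyhedral) domain with Lipschitz boundary $\partial\Omega=\Gamma_1\cup\Gamma_2$, where $\Gamma_1,\Gamma_2$ are disjoint and measurable and $\Gamma_1$ has positive surface measure. Put $V=H^1(\Omega)$, $H=L^2(\Omega)$, $Q=L^2(\Gamma_2)$, $R=L^2(\Gamma_1)$, $K_+=\{v\in V: v\ge 0 \text{ in } \Omega\}$, and let $\alpha,b,M>0$ be constants and $q\in Q$. For $u,v\in V$ set $a_\alpha(u,v)=\int_\Omega\nabla u\cdot\nabla v\,dx+\alpha\int_{\Gamma_1}uv\,ds$. For a control $g\in H$ the continuous state $u_{\alpha g}\in K_+$ is the solution of $$a_\alpha(u_{\alpha g},v-u_{\alpha g})\ \ge\ (g,v-u_{\alpha g})_H-(q,v-u_{\alpha g})_Q+\alpha(b,v-u_{\alpha g})_R\qquad\forall v\in K_+ .$$ For a conforming triangulation $\tau_h$ of $\overline\Omega$ into finitely many $n$-simplices, let $h$ be the length of the longest side of the simplices, let $V_h$ be the set of functions $v_h\in C^0(\overline\Omega)$ that are affine on every $T\in\tau_h$, and let $K_{+h}=\{v_h\in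 V_h: v_h\ge0\text{ in }\Omega\}$. The discrete state $u_{h\alpha g}\in K_{+h}$ is the solution of the same inequality with $K_+$ replaced by $K_{+h}$. The cost functionals are $$J_\alpha(g)=\tfrac12\|u_{\alpha g}\|_H^2+\tfrac M2\|g\|_H^2,\qquad J_{h\alpha}(g)=\tfrac12\|u_{h\alpha g}\|_H^2+\tfrac M2\|g\|_H^2 .$$ Let $1<r\le 2$ and $n<2r$ (so that $H^r(\Omega)\subset C^0(\overline\Omega)$; this is automatic for $n=2$), and let $\sigma$ be a constant. Then for every $g\in H$ with $u_{\alpha g}\in H^r(\Omega)$ there is a constant $C=C(\alpha)>0$, independent of $h$ and of the triangulation, such that $$|J_{h\alpha}(g)-J_\alpha(g)|\le C(\alpha)\,h^{(r-1)/2}$$ for every triangulation $\tau_h$ that is regular with parameter $\sigma$, i.e. in which every simplex $T$ contains a ball of some diameter $\rho_T>0$ with $\operatorname{diam}T\le\sigma\rho_T$. (The constant $C$ may depend on the fixed data $\Omega,\Gamma_1,\Gamma_2,\alpha,b,q,M,r,\sigma$ and on $g$.) -/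

import Mathlib

open MeasureTheory Filter Topology
open scoped ENNReal NNReal ContDiff

namespace VarIneqFEM

/-- Euclidean space `ℝⁿ`. -/
abbrev E (n : ℕ) : Type := EuclideanSpace ℝ (Fin n)

/-- The surface measure on hypersurfaces of `ℝⁿ`: the `(n-1)`-dimensional Hausdorff measure,
normalised to agree with Lebesgue measure on hyperplanes (counting measure when `n = 1`). -/
noncomputable def surf (n : ℕ) : Measure (E n) := μHE[n - 1]

/-! ### Domains and triangulations -/

/-- The open set `Ω` has a Lipschitz boundary: near each boundary point there are a unit
direction `e` and a Lipschitz function `ψ` of the coordinates orthogonal to `e` such that `Ω` is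
the set of points lying strictly above the graph of `ψ` in direction `e`. -/
def HasLipschitzBoundary {n : ℕ} (Ω : Set (E n)) : Prop :=
  ∀ x₀ ∈ frontier Ω, ∃ e : E n, ‖e‖ = 1 ∧ ∃ δ : ℝ, 0 < δ ∧ ∃ (K : ℝ≥0) (ψ : E n → ℝ),
    LipschitzWith K ψ ∧ (∀ (y : E n) (t : ℝ), ψ (y + t • e) = ψ y) ∧
      ∀ y ∈ Metric.ball x₀ δ, y ∈ Ω ↔ ψ y < inner ℝ e y

/-- A bounded polygonal (for `n = 3`, polyhedral) domain in `ℝⁿ` with regular, i.e. Lipschitz,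
boundary. Its closure is a finite union of nondegenerate closed `n`-simplices. -/
structure IsPolygonalDomain {n : ℕ} (Ω : Set (E n)) : Prop where
  isOpen : IsOpen Ω
  isConnected : IsConnected Ω
  isBounded : Bornology.IsBounded Ω
  lipschitz : HasLipschitzBoundary Ω
  polygonal : ∃ S : Set (Finset (E n)), S.Finite ∧
    (∀ s ∈ S, s.card = n + 1 ∧ AffineIndependent ℝ ((↑) : s → E n)) ∧
    (⋃ s ∈ S, convexHull ℝ (s : Set (E n))) = closure Ω

/-- A (conforming) triangulation of the closure of `Ω`: a finite simplicial complex whose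
underlying space is the closure of `Ω`. -/
structure Triangulation {n : ℕ} (Ω : Set (E n)) where
  complex : Geometry.SimplicialComplex ℝ (E n)
  finite_faces : complex.faces.Finite
  space_eq : complex.space = closure Ω

namespace Triangulation

variable {n : ℕ} {Ω : Set (E n)}

/-- The triangles (`n`-simplices) of the triangulation, each given by its set of vertices. -/
def cells (T : Triangulation Ω) : Set (Finset (E n)) :=
  {s | s ∈ T.complex.faces ∧ s.card = n + 1}

/-- The mesh size `h`: the length of the longest side of the triangles. -/
noncomputable def meshSize (T : Triangulation Ω) : ℝ :=
  sSup ((fun s : Finset (E n) => Metric.diam (s : Set (E n))) '' T.cells)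

/-- Shape regularity with parameter `σ`: every triangle contains a ball of some diameter `ρ > 0`
such that the diameter of the triangle is at most `σ ρ`. -/
def IsShapeRegular (T : Triangulation Ω) (σ : ℝ) : Prop :=
  ∀ s ∈ T.cells, ∃ (c : E n) (ρ : ℝ), 0 < ρ ∧
    Metric.ball c (ρ / 2) ⊆ convexHull ℝ (s : Set (E n)) ∧
    Metric.diam (s : Set (E n)) ≤ σ * ρ

end Triangulation

/-! ### Sobolev spaces -/

/-- `G` is a weak gradient of `u` in `Ω`. -/
def HasWeakGradient {n : ℕ} (Ω : Set (E n)) (u : E n → ℝ) (G : E n → E n) : Prop :=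
  ∀ φ : E n → ℝ, ContDiff ℝ ∞ φ → HasCompactSupport φ → tsupport φ ⊆ Ω → ∀ i : Fin n,
    ∫ x in Ω, u x * fderiv ℝ φ x (EuclideanSpace.single i 1) = - ∫ x in Ω, G x i * φ x

/-- `τ` is the boundary trace of the `H¹(Ω)` function `u` with weak gradient `G`: there are
functions `φ_k`, smooth up to the boundary, that converge to `u` in `H¹(Ω)` and whose restrictions
to the boundary converge to `τ` in `L²(∂Ω)`. -/
def HasTrace {n : ℕ} (Ω : Set (E n)) (u : E n → ℝ) (G : E n → E n) (τ : E n → ℝ) : Prop :=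
  ∃ φ : ℕ → E n → ℝ, (∀ k, ContDiff ℝ ∞ (φ k)) ∧
    Tendsto (fun k => eLpNorm (fun x => φ k x - u x) 2 (volume.restrict Ω)) atTop (𝓝 0) ∧
    Tendsto (fun k => eLpNorm (fun x => gradient (φ k) x - G x) 2 (volume.restrict Ω))
      atTop (𝓝 0) ∧
    Tendsto (fun k => eLpNorm (fun x => φ k x - τ x) 2 ((surf n).restrict (frontier Ω)))
      atTop (𝓝 0)

/-- An element of `V = H¹(Ω)`: a representative of the function together with representatives of
its weak gradient and of its boundary trace (which are determined by the function almost
everywhere in `Ω` and on the boundary, respectively). -/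
structure H1 {n : ℕ} (Ω : Set (E n)) where
  val : E n → ℝ
  grad : E n → E n
  trace : E n → ℝ
  memLp_val : MemLp val 2 (volume.restrict Ω)
  memLp_grad : MemLp grad 2 (volume.restrict Ω)
  memLp_trace : MemLp trace 2 ((surf n).restrict (frontier Ω))
  hasWeakGradient : HasWeakGradient Ω val grad
  hasTrace : HasTrace Ω val grad trace

/-- The function `u ∈ H¹(Ω)` belongs to `H^r(Ω)`, for `1 < r ≤ 2`. If `r = 2`, all first weak
derivatives have a weak gradient in `L²(Ω)`; if `1 < r < 2`, the Sobolev-Slobodeckij seminorm of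
order `r - 1` of the gradient is finite. -/
def MemHr {n : ℕ} {Ω : Set (E n)} (r : ℝ) (u : H1 Ω) : Prop :=
  (r = 2 → ∀ i : Fin n, ∃ D : E n → E n, MemLp D 2 (volume.restrict Ω) ∧
    HasWeakGradient Ω (fun x => u.grad x i) D) ∧
  (r < 2 → ∫⁻ x in Ω, ∫⁻ y in Ω,
    ENNReal.ofReal (‖u.grad x - u.grad y‖ ^ 2 / ‖x - y‖ ^ ((n : ℝ) + 2 * (r - 1))) < ⊤)

/-! ### The variational inequalities -/

/-- `K₊`: the nonnegative functions of `H¹(Ω)`. -/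
def Kplus {n : ℕ} (Ω : Set (E n)) : Set (H1 Ω) :=
  {v | ∀ᵐ x ∂(volume.restrict Ω), 0 ≤ v.val x}

/-- `V_h`, as a subset of `H¹(Ω)`: the functions that are continuous on the closure of `Ω` and
affine on each triangle. -/
def Vh {n : ℕ} {Ω : Set (E n)} (T : Triangulation Ω) : Set (H1 Ω) :=
  {v | ContinuousOn v.val (closure Ω) ∧
    ∀ s ∈ T.cells, ∃ A : E n →ᵃ[ℝ] ℝ, Set.EqOn v.val A (convexHull ℝ (s : Set (E n)))}

/-- `K₊ₕ`: the nonnegative functions of `V_h`. -/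
def KplusH {n : ℕ} {Ω : Set (E n)} (T : Triangulation Ω) : Set (H1 Ω) :=
  {v | v ∈ Vh T ∧ ∀ x ∈ Ω, 0 ≤ v.val x}

/-- The inner product of `L²(Ω)`. -/
noncomputable def innerH {n : ℕ} (Ω : Set (E n)) (f g : E n → ℝ) : ℝ := ∫ x in Ω, f x * g x

/-- The inner product of `L²(Γ)`, for a part `Γ` of the boundary. -/
noncomputable def innerBdry {n : ℕ} (Γ : Set (E n)) (f g : E n → ℝ) : ℝ :=
  ∫ x in Γ, f x * g x ∂(surf n)

/-- `u ∈ K` solves the variational inequality posed on `K`: for all `v ∈ K`,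
`a_α(u, v - u) ≥ (g, v - u)_H - (q, v - u)_Q + α (b, v - u)_R`, where
`a_α(u, w) = ∫_Ω ∇u · ∇w + α (u, w)_R`, `H = L²(Ω)`, `R = L²(Γ₁)` and `Q = L²(Γ₂)`. -/
def SolvesVI {n : ℕ} {Ω : Set (E n)} (Γ₁ Γ₂ : Set (E n)) (α b : ℝ) (q g : E n → ℝ)
    (K : Set (H1 Ω)) (u : H1 Ω) : Prop :=
  u ∈ K ∧ ∀ v ∈ K,
    innerH Ω g (fun x => v.val x - u.val x)
        - innerBdry Γ₂ q (fun x => v.trace x - u.trace x)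
        + α * innerBdry Γ₁ (fun _ => b) (fun x => v.trace x - u.trace x)
      ≤ (∫ x in Ω, inner ℝ (u.grad x) (v.grad x - u.grad x))
        + α * innerBdry Γ₁ u.trace (fun x => v.trace x - u.trace x)

/-- The quadratic cost `½ ‖u‖²_H + (M/2) ‖g‖²_H` of a control `g` with associated state `u`. It is
`J_α(g)` if `u` is the continuous state of `g`, and `J_{hα}(g)` if `u` is the discrete one. -/
noncomputable def cost {n : ℕ} {Ω : Set (E n)} (M : ℝ) (g : E n → ℝ) (u : H1 Ω) : ℝ :=
  1 / 2 * innerH Ω u.val u.val + M / 2 * innerH Ω g g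

end VarIneqFEM

open VarIneqFEM

namespace VarIneqFEM

/-! ### Square integrals in extended nonnegative form -/

/-! The control terms of the two costs coincide, so the difference is half of ‖u_h‖² − ‖u‖² and is
bounded by ‖u_h − u‖ (‖u_h‖ + ‖u‖) in L²(Ω). Testing the discrete inequality with 0 bounds u_h
uniformly in the triangulation (`add_le_of_sq_le`), so everything rests on ‖u_h − u‖ =
O(h^((r-1)/2)).

This is Falk's argument (`sq_add_sq_le_of_variational_inequalities`). Since K₊ₕ ⊆ K₊, u_h is
admissible in the continuous inequality; adding the discrete inequality tested with some v_h ∈ K₊ₕ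
bounds the squared energy norm of u_h − u linearly by norms of v_h − u. If v_h − u is O(h^(r-1)) in
H¹, then u_h − u is of the order of the square root (`sqrt_rate`). A Friedrichs inequality with
boundary term on Γ₁ passes from the energy norm to L²(Ω), and a trace inequality bounds the boundary
terms (`exists_norm_bounds`). Both are proved for smooth functions in the form `Controls`, by
integrating along segments in convex sets and boundary charts, and reach H¹ through the smooth
approximations in the definition of the trace.

What remains is a nonnegative v_h with rate h^(r-1) (`exists_discrete_approx`). For u in H^r, the
integral of |∇u(y) − ∇u(x)|² over U × U, for U convex of diameter at most d, is at most d^(n+2(r-1))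
μ(U) with one finite measure μ (`exists_regularity_measure`). Together with Poincaré this gives
affine approximations on convex sets that are not too thin (`exists_affine_approx`).

Since u is known only almost everywhere, its nodal values are constructed. Averages of u over copies
of U shrunk towards z by powers of 1/2 are extrapolated so that affine functions are reproduced at
z; successive extrapolations differ by a geometric sequence of ratio 2^-(r-n/2), which converges
because n < 2r (`exists_tendsto_extrapolate`). The limit does not depend on U, because in a
Lipschitz domain any two convex open sets with z in their closures are linked near z by larger ones
(`exists_convex_link`, `exists_point_value`); so simplices sharing a vertex share its value. The
limit is nonnegative when u is. The piecewise affine interpolant of these values is Lipschitz on the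
closure of Ω, hence an element of `H1` (`Triangulation.exists_interpolant`). Shape regularity turns
vertex errors into gradient errors, and the sum over the cells is bounded by additivity of μ. -/

theorem sq_lintegral_le {X : Type*} [MeasurableSpace X] (μ : Measure X) {f : X → ℝ≥0∞}
    (hf : AEMeasurable f μ) : (∫⁻ x, f x ∂μ) ^ 2 ≤ μ Set.univ * ∫⁻ x, f x ^ 2 ∂μ := by
  have h := ENNReal.lintegral_mul_le_Lp_mul_Lq μ (p := 2) (q := 2)
    (by constructor <;> norm_num) (f := fun _ => 1) (g := f) aemeasurable_const hf
  simp only [Pi.mul_apply, one_mul, lintegral_const, ENNReal.rpow_two, one_pow] at h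
  calc (∫⁻ x, f x ∂μ) ^ 2
      ≤ (μ Set.univ ^ (1 / 2 : ℝ) * (∫⁻ x, f x ^ 2 ∂μ) ^ (1 / 2 : ℝ)) ^ 2 := by gcongr
    _ = _ := by
        rw [mul_pow, ← ENNReal.rpow_two, ← ENNReal.rpow_two, ← ENNReal.rpow_mul,
          ← ENNReal.rpow_mul]
        norm_num

theorem enorm_add_sq_le {F : Type*} [NormedAddCommGroup F] (a b : F) :
    ‖a + b‖ₑ ^ 2 ≤ 2 * ‖a‖ₑ ^ 2 + 2 * ‖b‖ₑ ^ 2 := by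
  have h : ‖a + b‖ ^ 2 ≤ 2 * ‖a‖ ^ 2 + 2 * ‖b‖ ^ 2 := by
    have := norm_add_le a b
    nlinarith [sq_nonneg (‖a‖ - ‖b‖), norm_nonneg (a + b), norm_nonneg a, norm_nonneg b]
  have h2 := ENNReal.ofReal_le_ofReal h
  rw [ENNReal.ofReal_add (by positivity) (by positivity), ENNReal.ofReal_mul (by norm_num),
    ENNReal.ofReal_mul (by norm_num), ENNReal.ofReal_pow (norm_nonneg _),
    ENNReal.ofReal_pow (norm_nonneg _), ENNReal.ofReal_pow (norm_nonneg _)] at h2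
  simpa [ofReal_norm] using h2

theorem enorm_sq_le_sub {F : Type*} [NormedAddCommGroup F] (a b : F) :
    ‖a‖ₑ ^ 2 ≤ 2 * ‖b‖ₑ ^ 2 + 2 * ‖b - a‖ₑ ^ 2 := by
  have := enorm_add_sq_le b (a - b)
  rwa [add_sub_cancel, ← enorm_neg (a - b), neg_sub] at this

theorem continuous_gradient {n : ℕ} {φ : E n → ℝ} (hφ : ContDiff ℝ 1 φ) :
    Continuous (gradient φ) :=
  (InnerProductSpace.toDual ℝ (E n)).symm.continuous.comp (hφ.continuous_fderiv one_ne_zero)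

/-- The difference of the values at two points is controlled by the gradient on the segment. -/
theorem enorm_sub_sq_le_lintegral_gradient {n : ℕ} {φ : E n → ℝ} (hφ : ContDiff ℝ 1 φ)
    (x v : E n) {T : ℝ} (hT : 0 ≤ T) : ‖φ (x + T • v) - φ x‖ₑ ^ 2
      ≤ ‖v‖ₑ ^ 2 * (ENNReal.ofReal T * ∫⁻ t in Set.Ioc 0 T, ‖gradient φ (x + t • v)‖ₑ ^ 2) := by
  have hd : ∀ t : ℝ, HasDerivAt (fun t : ℝ => φ (x + t • v)) (fderiv ℝ φ (x + t • v) v) t := by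
    intro t
    have h1 : HasDerivAt (fun t : ℝ => x + t • v) v t := by
      simpa using ((hasDerivAt_id t).smul_const v).const_add x
    exact ((hφ.differentiable one_ne_zero _).hasFDerivAt).comp_hasDerivAt t h1
  have hc : Continuous fun t : ℝ => fderiv ℝ φ (x + t • v) v :=
    ((hφ.continuous_fderiv one_ne_zero).comp (by fun_prop)).clm_apply continuous_const
  have hi := intervalIntegral.integral_eq_sub_of_hasDerivAt (a := 0) (b := T)
    (fun t _ => hd t) (hc.intervalIntegrable _ _)
  simp only [zero_smul, add_zero] at hi
  rw [← hi, intervalIntegral.integral_of_le hT]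
  have hg : Continuous fun t : ℝ => ‖gradient φ (x + t • v)‖ₑ := by
    have := continuous_gradient hφ
    fun_prop
  calc ‖∫ t in Set.Ioc 0 T, fderiv ℝ φ (x + t • v) v‖ₑ ^ 2
      ≤ (∫⁻ t in Set.Ioc 0 T, ‖v‖ₑ * ‖gradient φ (x + t • v)‖ₑ) ^ 2 := by
        gcongr
        refine (enorm_integral_le_lintegral_enorm _).trans (lintegral_mono fun t => ?_)
        rw [mul_comm]
        have : ‖gradient φ (x + t • v)‖ₑ = ‖fderiv ℝ φ (x + t • v)‖ₑ := by
          simp [gradient, enorm_eq_nnnorm]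
        rw [this]
        exact ContinuousLinearMap.le_opENorm _ _
    _ ≤ _ := by
        rw [lintegral_const_mul _ hg.measurable, mul_pow]
        gcongr
        simpa using sq_lintegral_le (volume.restrict (Set.Ioc 0 T)) hg.measurable.aemeasurable

/-- The line estimate is integrated over A and the integrals are exchanged; for each t the translate
of A by t v lies in Ω, and translation preserves Lebesgue measure. -/
theorem lintegral_enorm_translate_sub_sq_le {n : ℕ} {φ : E n → ℝ} (hφ : ContDiff ℝ 1 φ)
    {A Ω : Set (E n)} (hA : MeasurableSet A) (hΩ : MeasurableSet Ω) (v : E n)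
    (h : ∀ x ∈ A, ∀ t ∈ Set.Ioc (0 : ℝ) 1, x + t • v ∈ Ω) :
    ∫⁻ x in A, ‖φ (x + v) - φ x‖ₑ ^ 2 ≤ ‖v‖ₑ ^ 2 * ∫⁻ x in Ω, ‖gradient φ x‖ₑ ^ 2 := by
  have hg := continuous_gradient hφ
  calc ∫⁻ x in A, ‖φ (x + v) - φ x‖ₑ ^ 2
      ≤ ∫⁻ x in A, ‖v‖ₑ ^ 2 * ∫⁻ t in Set.Ioc (0 : ℝ) 1, ‖gradient φ (x + t • v)‖ₑ ^ 2 :=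
        lintegral_mono fun x => by
          simpa using enorm_sub_sq_le_lintegral_gradient hφ x v zero_le_one
    _ = ‖v‖ₑ ^ 2 * ∫⁻ t in Set.Ioc (0 : ℝ) 1, ∫⁻ x in A, ‖gradient φ (x + t • v)‖ₑ ^ 2 := by
        rw [lintegral_const_mul' _ _ (by simp), lintegral_lintegral_swap]
        exact Continuous.aemeasurable (by fun_prop)
    _ ≤ ‖v‖ₑ ^ 2 * ∫⁻ t in Set.Ioc (0 : ℝ) 1, ∫⁻ x in Ω, ‖gradient φ x‖ₑ ^ 2 := by
        gcongr ‖v‖ₑ ^ 2 * ?_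
        refine setLIntegral_mono' measurableSet_Ioc fun t ht => ?_
        rw [← lintegral_indicator hA, ← lintegral_indicator hΩ,
          ← lintegral_add_right_eq_self (fun x => Ω.indicator _ x) (t • v)]
        refine lintegral_mono fun x => ?_
        by_cases hx : x ∈ A
        · rw [Set.indicator_of_mem hx, Set.indicator_of_mem (h x hx t ht)]
        · simp [Set.indicator_of_notMem hx]
    _ = _ := by simp

/-- Poincaré inequality on a convex set, for smooth functions. -/
theorem lintegral_lintegral_enorm_sub_sq_le {n : ℕ} {φ : E n → ℝ} (hφ : ContDiff ℝ 1 φ)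
    {U : Set (E n)} (hU : MeasurableSet U) (hc : Convex ℝ U) {d : ℝ}
    (hd : ∀ x ∈ U, ∀ y ∈ U, dist x y ≤ d) :
    ∫⁻ x in U, ∫⁻ y in U, ‖φ y - φ x‖ₑ ^ 2
      ≤ volume (Metric.closedBall (0 : E n) d) * ENNReal.ofReal d ^ 2 *
        ∫⁻ x in U, ‖gradient φ x‖ₑ ^ 2 := by
  have hφc := hφ.continuous
  have hm : Measurable (Function.uncurry fun x v : E n =>
      U.indicator 1 x * (U.indicator 1 (x + v) * ‖φ (x + v) - φ x‖ₑ ^ 2)) := by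
    have h1 : Measurable (U.indicator (1 : E n → ℝ≥0∞)) := measurable_one.indicator hU
    have h2 : Continuous fun p : E n × E n => ‖φ (p.1 + p.2) - φ p.1‖ₑ ^ 2 := by fun_prop
    exact (h1.comp measurable_fst).mul
      ((h1.comp (measurable_fst.add measurable_snd)).mul h2.measurable)
  -- With y = x + v the double integral becomes one over increments v. Convexity keeps the segment
  -- from x to x + v in U, and increments longer than d contribute nothing, so v ranges over a ball
  -- of radius d.
  calc ∫⁻ x in U, ∫⁻ y in U, ‖φ y - φ x‖ₑ ^ 2
      = ∫⁻ x, ∫⁻ v, U.indicator 1 x * (U.indicator 1 (x + v) * ‖φ (x + v) - φ x‖ₑ ^ 2) := by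
        rw [← lintegral_indicator hU]
        refine lintegral_congr fun x => ?_
        by_cases hx : x ∈ U
        · simp only [Set.indicator_of_mem hx, Pi.one_apply, one_mul]
          rw [← lintegral_indicator hU, ← lintegral_add_left_eq_self _ x]
          refine lintegral_congr fun y => ?_
          by_cases hy : x + y ∈ U <;> simp [hy]
        · simp [hx]
    _ = ∫⁻ v, ∫⁻ x, U.indicator 1 x * (U.indicator 1 (x + v) * ‖φ (x + v) - φ x‖ₑ ^ 2) :=
        lintegral_lintegral_swap hm.aemeasurable
    _ ≤ ∫⁻ v, (Metric.closedBall (0 : E n) d).indicator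
          (fun _ => ENNReal.ofReal d ^ 2 * ∫⁻ x in U, ‖gradient φ x‖ₑ ^ 2) v := by
        refine lintegral_mono fun v => ?_
        by_cases hv : v ∈ Metric.closedBall (0 : E n) d
        · rw [Set.indicator_of_mem hv]
          have hvd : ‖v‖ₑ ≤ ENNReal.ofReal d := by
            rw [← ofReal_norm]
            exact ENNReal.ofReal_le_ofReal (by simpa using hv)
          have hUv : MeasurableSet (U ∩ (fun x => x + v) ⁻¹' U) :=
            hU.inter (measurable_add_const v hU)
          have := lintegral_enorm_translate_sub_sq_le hφ hUv hU v (by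
            rintro x ⟨hx, hx'⟩ t ht
            have := hc.add_smul_sub_mem hx hx' ⟨ht.1.le, ht.2⟩
            simpa using this)
          refine le_trans (le_of_eq ?_) (this.trans (by gcongr))
          rw [← lintegral_indicator hUv]
          refine lintegral_congr fun x => ?_
          by_cases hx : x ∈ U <;> by_cases hx' : x + v ∈ U <;> simp [hx, hx', Set.indicator]
        · rw [Set.indicator_of_notMem hv, nonpos_iff_eq_zero, lintegral_eq_zero_iff']
          · refine Eventually.of_forall fun x => ?_
            by_cases hx : x ∈ U
            · have hx' : x + v ∉ U := fun hx' => hv (by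
                simpa using hd _ hx' _ hx)
              simp [hx']
            · simp [hx]
          · exact (hm.comp (measurable_id.prodMk measurable_const)).aemeasurable
    _ = _ := by
        rw [lintegral_indicator Metric.isClosed_closedBall.measurableSet]
        simp; ring

/-! ### Control of square norms of smooth functions -/

/-- The square norm with respect to `μ` of any smooth function is controlled by its square norm
with respect to `ν` and that of its gradient in `Ω`. -/
def Controls {n : ℕ} (Ω : Set (E n)) (μ ν : Measure (E n)) : Prop :=
  ∃ C : ℝ≥0, ∀ φ : E n → ℝ, ContDiff ℝ ∞ φ →
    ∫⁻ x, ‖φ x‖ₑ ^ 2 ∂μ ≤ C * (∫⁻ x, ‖φ x‖ₑ ^ 2 ∂ν + ∫⁻ x in Ω, ‖gradient φ x‖ₑ ^ 2)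

namespace Controls

variable {n : ℕ} {Ω : Set (E n)} {μ ν ξ : Measure (E n)}

theorem of_le (h : μ ≤ ν) : Controls Ω μ ν :=
  ⟨1, fun φ _ => by
    rw [ENNReal.coe_one, one_mul]
    exact (lintegral_mono' h le_rfl).trans le_self_add⟩

theorem trans (h₁ : Controls Ω μ ν) (h₂ : Controls Ω ν ξ) : Controls Ω μ ξ := by
  obtain ⟨C, hC⟩ := h₁
  obtain ⟨D, hD⟩ := h₂
  refine ⟨C * (D + 1), fun φ hφ => (hC φ hφ).trans ?_⟩
  push_cast
  rw [mul_assoc]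
  gcongr
  rw [add_mul, one_mul]
  gcongr
  · exact hD φ hφ
  · exact le_add_self

theorem add (h₁ : Controls Ω μ ξ) (h₂ : Controls Ω ν ξ) : Controls Ω (μ + ν) ξ := by
  obtain ⟨C, hC⟩ := h₁
  obtain ⟨D, hD⟩ := h₂
  refine ⟨C + D, fun φ hφ => ?_⟩
  rw [lintegral_add_measure]
  push_cast
  rw [add_mul]
  exact add_le_add (hC φ hφ) (hD φ hφ)

theorem union {A B : Set (E n)} (h₁ : Controls Ω (μ.restrict A) ξ)
    (h₂ : Controls Ω (μ.restrict B) ξ) : Controls Ω (μ.restrict (A ∪ B)) ξ :=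
  (of_le (Measure.restrict_union_le A B)).trans (h₁.add h₂)

/-- A finite subcover suffices, since the constants of finitely many pieces add up. This makes
`Controls` a local property on compact sets. -/
theorem of_isCompact {K : Set (E n)} (hK : IsCompact K)
    (h : ∀ x ∈ K, ∃ U ∈ 𝓝 x, Controls Ω (μ.restrict U) ξ) : Controls Ω (μ.restrict K) ξ := by
  refine hK.induction_on (p := fun s => Controls Ω (μ.restrict s) ξ) ?_ ?_ ?_ ?_
  · exact of_le (by simp [Measure.zero_le])
  · exact fun s t hst ht => (of_le (Measure.restrict_mono_set _ hst)).trans ht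
  · exact fun s t hs ht => hs.union ht
  · intro x hx
    obtain ⟨U, hU, h⟩ := h x hx
    exact ⟨U, mem_nhdsWithin_of_mem_nhds hU, h⟩

/-- Control on a convex set by any subset of positive measure. -/
theorem of_convex {U A : Set (E n)} (hUΩ : U ⊆ Ω) (hU : MeasurableSet U) (hc : Convex ℝ U)
    (hb : Bornology.IsBounded U) (hA : A ⊆ U) (hA0 : volume A ≠ 0) :
    Controls Ω (volume.restrict U) (volume.restrict A) := by
  obtain ⟨d, hd⟩ := Metric.isBounded_iff.1 hb
  have hUf : volume U ≠ ⊤ := hb.measure_lt_top.ne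
  have hAf : volume A ≠ ⊤ := (hb.subset hA).measure_lt_top.ne
  set P := volume (Metric.closedBall (0 : E n) d) * ENNReal.ofReal d ^ 2 with hP
  have hPf : P ≠ ⊤ := ENNReal.mul_ne_top measure_closedBall_lt_top.ne (by simp)
  have hCf : (volume A)⁻¹ * (2 * volume U + 2 * P) ≠ ⊤ := by
    refine ENNReal.mul_ne_top (by simpa using hA0) ?_
    finiteness
  refine ⟨((volume A)⁻¹ * (2 * volume U + 2 * P)).toNNReal, fun φ hφ => ?_⟩
  -- The factor 1 / volume A is moved to the left, where volume A becomes an integration over y in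
  -- A: each value at x in U is compared with all values at y in A.
  rw [ENNReal.coe_toNNReal hCf, mul_assoc, mul_comm, ← div_eq_mul_inv,
    ENNReal.le_div_iff_mul_le (Or.inl hA0) (Or.inl hAf), mul_comm]
  have hφ1 : ContDiff ℝ 1 φ := hφ.of_le (by norm_cast)
  have hφc := hφ.continuous
  calc volume A * ∫⁻ x in U, ‖φ x‖ₑ ^ 2
      = ∫⁻ y in A, ∫⁻ x in U, ‖φ x‖ₑ ^ 2 := by simp [mul_comm]
    _ ≤ ∫⁻ y in A, ∫⁻ x in U, (2 * ‖φ y‖ₑ ^ 2 + 2 * ‖φ y - φ x‖ₑ ^ 2) := by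
        gcongr; exact enorm_sq_le_sub _ _
    _ = ∫⁻ y in A, (2 * volume U * ‖φ y‖ₑ ^ 2 + 2 * ∫⁻ x in U, ‖φ y - φ x‖ₑ ^ 2) := by
        refine lintegral_congr fun y => ?_
        rw [lintegral_add_left measurable_const,
          lintegral_const_mul' _ (fun x => ‖φ y - φ x‖ₑ ^ 2) (by simp), lintegral_const,
          Measure.restrict_apply_univ]
        ring
    _ = 2 * volume U * (∫⁻ y in A, ‖φ y‖ₑ ^ 2)
          + 2 * ∫⁻ y in A, ∫⁻ x in U, ‖φ y - φ x‖ₑ ^ 2 := by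
        rw [lintegral_add_left (by fun_prop), lintegral_const_mul' _ _ (by finiteness),
          lintegral_const_mul' _ _ (by simp)]
    _ ≤ 2 * volume U * (∫⁻ y in A, ‖φ y‖ₑ ^ 2)
          + 2 * (P * ∫⁻ x in Ω, ‖gradient φ x‖ₑ ^ 2) := by
        gcongr
        calc ∫⁻ y in A, ∫⁻ x in U, ‖φ y - φ x‖ₑ ^ 2
            ≤ ∫⁻ y in U, ∫⁻ x in U, ‖φ x - φ y‖ₑ ^ 2 := by
              simp_rw [fun y x => enorm_sub_rev (φ y) (φ x)]
              exact lintegral_mono_set hA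
          _ ≤ P * ∫⁻ x in U, ‖gradient φ x‖ₑ ^ 2 :=
              lintegral_lintegral_enorm_sub_sq_le hφ1 hU hc fun x hx y hy => hd hx hy
          _ ≤ _ := by gcongr
    _ ≤ _ := by
        rw [add_mul, ← mul_assoc 2 P]
        gcongr
        · exact le_self_add
        · exact le_add_self

/-- This carries control up to the boundary: a piece of Ω touching the boundary is pushed into the
interior along a fixed vector, at the price of the gradient along the way. -/
theorem of_translate {A W : Set (E n)} (hA : MeasurableSet A) (hW : MeasurableSet W)
    (hΩ : MeasurableSet Ω) (v : E n)
    (h : ∀ x ∈ A, ∀ t ∈ Set.Ioc (0 : ℝ) 1, x + t • v ∈ Ω) (hAW : ∀ x ∈ A, x + v ∈ W) :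
    Controls Ω (volume.restrict A) (volume.restrict W) := by
  refine ⟨2 + 2 * ‖v‖₊ ^ 2, fun φ hφ => ?_⟩
  have hφ1 : ContDiff ℝ 1 φ := hφ.of_le (by norm_cast)
  have hφc := hφ.continuous
  calc ∫⁻ x in A, ‖φ x‖ₑ ^ 2
      ≤ ∫⁻ x in A, (2 * ‖φ (x + v)‖ₑ ^ 2 + 2 * ‖φ (x + v) - φ x‖ₑ ^ 2) :=
        lintegral_mono fun x => enorm_sq_le_sub _ _
    _ = 2 * (∫⁻ x in A, ‖φ (x + v)‖ₑ ^ 2) + 2 * ∫⁻ x in A, ‖φ (x + v) - φ x‖ₑ ^ 2 := by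
        rw [lintegral_add_left (Measurable.const_mul (Continuous.measurable (by fun_prop)) _),
          lintegral_const_mul' _ _ (by simp), lintegral_const_mul' _ _ (by simp)]
    _ ≤ 2 * (∫⁻ x in W, ‖φ x‖ₑ ^ 2) + 2 * (‖v‖ₑ ^ 2 * ∫⁻ x in Ω, ‖gradient φ x‖ₑ ^ 2) := by
        refine add_le_add (mul_le_mul_right ?_ _) (mul_le_mul_right ?_ _)
        · rw [← lintegral_indicator hA, ← lintegral_indicator hW,
            ← lintegral_add_right_eq_self (fun x => W.indicator _ x) v]
          refine lintegral_mono fun x => ?_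
          by_cases hx : x ∈ A
          · rw [Set.indicator_of_mem hx, Set.indicator_of_mem (hAW x hx)]
          · simp [Set.indicator_of_notMem hx]
        · exact lintegral_enorm_translate_sub_sq_le hφ1 hA hΩ v h
    _ ≤ _ := by
        push_cast
        rw [← enorm_eq_nnnorm, mul_add, ← mul_assoc]
        gcongr
        · exact le_self_add
        · exact le_add_self

end Controls

/-- In a connected open set, each point has a neighbourhood on which square norms are controlled
by those on any given subset of positive measure. -/
theorem exists_nhds_controls {n : ℕ} {Ω : Set (E n)} (ho : IsOpen Ω) (hcon : IsPreconnected Ω)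
    {W : Set (E n)} (hW : W ⊆ Ω) (hW0 : volume W ≠ 0) {x : E n} (hx : x ∈ Ω) :
    ∃ U ∈ 𝓝 x, Controls Ω (volume.restrict U) (volume.restrict W) := by
  -- Connectedness argument: S is open, it meets Ω because otherwise W would be locally null, and it
  -- is closed relative to Ω because overlapping balls pass control to each other.
  set S := {x | ∃ U ∈ 𝓝 x, Controls Ω (volume.restrict U) (volume.restrict W)} with hS
  have hball : ∀ y ∈ Ω, ∃ ε > 0, Metric.ball y ε ⊆ Ω := fun y hy => Metric.isOpen_iff.1 ho y hy
  have hSo : IsOpen S := by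
    refine isOpen_iff_mem_nhds.2 ?_
    rintro y ⟨U, hU, h⟩
    filter_upwards [eventually_mem_nhds_iff.2 hU] with z hz using ⟨U, hz, h⟩
  have hne : (Ω ∩ S).Nonempty := by
    by_contra hcontra
    apply hW0
    refine measure_null_of_locally_null W fun y hy => ?_
    obtain ⟨ε, hε, hb⟩ := hball y (hW hy)
    refine ⟨Metric.ball y ε ∩ W, inter_mem (mem_nhdsWithin_of_mem_nhds
      (Metric.ball_mem_nhds y hε)) self_mem_nhdsWithin, ?_⟩
    · by_contra h0
      refine hcontra ⟨y, hW hy, Metric.ball y ε, Metric.ball_mem_nhds y hε, ?_⟩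
      exact (Controls.of_convex hb Metric.isOpen_ball.measurableSet (convex_ball _ _)
        Metric.isBounded_ball Set.inter_subset_left h0).trans
        (Controls.of_le (Measure.restrict_mono_set _ Set.inter_subset_right))
  have hsub : Ω ⊆ S := by
    refine hcon.subset_of_closure_inter_subset hSo hne ?_
    rintro y ⟨hy, hyΩ⟩
    obtain ⟨ε, hε, hb⟩ := hball y hyΩ
    obtain ⟨z, hzb, U, hU, h⟩ := mem_closure_iff_nhds.1 hy _ (Metric.ball_mem_nhds y hε)
    refine ⟨Metric.ball y ε, Metric.ball_mem_nhds y hε, ?_⟩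
    -- The overlap has interior points, so it can serve as the set of positive measure that controls
    -- the whole ball around y.
    have hpos : volume (Metric.ball y ε ∩ U) ≠ 0 :=
      (Measure.measure_pos_of_mem_nhds volume
        (inter_mem (Metric.isOpen_ball.mem_nhds hzb) hU)).ne'
    exact (Controls.of_convex hb Metric.isOpen_ball.measurableSet (convex_ball _ _)
        Metric.isBounded_ball Set.inter_subset_left hpos).trans
        ((Controls.of_le (Measure.restrict_mono_set _ Set.inter_subset_right)).trans h)
  exact hsub hx

/-! ### Surface measure and Fubini over a Lipschitz graph -/

section Graph

variable {n : ℕ} {e : E n}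

theorem pos_of_norm_eq_one (he : ‖e‖ = 1) : 0 < n := by
  rcases Nat.eq_zero_or_pos n with rfl | h
  · rw [Subsingleton.elim e 0, norm_zero] at he
    exact absurd he zero_ne_one
  · exact h

theorem finrank_orthogonal_span (he : ‖e‖ = 1) :
    Module.finrank ℝ (ℝ ∙ e)ᗮ = n - 1 := by
  have hn := pos_of_norm_eq_one he
  have : Fact (Module.finrank ℝ (E n) = (n - 1) + 1) :=
    ⟨by rw [finrank_euclideanSpace_fin]; omega⟩
  exact Submodule.finrank_orthogonal_span_singleton (by rintro rfl; simp at he)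

/-- Fubini for the orthogonal splitting into the hyperplane e^⊥ and the line along e, the latter
parametrised isometrically by t ↦ t e. -/
theorem lintegral_eq_orthogonal (he : ‖e‖ = 1) {f : E n → ℝ≥0∞} (hf : Measurable f) :
    ∫⁻ x, f x = ∫⁻ y : (ℝ ∙ e)ᗮ, ∫⁻ t : ℝ, f ((y : E n) + t • e) := by
  have h1 := (Submodule.measurePreserving_measurableEquivProd (ℝ ∙ e) (0 : E n)).symm
  rw [InnerProductSpace.euclideanHausdorffMeasure_eq_volume] at h1
  have h2 : MeasurePreserving (LinearIsometryEquiv.toSpanUnitSingleton (𝕜 := ℝ) e he) :=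
    LinearIsometryEquiv.measurePreserving _
  rw [← h1.lintegral_comp hf, Measure.volume_eq_prod,
    lintegral_prod_symm' (fun a => f (((ℝ ∙ e).measurableEquivProd 0).symm a))
      (hf.comp (MeasurableEquiv.measurable _))]
  · refine lintegral_congr fun y => ?_
    rw [← h2.lintegral_comp_emb 
      (LinearIsometryEquiv.toSpanUnitSingleton (𝕜 := ℝ) e he).toHomeomorph.measurableEmbedding]
    refine lintegral_congr fun t => ?_
    simp [Submodule.measurableEquivProd_symm_apply, add_comm]

variable {K : ℝ≥0} {ψ : E n → ℝ}

/-- The points at distance at most `τ` above a piece of the graph of `ψ`, in direction `e`. -/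
def aboveGraph (e : E n) (ψ : E n → ℝ) (Γ : Set (E n)) (τ : ℝ) : Set (E n) :=
  {x | x - (inner ℝ e x - ψ x) • e ∈ Γ ∧ inner ℝ e x - ψ x ∈ Set.Ioc 0 τ}

theorem measurableSet_aboveGraph (hψ : Continuous ψ) {Γ : Set (E n)} (hΓ : MeasurableSet Γ)
    (τ : ℝ) : MeasurableSet (aboveGraph e ψ Γ τ) :=
  (hΓ.preimage (Continuous.measurable (by fun_prop))).inter
    (measurableSet_Ioc.preimage (Continuous.measurable (by fun_prop)))

theorem orthogonal_add_inner_smul (he : ‖e‖ = 1) (z : E n) :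
    ((ℝ ∙ e)ᗮ.orthogonalProjectionOnto z : E n) + (inner ℝ e z : ℝ) • e = z := by
  have h1 := Submodule.starProjection_unit_singleton ℝ he z
  have h2 := (ℝ ∙ e).starProjection_add_starProjection_orthogonal z
  rw [h1, add_comm] at h2
  simpa using h2

theorem inner_orthogonal (y : (ℝ ∙ e)ᗮ) : inner ℝ e (y : E n) = 0 :=
  Submodule.mem_orthogonal_singleton_iff_inner_right.1 y.2

theorem apply_projection (hψe : ∀ (y : E n) (t : ℝ), ψ (y + t • e) = ψ y) (he : ‖e‖ = 1) (z : E n) :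
    ψ ((ℝ ∙ e)ᗮ.orthogonalProjectionOnto z : E n) = ψ z := by
  conv_rhs => rw [← orthogonal_add_inner_smul he z, hψe]

/-- The projection along `e` compares the surface measure on a graph with Lebesgue measure. -/
theorem map_projection_surf (hψ : LipschitzWith K ψ)
    (hψe : ∀ (y : E n) (t : ℝ), ψ (y + t • e) = ψ y) (he : ‖e‖ = 1) {Γ : Set (E n)}
    (hΓψ : ∀ z ∈ Γ, ψ z = inner ℝ e z) :
    (volume.restrict ((fun y : (ℝ ∙ e)ᗮ => (y : E n) + ψ y • e) ⁻¹' Γ)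
      ≤ ((surf n).restrict Γ).map (ℝ ∙ e)ᗮ.orthogonalProjectionOnto) ∧
    ((surf n).restrict Γ).map (ℝ ∙ e)ᗮ.orthogonalProjectionOnto
      ≤ ((K + 1 : ℝ≥0) ^ (n - 1) : ℝ≥0∞) •
        volume.restrict ((fun y : (ℝ ∙ e)ᗮ => (y : E n) + ψ y • e) ⁻¹' Γ) := by
  set P := (ℝ ∙ e)ᗮ.orthogonalProjectionOnto (𝕜 := ℝ) with hP
  set γ := fun y : (ℝ ∙ e)ᗮ => (y : E n) + ψ y • e with hγ
  have hPγ : ∀ z ∈ Γ, γ (P z) = z := fun z hz => by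
    simp only [hγ, hP, apply_projection hψe he, hΓψ z hz]
    exact orthogonal_add_inner_smul he z
  have hγP : ∀ y, P (γ y) = y := fun y => by
    simp [hγ, hP]
  have hγL : LipschitzWith (K + 1) γ := by
    have h1 : LipschitzWith K fun y : (ℝ ∙ e)ᗮ => ψ y • e := by
      refine LipschitzWith.of_dist_le_mul fun x y => ?_
      rw [dist_eq_norm, ← sub_smul, norm_smul, he, mul_one, ← dist_eq_norm]
      exact hψ.dist_le_mul _ _
    have h2 : LipschitzWith 1 fun y : (ℝ ∙ e)ᗮ => (y : E n) := LipschitzWith.subtype_val _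
    rw [add_comm]
    exact h2.add h1
  have hPL : LipschitzWith 1 P := by
    refine LipschitzWith.of_dist_le_mul fun x y => ?_
    rw [dist_eq_norm, ← map_sub, NNReal.coe_one, one_mul, dist_eq_norm]
    exact Submodule.norm_orthogonalProjectionOnto_apply_le _ _
  have hvol : (volume : Measure (ℝ ∙ e)ᗮ) = μHE[n - 1] := by
    rw [← InnerProductSpace.euclideanHausdorffMeasure_eq_volume, finrank_orthogonal_span he]
  have hPm : Measurable P := P.continuous.measurable
  constructor
  · refine Measure.le_iff.2 fun B hB => ?_
    rw [Measure.map_apply hPm hB, Measure.restrict_apply hB,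
      Measure.restrict_apply (hPm hB), hvol, surf]
    -- Lower bound: the orthogonal projection is 1-Lipschitz and does not increase Hausdorff
    -- measure.
    have hsub : B ∩ γ ⁻¹' Γ ⊆ P '' (P ⁻¹' B ∩ Γ) := fun y hy =>
      ⟨γ y, ⟨by simpa [hγP] using hy.1, hy.2⟩, hγP y⟩
    refine (measure_mono hsub).trans ?_
    simp only [Measure.euclideanHausdorffMeasure_def, Measure.smul_apply]
    gcongr
    simpa using hPL.hausdorffMeasure_image_le (d := (n - 1 : ℕ)) (by positivity) (P ⁻¹' B ∩ Γ)
  · refine Measure.le_iff.2 fun B hB => ?_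
    rw [Measure.map_apply hPm hB, Measure.smul_apply, Measure.restrict_apply hB,
      Measure.restrict_apply (hPm hB), hvol, surf]
    -- Upper bound: the graph map is (K + 1)-Lipschitz and inverts the projection on Γ.
    have hsub : P ⁻¹' B ∩ Γ ⊆ γ '' (B ∩ γ ⁻¹' Γ) := fun z hz =>
      ⟨P z, ⟨hz.1, by simpa [hPγ z hz.2] using hz.2⟩, hPγ z hz.2⟩
    refine (measure_mono hsub).trans ?_
    simp only [Measure.euclideanHausdorffMeasure_def, Measure.smul_apply]
    rw [smul_comm]
    gcongr
    simpa using hγL.hausdorffMeasure_image_le (d := (n - 1 : ℕ)) (by positivity) (B ∩ γ ⁻¹' Γ)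

/-- Fubini in graph coordinates. On each line the shift by ψ(y) preserves Lebesgue measure, so the
only loss is the comparison of the surface measure with its projection to e^⊥. -/
theorem lintegral_aboveGraph (hψ : LipschitzWith K ψ)
    (hψe : ∀ (y : E n) (t : ℝ), ψ (y + t • e) = ψ y) (he : ‖e‖ = 1) {Γ : Set (E n)} (hΓ : MeasurableSet Γ)
    (hΓψ : ∀ z ∈ Γ, ψ z = inner ℝ e z) (τ : ℝ) {f : E n → ℝ≥0∞} (hf : Measurable f) :
    (∫⁻ x in aboveGraph e ψ Γ τ, f x
      ≤ ∫⁻ z in Γ, ∫⁻ t in Set.Ioc 0 τ, f (z + t • e) ∂(volume : Measure ℝ) ∂(surf n)) ∧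
    ∫⁻ z in Γ, ∫⁻ t in Set.Ioc 0 τ, f (z + t • e) ∂(volume : Measure ℝ) ∂(surf n)
      ≤ ((K + 1 : ℝ≥0) ^ (n - 1) : ℝ≥0∞) * ∫⁻ x in aboveGraph e ψ Γ τ, f x := by
  obtain ⟨h1, h2⟩ := map_projection_surf hψ hψe he hΓψ
  set P := (ℝ ∙ e)ᗮ.orthogonalProjectionOnto (𝕜 := ℝ) with hP
  set γ := fun y : (ℝ ∙ e)ᗮ => (y : E n) + ψ y • e with hγ
  have hψc := hψ.continuous
  have hA := measurableSet_aboveGraph (e := e) hψc hΓ τ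
  have hPm : Measurable P := P.continuous.measurable
  have hγm : Measurable γ := Continuous.measurable (by fun_prop)
  set g : (ℝ ∙ e)ᗮ → ℝ≥0∞ := fun y => ∫⁻ t in Set.Ioc 0 τ, f (γ y + t • e) with hg
  have hgm : Measurable g := by
    refine Measurable.lintegral_prod_right' (f := fun p : (ℝ ∙ e)ᗮ × ℝ => f (γ p.1 + p.2 • e)) ?_
    exact hf.comp (by fun_prop)
  have e1 : ∫⁻ z in Γ, ∫⁻ t in Set.Ioc 0 τ, f (z + t • e) ∂(volume : Measure ℝ) ∂(surf n)
      = ∫⁻ y, g y ∂(((surf n).restrict Γ).map P) := by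
    rw [lintegral_map hgm hPm]
    refine setLIntegral_congr_fun hΓ fun z hz => ?_
    simp only [hg, hγ, hP, apply_projection hψe he, hΓψ z hz, orthogonal_add_inner_smul he]
  have e2 : ∫⁻ x in aboveGraph e ψ Γ τ, f x = ∫⁻ y in γ ⁻¹' Γ, g y := by
    rw [← lintegral_indicator hA, lintegral_eq_orthogonal he (hf.indicator hA),
      ← lintegral_indicator (hγm hΓ)]
    refine lintegral_congr fun y => ?_
    rw [← lintegral_add_left_eq_self _ (ψ y)]
    have key : ∀ t : ℝ, (y : E n) + (ψ y + t) • e ∈ aboveGraph e ψ Γ τ ↔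
        γ y ∈ Γ ∧ t ∈ Set.Ioc 0 τ := by
      intro t
      have : inner ℝ e ((y : E n) + (ψ y + t) • e) - ψ ((y : E n) + (ψ y + t) • e) = t := by
        rw [hψe, inner_add_right, inner_orthogonal, inner_smul_right,
          real_inner_self_eq_norm_sq, he]
        ring
      simp only [aboveGraph, Set.mem_ofPred_eq, this, hγ]
      rw [add_smul, ← add_assoc, add_sub_cancel_right]
    by_cases hy : γ y ∈ Γ
    · simp only [Set.indicator_of_mem (show y ∈ γ ⁻¹' Γ from hy), hg]
      rw [← lintegral_indicator measurableSet_Ioc]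
      refine lintegral_congr fun t => ?_
      by_cases ht : t ∈ Set.Ioc 0 τ
      · rw [Set.indicator_of_mem ((key t).2 ⟨hy, ht⟩), Set.indicator_of_mem ht, add_smul,
          ← add_assoc]
      · rw [Set.indicator_of_notMem (fun h => ht ((key t).1 h).2), Set.indicator_of_notMem ht]
    · rw [Set.indicator_of_notMem (by exact hy)]
      simp [Set.indicator, key, hy]
  rw [e1, e2]
  refine ⟨lintegral_mono' h1 le_rfl, (lintegral_mono' h2 le_rfl).trans ?_⟩
  rw [lintegral_smul_measure, smul_eq_mul]

end Graph

/-! ### Boundary charts and local trace inequalities -/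

/-- In the ball of radius `δ` around `x₀`, the set `Ω` lies above the graph of the Lipschitz
function `ψ` in direction `e`. -/
structure IsChart {n : ℕ} (Ω : Set (E n)) (x₀ e : E n) (δ : ℝ) (K : ℝ≥0) (ψ : E n → ℝ) :
    Prop where
  norm_eq : ‖e‖ = 1
  pos : 0 < δ
  lip : LipschitzWith K ψ
  apply_add : ∀ (y : E n) (t : ℝ), ψ (y + t • e) = ψ y
  mem_iff : ∀ y ∈ Metric.ball x₀ δ, y ∈ Ω ↔ ψ y < inner ℝ e y

namespace IsChart

variable {n : ℕ} {Ω : Set (E n)} {x₀ e : E n} {δ : ℝ} {K : ℝ≥0} {ψ : E n → ℝ}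

theorem inner_add_smul (h : IsChart Ω x₀ e δ K ψ) (y : E n) (t : ℝ) :
    inner ℝ e (y + t • e) = inner ℝ e y + t := by
  rw [inner_add_right, inner_smul_right, real_inner_self_eq_norm_sq, h.norm_eq]
  ring

theorem mem_closure_iff (h : IsChart Ω x₀ e δ K ψ) {y : E n} (hy : y ∈ Metric.ball x₀ δ) :
    y ∈ closure Ω ↔ ψ y ≤ inner ℝ e y := by
  have hψ := h.lip.continuous
  constructor
  · intro hc
    have hc' : y ∈ closure (Ω ∩ Metric.ball x₀ δ) := by
      rw [Set.inter_comm]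
      exact Metric.isOpen_ball.inter_closure ⟨hy, hc⟩
    have hcl : IsClosed {z : E n | ψ z ≤ inner ℝ e z} := isClosed_le hψ (by fun_prop)
    exact closure_minimal (fun z hz => ((h.mem_iff z hz.2).1 hz.1).le) hcl hc'
  · intro hle
    have ht : Tendsto (fun t : ℝ => y + t • e) (𝓝[>] 0) (𝓝 y) := by
      have : Continuous fun t : ℝ => y + t • e := by fun_prop
      simpa using (this.tendsto 0).mono_left nhdsWithin_le_nhds
    refine mem_closure_of_tendsto ht ?_
    filter_upwards [ht (Metric.isOpen_ball.mem_nhds hy), self_mem_nhdsWithin] with t ht1 ht2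
    rw [h.mem_iff _ ht1, h.apply_add, h.inner_add_smul]
    have : 0 < t := ht2
    linarith

theorem add_smul_mem (h : IsChart Ω x₀ e δ K ψ) {y : E n} (hy : y ∈ Metric.ball x₀ δ)
    (hyΩ : y ∈ closure Ω) {t : ℝ} (ht : 0 < t) (hyt : y + t • e ∈ Metric.ball x₀ δ) :
    y + t • e ∈ Ω := by
  rw [h.mem_closure_iff hy] at hyΩ
  rw [h.mem_iff _ hyt, h.apply_add, h.inner_add_smul]
  linarith

theorem eq_inner_of_mem_frontier (h : IsChart Ω x₀ e δ K ψ) (ho : IsOpen Ω) {y : E n}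
    (hy : y ∈ Metric.ball x₀ δ) (hyΩ : y ∈ frontier Ω) : ψ y = inner ℝ e y := by
  rw [ho.frontier_eq] at hyΩ
  have h1 := (h.mem_closure_iff hy).1 hyΩ.1
  have h2 := mt (h.mem_iff y hy).2 hyΩ.2
  exact le_antisymm h1 (not_lt.1 h2)

theorem add_smul_mem_ball (h : IsChart Ω x₀ e δ K ψ) {r s : ℝ} {y : E n}
    (hy : y ∈ Metric.ball x₀ r) {t : ℝ} (ht : 0 ≤ t) (hts : r + t ≤ s) :
    y + t • e ∈ Metric.ball x₀ s := by
  rw [Metric.mem_ball] at hy ⊢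
  calc dist (y + t • e) x₀ ≤ dist (y + t • e) y + dist y x₀ := dist_triangle _ _ _
    _ = t + dist y x₀ := by
        rw [dist_eq_norm, add_sub_cancel_left, norm_smul, h.norm_eq, mul_one,
          Real.norm_of_nonneg ht]
    _ < s := by linarith

theorem aboveGraph_subset (h : IsChart Ω x₀ e δ K ψ) {Γ : Set (E n)}
    (hΓ : Γ ⊆ frontier Ω ∩ Metric.ball x₀ (δ / 2)) : aboveGraph e ψ Γ (δ / 2) ⊆ Ω := by
  rintro x ⟨hx, hpos, hle⟩
  have hb := (hΓ hx).2
  have hδ := h.pos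
  have := h.add_smul_mem (Metric.ball_subset_ball (by linarith) hb)
    (frontier_subset_closure (hΓ hx).1) hpos (h.add_smul_mem_ball hb hpos.le (by linarith))
  simpa using this

/-- On a segment of length τ = δ/2 rising from a boundary point, φ changes by at most the integral
of its gradient. Integrated over the strip above Γ and read in one direction, this bounds boundary
values by interior ones (trace); read in the other, it bounds the strip by the boundary
(Friedrichs). -/
theorem lintegral_pair_bounds (h : IsChart Ω x₀ e δ K ψ) (ho : IsOpen Ω) {Γ : Set (E n)}
    (hΓm : MeasurableSet Γ) (hΓ : Γ ⊆ frontier Ω ∩ Metric.ball x₀ (δ / 2)) :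
    Controls Ω ((surf n).restrict Γ) (volume.restrict Ω) ∧
    Controls Ω (volume.restrict (aboveGraph e ψ Γ (δ / 2))) ((surf n).restrict Γ) := by
  have hδ := h.pos
  set τ := δ / 2 with hτ
  have hτ0 : 0 < τ := by positivity
  have hsub := h.aboveGraph_subset hΓ
  have hΓψ : ∀ z ∈ Γ, ψ z = inner ℝ e z := fun z hz =>
    h.eq_inner_of_mem_frontier ho (Metric.ball_subset_ball (by linarith) (hΓ hz).2) (hΓ hz).1
  set T := ENNReal.ofReal τ with hT
  have hT0 : T ≠ 0 := by simpa [hT] using hτ0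
  have hTt : T ≠ ⊤ := by simp [hT]
  set L : ℝ≥0 := (K + 1) ^ (n - 1) with hL
  have hvol : volume (Set.Ioc 0 τ) = T := by simp [hT]
  have hI : ∀ f : E n → ℝ≥0∞, Measurable f → _ := fun f hf =>
    lintegral_aboveGraph h.lip h.apply_add h.norm_eq hΓm hΓψ τ hf
  have hIle : ∀ f : E n → ℝ≥0∞, Measurable f →
      ∫⁻ z in Γ, ∫⁻ t in Set.Ioc 0 τ, f (z + t • e) ∂(volume : Measure ℝ) ∂(surf n)
        ≤ L * ∫⁻ x in Ω, f x := fun f hf => by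
    refine (hI f hf).2.trans ?_
    rw [hL]
    push_cast
    gcongr
  have hgrad : ∀ φ : E n → ℝ, ContDiff ℝ ∞ φ → Measurable fun x => ‖gradient φ x‖ₑ ^ 2 :=
    fun φ hφ => by
      have := continuous_gradient (hφ.of_le (m := 1) (by norm_cast))
      exact Continuous.measurable (by fun_prop)
  have hline : ∀ φ : E n → ℝ, ContDiff ℝ ∞ φ → ∀ z, ∀ t ∈ Set.Ioc 0 τ,
      ‖φ (z + t • e) - φ z‖ₑ ^ 2
        ≤ T * ∫⁻ s in Set.Ioc 0 τ, ‖gradient φ (z + s • e)‖ₑ ^ 2 := by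
    intro φ hφ z t ht
    refine (enorm_sub_sq_le_lintegral_gradient (hφ.of_le (by norm_cast)) z e ht.1.le).trans ?_
    have : ‖e‖ₑ = 1 := by rw [← ofReal_norm, h.norm_eq, ENNReal.ofReal_one]
    rw [this, one_pow, one_mul]
    gcongr
    · exact ENNReal.ofReal_le_ofReal ht.2
    · exact ht.2
  have hmz : ∀ f : E n → ℝ≥0∞, Measurable f →
      Measurable fun z => ∫⁻ t in Set.Ioc 0 τ, f (z + t • e) ∂(volume : Measure ℝ) := by
    intro f hf
    refine Measurable.lintegral_prod_right' (f := fun p : E n × ℝ => f (p.1 + p.2 • e)) ?_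
    exact hf.comp (by fun_prop)
  constructor
  · refine ⟨(T⁻¹ * (2 * L + 2 * T * T * L)).toNNReal, fun φ hφ => ?_⟩
    rw [ENNReal.coe_toNNReal (by finiteness), mul_assoc, mul_comm, ← div_eq_mul_inv,
      ENNReal.le_div_iff_mul_le (Or.inl hT0) (Or.inl hTt), mul_comm]
    have hφc := hφ.continuous
    have hφm : Measurable fun x => ‖φ x‖ₑ ^ 2 := Continuous.measurable (by fun_prop)
    have hpt : ∀ z, T * ‖φ z‖ₑ ^ 2 ≤
        2 * (∫⁻ t in Set.Ioc 0 τ, ‖φ (z + t • e)‖ₑ ^ 2) +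
          2 * T * T * ∫⁻ s in Set.Ioc 0 τ, ‖gradient φ (z + s • e)‖ₑ ^ 2 := by
      intro z
      calc T * ‖φ z‖ₑ ^ 2 = ∫⁻ t in Set.Ioc 0 τ, ‖φ z‖ₑ ^ 2 := by simp [hT, mul_comm]
        _ ≤ ∫⁻ t in Set.Ioc 0 τ, (2 * ‖φ (z + t • e)‖ₑ ^ 2 +
              2 * (T * ∫⁻ s in Set.Ioc 0 τ, ‖gradient φ (z + s • e)‖ₑ ^ 2)) := by
            refine setLIntegral_mono' measurableSet_Ioc fun t ht => ?_
            refine (enorm_sq_le_sub (φ z) (φ (z + t • e))).trans ?_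
            gcongr
            exact hline φ hφ z t ht
        _ = _ := by
            rw [lintegral_add_right _ measurable_const, lintegral_const_mul' _ _ (by simp),
              lintegral_const, Measure.restrict_apply_univ, hvol]
            ring
    calc T * ∫⁻ z in Γ, ‖φ z‖ₑ ^ 2 ∂(surf n)
        = ∫⁻ z in Γ, T * ‖φ z‖ₑ ^ 2 ∂(surf n) := by rw [lintegral_const_mul' _ _ hTt]
      _ ≤ ∫⁻ z in Γ, (2 * (∫⁻ t in Set.Ioc 0 τ, ‖φ (z + t • e)‖ₑ ^ 2) +
          2 * T * T * ∫⁻ s in Set.Ioc 0 τ, ‖gradient φ (z + s • e)‖ₑ ^ 2) ∂(surf n) :=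
          lintegral_mono fun z => hpt z
      _ = 2 * (∫⁻ z in Γ, ∫⁻ t in Set.Ioc 0 τ, ‖φ (z + t • e)‖ₑ ^ 2
            ∂(volume : Measure ℝ) ∂(surf n)) +
          2 * T * T * ∫⁻ z in Γ, ∫⁻ t in Set.Ioc 0 τ, ‖gradient φ (z + t • e)‖ₑ ^ 2
            ∂(volume : Measure ℝ) ∂(surf n) := by
          rw [lintegral_add_left ((hmz _ hφm).const_mul _), lintegral_const_mul' _ _ (by simp),
            lintegral_const_mul' _ _ (by finiteness)]
      _ ≤ 2 * (L * ∫⁻ x in Ω, ‖φ x‖ₑ ^ 2) +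
          2 * T * T * (L * ∫⁻ x in Ω, ‖gradient φ x‖ₑ ^ 2) := by
          gcongr
          · exact hIle _ hφm
          · exact hIle _ (hgrad φ hφ)
      _ ≤ _ := by
          rw [← mul_assoc 2, ← mul_assoc (2 * T * T), mul_add]
          gcongr
          · exact le_self_add
          · exact le_add_self
  · refine ⟨(2 * T + 2 * T * T * L).toNNReal, fun φ hφ => ?_⟩
    rw [ENNReal.coe_toNNReal (by finiteness)]
    have hφc := hφ.continuous
    have hφm : Measurable fun x => ‖φ x‖ₑ ^ 2 := Continuous.measurable (by fun_prop)
    have hpt : ∀ z, ∫⁻ t in Set.Ioc 0 τ, ‖φ (z + t • e)‖ₑ ^ 2 ≤ 2 * T * ‖φ z‖ₑ ^ 2 +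
        2 * T * T * ∫⁻ s in Set.Ioc 0 τ, ‖gradient φ (z + s • e)‖ₑ ^ 2 := by
      intro z
      calc ∫⁻ t in Set.Ioc 0 τ, ‖φ (z + t • e)‖ₑ ^ 2
          ≤ ∫⁻ t in Set.Ioc 0 τ, (2 * ‖φ z‖ₑ ^ 2 +
              2 * (T * ∫⁻ s in Set.Ioc 0 τ, ‖gradient φ (z + s • e)‖ₑ ^ 2)) := by
            refine setLIntegral_mono' measurableSet_Ioc fun t ht => ?_
            refine (enorm_sq_le_sub (φ (z + t • e)) (φ z)).trans ?_
            rw [enorm_sub_rev]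
            gcongr
            exact hline φ hφ z t ht
        _ = _ := by
            rw [lintegral_const, Measure.restrict_apply_univ, hvol]
            ring
    calc ∫⁻ x in aboveGraph e ψ Γ τ, ‖φ x‖ₑ ^ 2
        ≤ ∫⁻ z in Γ, ∫⁻ t in Set.Ioc 0 τ, ‖φ (z + t • e)‖ₑ ^ 2
            ∂(volume : Measure ℝ) ∂(surf n) := (hI _ hφm).1
      _ ≤ ∫⁻ z in Γ, (2 * T * ‖φ z‖ₑ ^ 2 +
        2 * T * T * ∫⁻ s in Set.Ioc 0 τ, ‖gradient φ (z + s • e)‖ₑ ^ 2) ∂(surf n) :=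
          lintegral_mono fun z => hpt z
      _ = 2 * T * (∫⁻ z in Γ, ‖φ z‖ₑ ^ 2 ∂(surf n)) +
          2 * T * T * ∫⁻ z in Γ, ∫⁻ t in Set.Ioc 0 τ, ‖gradient φ (z + t • e)‖ₑ ^ 2
            ∂(volume : Measure ℝ) ∂(surf n) := by
          rw [lintegral_add_left (hφm.const_mul _), lintegral_const_mul' _ _ (by finiteness),
            lintegral_const_mul' _ _ (by finiteness)]
      _ ≤ 2 * T * (∫⁻ z in Γ, ‖φ z‖ₑ ^ 2 ∂(surf n)) +
          2 * T * T * (L * ∫⁻ x in Ω, ‖gradient φ x‖ₑ ^ 2) := by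
          gcongr
          exact hIle _ (hgrad φ hφ)
      _ ≤ _ := by
          rw [← mul_assoc (2 * T * T), mul_add]
          gcongr
          · exact le_self_add
          · exact le_add_self

/-- The graph form of Fubini for the constant 1 bounds the surface measure of Γ times δ/2 by a
multiple of the volume of the strip. -/
theorem volume_aboveGraph_ne_zero (h : IsChart Ω x₀ e δ K ψ) (ho : IsOpen Ω) {Γ : Set (E n)}
    (hΓm : MeasurableSet Γ) (hΓ : Γ ⊆ frontier Ω ∩ Metric.ball x₀ (δ / 2))
    (h0 : surf n Γ ≠ 0) : volume (aboveGraph e ψ Γ (δ / 2)) ≠ 0 := by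
  have hδ := h.pos
  have hΓψ : ∀ z ∈ Γ, ψ z = inner ℝ e z := fun z hz =>
    h.eq_inner_of_mem_frontier ho (Metric.ball_subset_ball (by linarith) (hΓ hz).2) (hΓ hz).1
  intro hA
  have := (lintegral_aboveGraph h.lip h.apply_add h.norm_eq hΓm hΓψ (δ / 2)
    (f := fun _ => 1) measurable_const).2
  simp only [lintegral_one, hA, Measure.restrict_apply_univ, mul_zero, nonpos_iff_eq_zero,
    lintegral_const, Real.volume_Ioc, sub_zero, mul_eq_zero, h0, or_false,
    ENNReal.ofReal_eq_zero] at this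
  linarith

end IsChart

theorem exists_isChart {n : ℕ} {Ω : Set (E n)} (h : HasLipschitzBoundary Ω) {x₀ : E n}
    (hx : x₀ ∈ frontier Ω) : ∃ e δ K ψ, IsChart Ω x₀ e δ K ψ := by
  obtain ⟨e, he, δ, hδ, K, ψ, hψ, hψe, hΩ⟩ := h x₀ hx
  exact ⟨e, δ, K, ψ, he, hδ, hψ, hψe, hΩ⟩

/-! ### Trace and Friedrichs inequalities on the whole domain -/

section Domain

variable {n : ℕ} {Ω : Set (E n)}

/-- Square norms of smooth functions on a Lipschitz domain are controlled by those on any subset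
of positive measure. -/
theorem controls_of_subset (ho : IsOpen Ω) (hcon : IsPreconnected Ω) (hb : Bornology.IsBounded Ω)
    (hlip : HasLipschitzBoundary Ω) {W : Set (E n)} (hW : W ⊆ Ω) (hW0 : volume W ≠ 0) :
    Controls Ω (volume.restrict Ω) (volume.restrict W) := by
  have hcompact : IsCompact (closure Ω) := hb.isCompact_closure
  have hin := fun x (hx : x ∈ Ω) => exists_nhds_controls ho hcon hW hW0 hx
  have : Controls Ω ((volume.restrict Ω).restrict (closure Ω)) (volume.restrict W) := by
    refine Controls.of_isCompact hcompact fun x₀ hx₀ => ?_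
    by_cases hxΩ : x₀ ∈ Ω
    · obtain ⟨U, hU, h⟩ := hin x₀ hxΩ
      exact ⟨U, hU, (Controls.of_le (Measure.restrict_mono le_rfl Measure.restrict_le_self)).trans h⟩
    · have hfr : x₀ ∈ frontier Ω := by rw [ho.frontier_eq]; exact ⟨hx₀, hxΩ⟩
      obtain ⟨e, δ, K, ψ, h⟩ := exists_isChart hlip hfr
      have hδ := h.pos
      set A := Metric.ball x₀ (δ / 4) ∩ Ω with hA
      have hAm : MeasurableSet A := Metric.isOpen_ball.measurableSet.inter ho.measurableSet
      -- Taking the closure before shifting makes W' a compact subset of Ω, to which the local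
      -- interior control extends; A itself may touch the boundary.
      set W' := (fun y => y + (δ / 4) • e) '' closure A with hW'
      have hW'c : IsCompact W' :=
        (hb.subset Set.inter_subset_right).isCompact_closure.image (by fun_prop)
      have hball : ∀ y ∈ closure A, y ∈ Metric.ball x₀ (δ / 2) := fun y hy => by
        have := Metric.closure_ball_subset_closedBall
          (closure_mono Set.inter_subset_left hy : y ∈ closure (Metric.ball x₀ (δ / 4)))
        rw [Metric.mem_closedBall] at this
        rw [Metric.mem_ball]
        linarith
      have hshift : ∀ y ∈ closure A, ∀ t, 0 < t → t ≤ δ / 4 → y + t • e ∈ Ω :=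
        fun y hy t ht0 ht => h.add_smul_mem (Metric.ball_subset_ball (by linarith) (hball y hy))
          (closure_mono Set.inter_subset_right hy) ht0
          (h.add_smul_mem_ball (hball y hy) ht0.le (by linarith))
      have hW'Ω : W' ⊆ Ω := by
        rintro _ ⟨y, hy, rfl⟩
        exact hshift y hy _ (by positivity) le_rfl
      have c1 : Controls Ω (volume.restrict A) (volume.restrict W') := by
        refine Controls.of_translate hAm hW'c.measurableSet ho.measurableSet ((δ / 4) • e) ?_ ?_
        · intro x hx t ht
          rw [smul_smul]
          have := ht.1
          refine hshift x (subset_closure hx) _ (by positivity) ?_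
          nlinarith [ht.2]
        · exact fun x hx => ⟨x, subset_closure hx, rfl⟩
      refine ⟨Metric.ball x₀ (δ / 4), Metric.ball_mem_nhds _ (by positivity), ?_⟩
      rw [Measure.restrict_restrict Metric.isOpen_ball.measurableSet]
      exact c1.trans (Controls.of_isCompact hW'c fun x hx => hin x (hW'Ω hx))
  rwa [Measure.restrict_restrict isClosed_closure.measurableSet,
    Set.inter_eq_self_of_subset_right subset_closure] at this

/-- Trace inequality on a bounded Lipschitz domain, for smooth functions. -/
theorem controls_surf_frontier (ho : IsOpen Ω) (hb : Bornology.IsBounded Ω)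
    (hlip : HasLipschitzBoundary Ω) :
    Controls Ω ((surf n).restrict (frontier Ω)) (volume.restrict Ω) := by
  have hcompact : IsCompact (frontier Ω) :=
    hb.isCompact_closure.of_isClosed_subset isClosed_frontier frontier_subset_closure
  have : Controls Ω (((surf n).restrict (frontier Ω)).restrict (frontier Ω))
      (volume.restrict Ω) := by
    refine Controls.of_isCompact hcompact fun x₀ hx₀ => ?_
    obtain ⟨e, δ, K, ψ, h⟩ := exists_isChart hlip hx₀
    have hδ := h.pos
    refine ⟨Metric.ball x₀ (δ / 2), Metric.ball_mem_nhds _ (by positivity), ?_⟩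
    rw [Measure.restrict_restrict Metric.isOpen_ball.measurableSet, Set.inter_comm]
    exact (h.lintegral_pair_bounds ho (isClosed_frontier.measurableSet.inter
      Metric.isOpen_ball.measurableSet) le_rfl).1
  rwa [Measure.restrict_restrict isClosed_frontier.measurableSet, Set.inter_self] at this

/-- Friedrichs inequality on a bounded Lipschitz domain, for smooth functions: the square norm is
controlled by that on a part of the boundary of positive measure. -/
theorem controls_by_surf (ho : IsOpen Ω) (hcon : IsPreconnected Ω) (hb : Bornology.IsBounded Ω)
    (hlip : HasLipschitzBoundary Ω) {Γ : Set (E n)} (hΓ : Γ ⊆ frontier Ω)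
    (hΓm : MeasurableSet Γ) (hΓ0 : surf n Γ ≠ 0) :
    Controls Ω (volume.restrict Ω) ((surf n).restrict Γ) := by
  -- Some point of Γ has positive surface measure of Γ in all its neighbourhoods, since otherwise Γ
  -- would be locally null; a chart at that point yields a strip of positive volume.
  have hloc : ∃ x₀ ∈ Γ, ∀ U ∈ 𝓝 x₀, surf n (Γ ∩ U) ≠ 0 := by
    by_contra! hcontra
    refine hΓ0 (measure_null_of_locally_null Γ fun x hx => ?_)
    obtain ⟨U, hU, h0⟩ := hcontra x hx
    exact ⟨Γ ∩ U, inter_mem self_mem_nhdsWithin (mem_nhdsWithin_of_mem_nhds hU), h0⟩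
  obtain ⟨x₀, hx₀, hx⟩ := hloc
  obtain ⟨e, δ, K, ψ, h⟩ := exists_isChart hlip (hΓ hx₀)
  have hδ := h.pos
  have hsub : Γ ∩ Metric.ball x₀ (δ / 2) ⊆ frontier Ω ∩ Metric.ball x₀ (δ / 2) :=
    Set.inter_subset_inter_left _ hΓ
  have hm := hΓm.inter (Metric.isOpen_ball (x := x₀) (ε := δ / 2)).measurableSet
  have h0 := hx _ (Metric.ball_mem_nhds x₀ (half_pos hδ))
  exact (controls_of_subset ho hcon hb hlip (h.aboveGraph_subset hsub)
    (h.volume_aboveGraph_ne_zero ho hm hsub h0)).trans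
    ((h.lintegral_pair_bounds ho hm hsub).2.trans
      (Controls.of_le (Measure.restrict_mono_set _ Set.inter_subset_left)))

/-- The boundary of a bounded Lipschitz domain has finite surface measure. -/
theorem surf_frontier_lt_top (ho : IsOpen Ω) (hb : Bornology.IsBounded Ω)
    (hlip : HasLipschitzBoundary Ω) : surf n (frontier Ω) < ⊤ := by
  obtain ⟨C, hC⟩ := controls_surf_frontier ho hb hlip
  -- The trace inequality for the constant 1 bounds the surface measure by the volume of Ω.
  have := hC (fun _ => 1) contDiff_const
  have hg : ∀ x : E n, gradient (fun _ : E n => (1 : ℝ)) x = 0 := fun x => by simp [gradient]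
  simp only [enorm_one, one_pow, lintegral_one, Measure.restrict_apply_univ, hg, enorm_zero] at this
  refine this.trans_lt ?_
  have := hb.measure_lt_top (μ := volume)
  simp only [ne_eq, OfNat.ofNat_ne_zero, not_false_eq_true, zero_pow, lintegral_zero, add_zero]
  finiteness

end Domain

/-! ### Mollification and Poincaré for weak gradients -/

section WeakGradient

open scoped Convolution
open ContinuousLinearMap (lsmul)

variable {n : ℕ} {Ω : Set (E n)} {w : E n → ℝ} {D : E n → E n}

theorem gradient_apply (f : E n → ℝ) (x : E n) (i : Fin n) :
    gradient f x i = fderiv ℝ f x (EuclideanSpace.single i 1) := by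
  rw [gradient, ← InnerProductSpace.toDual_symm_apply, real_inner_comm,
    EuclideanSpace.inner_single_left]
  simp

theorem locallyIntegrable_indicator {F : Type*} [NormedAddCommGroup F] {f : E n → F}
    (hΩ : MeasurableSet Ω) (hf : MemLp f 2 (volume.restrict Ω)) :
    LocallyIntegrable (Ω.indicator f) volume :=
  ((memLp_indicator_iff_restrict hΩ).2 hf).locallyIntegrable (by norm_num)

/-- The mollification of the function `w` on `Ω`, extended by zero. -/
noncomputable def mollify (Ω : Set (E n)) (ρ : ContDiffBump (0 : E n)) (w : E n → ℝ) : E n → ℝ :=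
  ρ.normed volume ⋆[lsmul ℝ ℝ, volume] (Ω.indicator w)

theorem contDiff_mollify (hΩ : MeasurableSet Ω) (ρ : ContDiffBump (0 : E n))
    (hw : MemLp w 2 (volume.restrict Ω)) : ContDiff ℝ ∞ (mollify Ω ρ w) :=
  ρ.hasCompactSupport_normed.contDiff_convolution_left _ ρ.contDiff_normed
    (locallyIntegrable_indicator hΩ hw)

/-- The reflected kernel centred at x is a test function once its ball fits into Ω. Differentiating
it in y instead of x changes the sign, which cancels the sign in the definition of the weak
gradient. -/
theorem gradient_mollify (hΩ : MeasurableSet Ω) (ρ : ContDiffBump (0 : E n))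
    (hw : MemLp w 2 (volume.restrict Ω)) (hD : MemLp D 2 (volume.restrict Ω))
    (hwD : HasWeakGradient Ω w D) {x : E n} (hx : Metric.closedBall x ρ.rOut ⊆ Ω) :
    gradient (mollify Ω ρ w) x = ∫ y in Ω, ρ.normed volume (x - y) • D y := by
  set r := ρ.normed (volume : Measure (E n)) with hr
  have hrc : ContDiff ℝ ∞ r := ρ.contDiff_normed
  have hrs : HasCompactSupport r := ρ.hasCompactSupport_normed
  have hlw := locallyIntegrable_indicator hΩ hw
  have h1 := hrs.hasFDerivAt_convolution_left (lsmul ℝ ℝ) (hrc.of_le (by norm_cast)) hlw x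
  have hsupp : HasCompactSupport fun y => r (x - y) :=
    hrs.comp_homeomorph (Homeomorph.subLeft x)
  have hint : Integrable (fun y => r (x - y) • D y) (volume.restrict Ω) := by
    have := (locallyIntegrable_indicator hΩ hD).integrable_smul_left_of_hasCompactSupport
      (g := fun y => r (x - y)) (by have := hrc.continuous; fun_prop) hsupp
    have h2 := this.integrableOn (s := Ω)
    refine (integrableOn_congr_fun (fun y hy => ?_) hΩ).1 h2
    simp [Set.indicator_of_mem hy]
  ext i
  have hcoord : (∫ y in Ω, r (x - y) • D y) i = ∫ y in Ω, D y i * r (x - y) := by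
    have := (EuclideanSpace.proj (𝕜 := ℝ) i).integral_comp_comm hint
    simp only [PiLp.proj_apply, PiLp.smul_apply, smul_eq_mul] at this
    rw [← this]
    simp_rw [mul_comm]
  have htest := hwD (fun y => r (x - y)) (hrc.comp (contDiff_const.sub contDiff_id)) hsupp (by
    refine (closure_minimal ?_ Metric.isClosed_closedBall).trans hx
    intro y hy
    have : x - y ∈ Function.support r := hy
    rw [hr, ρ.support_normed_eq] at this
    rw [Metric.mem_closedBall, dist_comm, dist_eq_norm]
    exact (mem_ball_zero_iff.1 this).le) i
  have hder : ∀ y, fderiv ℝ (fun y => r (x - y)) y (EuclideanSpace.single i 1)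
      = - fderiv ℝ r (x - y) (EuclideanSpace.single i 1) := by
    intro y
    have h2 := ((hrc.differentiable (by simp) (x - y)).hasFDerivAt).comp y
        ((hasFDerivAt_id y).const_sub x)
    have h3 : (fun y => r (x - y)) = r ∘ fun y => x - y := rfl
    rw [h3, h2.fderiv]
    simp
  rw [gradient_apply, hcoord, mollify, h1.fderiv, convolution_def,
    ContinuousLinearMap.integral_apply]
  · simp only [ContinuousLinearMap.precompL_apply, ContinuousLinearMap.lsmul_apply, smul_eq_mul]
    rw [← integral_sub_left_eq_self _ volume x]
    simp only [sub_sub_cancel, hder, mul_neg, integral_neg, neg_inj] at htest ⊢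
    rw [← htest, ← integral_indicator hΩ]
    congr 1
    ext y
    by_cases hy : y ∈ Ω <;> simp [hy, mul_comm]
  · exact (hrs.fderiv ℝ).convolutionExists_left _ (hrc.continuous_fderiv (by simp)) hlw x

theorem lintegral_normed (ρ : ContDiffBump (0 : E n)) (x : E n) :
    ∫⁻ y, ENNReal.ofReal (ρ.normed volume (x - y)) = 1 := by
  rw [lintegral_sub_left_eq_self (fun y => ENNReal.ofReal (ρ.normed volume y)) x,
    ← ofReal_integral_eq_lintegral_ofReal ρ.integrable_normed
      (Eventually.of_forall ρ.nonneg_normed), ρ.integral_normed, ENNReal.ofReal_one]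

theorem lintegral_normed' (ρ : ContDiffBump (0 : E n)) (y : E n) :
    ∫⁻ x, ENNReal.ofReal (ρ.normed volume (x - y)) = 1 := by
  rw [← lintegral_normed ρ y]
  refine lintegral_congr fun x => ?_
  rw [← neg_sub, ρ.normed_neg]

theorem normed_eq_zero (ρ : ContDiffBump (0 : E n)) {x y : E n}
    (h : y ∉ Metric.closedBall x ρ.rOut) : ρ.normed volume (x - y) = 0 := by
  by_contra h0
  have : x - y ∈ Function.support (ρ.normed (volume : Measure (E n))) := h0
  rw [ρ.support_normed_eq] at this
  apply h
  rw [Metric.mem_closedBall, dist_comm, dist_eq_norm]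
  exact (mem_ball_zero_iff.1 this).le

/-- Jensen's inequality: near x the kernel is a probability density on U, so the left side is the
squared norm of an average of D − a. -/
theorem enorm_gradient_mollify_sub_sq_le (hΩ : MeasurableSet Ω) (ρ : ContDiffBump (0 : E n))
    (hw : MemLp w 2 (volume.restrict Ω)) (hD : MemLp D 2 (volume.restrict Ω))
    (hwD : HasWeakGradient Ω w D) {U : Set (E n)} (hU : MeasurableSet U) (hUΩ : U ⊆ Ω)
    {x : E n} (hx : Metric.closedBall x ρ.rOut ⊆ U) (a : E n) :
    ‖gradient (mollify Ω ρ w) x - a‖ₑ ^ 2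
      ≤ ∫⁻ y in U, ENNReal.ofReal (ρ.normed volume (x - y)) * ‖D y - a‖ₑ ^ 2 := by
  set r := ρ.normed (volume : Measure (E n)) with hr
  have hrc : Continuous r := ρ.continuous_normed
  have hrm : Measurable fun y => ENNReal.ofReal (r (x - y)) := by fun_prop
  have hrU : ∀ y, y ∉ U → r (x - y) = 0 := fun y hy => normed_eq_zero ρ fun h => hy (hx h)
  have hDU : AEStronglyMeasurable D (volume.restrict U) :=
    hD.1.mono_measure (Measure.restrict_mono_set _ hUΩ)
  have hDm : AEMeasurable (fun y => ‖D y - a‖ₑ) (volume.restrict U) :=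
    (hDU.sub aestronglyMeasurable_const).enorm
  have hone : ∫⁻ y in U, ENNReal.ofReal (r (x - y)) = 1 := by
    rw [← lintegral_normed ρ x, ← lintegral_indicator hU]
    refine lintegral_congr fun y => ?_
    by_cases hy : y ∈ U
    · simp [hy, hr]
    · simp [hy, ← hr, hrU y hy]
  have hintr : Integrable (fun y => r (x - y)) (volume.restrict U) :=
    (ρ.integrable_normed.comp_sub_left x).integrableOn
  have hintD : Integrable (fun y => r (x - y) • D y) (volume.restrict U) := by
    have hsupp : HasCompactSupport fun y => r (x - y) :=
      ρ.hasCompactSupport_normed.comp_homeomorph (Homeomorph.subLeft x)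
    have := (locallyIntegrable_indicator hΩ hD).integrable_smul_left_of_hasCompactSupport
      (g := fun y => r (x - y)) (by fun_prop) hsupp
    refine (integrableOn_congr_fun (fun y hy => ?_) hU).1 (this.integrableOn (s := U))
    simp [Set.indicator_of_mem (hUΩ hy)]
  have hreal : ∫ y in U, r (x - y) = 1 := by
    rw [integral_eq_lintegral_of_nonneg_ae (Eventually.of_forall fun y => ρ.nonneg_normed _)
      hintr.1, hone, ENNReal.toReal_one]
  have hgrad : gradient (mollify Ω ρ w) x - a = ∫ y in U, r (x - y) • (D y - a) := by
    simp_rw [smul_sub]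
    rw [integral_sub hintD (hintr.smul_const a), integral_smul_const, hreal, one_smul,
      gradient_mollify hΩ ρ hw hD hwD (hx.trans hUΩ)]
    congr 1
    refine (setIntegral_eq_of_subset_of_forall_sdiff_eq_zero hΩ hUΩ fun y hy => ?_)
    rw [← hr, hrU y hy.2, zero_smul]
  rw [hgrad]
  set ν := (volume.restrict U).withDensity fun y => ENNReal.ofReal (r (x - y)) with hν
  calc ‖∫ y in U, r (x - y) • (D y - a)‖ₑ ^ 2
      ≤ (∫⁻ y in U, ENNReal.ofReal (r (x - y)) * ‖D y - a‖ₑ) ^ 2 := by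
        gcongr
        refine (enorm_integral_le_lintegral_enorm _).trans (lintegral_mono fun y => ?_)
        rw [enorm_smul, Real.enorm_of_nonneg (ρ.nonneg_normed _)]
    _ = (∫⁻ y, ‖D y - a‖ₑ ∂ν) ^ 2 := by
        rw [hν, lintegral_withDensity_eq_lintegral_mul₀ hrm.aemeasurable hDm]
        rfl
    _ ≤ ν Set.univ * ∫⁻ y, ‖D y - a‖ₑ ^ 2 ∂ν :=
        sq_lintegral_le _ (hDm.mono_ac (withDensity_absolutelyContinuous _ _))
    _ = _ := by
        rw [hν, withDensity_apply _ MeasurableSet.univ, Measure.restrict_univ, hone, one_mul,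
          lintegral_withDensity_eq_lintegral_mul₀ hrm.aemeasurable (hDm.pow_const 2)]
        rfl

/-- Jensen's bound is integrated in x and the order exchanged; the kernel has mass 1 in its first
variable too. -/
theorem setLIntegral_enorm_gradient_mollify_le (hΩ : MeasurableSet Ω) (ρ : ContDiffBump (0 : E n))
    (hw : MemLp w 2 (volume.restrict Ω)) (hD : MemLp D 2 (volume.restrict Ω))
    (hwD : HasWeakGradient Ω w D) {U V : Set (E n)} (hU : MeasurableSet U) (hUΩ : U ⊆ Ω)
    (hV : MeasurableSet V) (hVU : ∀ x ∈ V, Metric.closedBall x ρ.rOut ⊆ U) (a : E n) :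
    ∫⁻ x in V, ‖gradient (mollify Ω ρ w) x - a‖ₑ ^ 2 ≤ ∫⁻ y in U, ‖D y - a‖ₑ ^ 2 := by
  have hrc : Continuous (ρ.normed (volume : Measure (E n))) := ρ.continuous_normed
  have hDU : AEStronglyMeasurable D (volume.restrict U) :=
    hD.1.mono_measure (Measure.restrict_mono_set _ hUΩ)
  have hDm : AEMeasurable (fun y => ‖D y - a‖ₑ ^ 2) (volume.restrict U) :=
    (hDU.sub aestronglyMeasurable_const).enorm.pow_const 2
  calc ∫⁻ x in V, ‖gradient (mollify Ω ρ w) x - a‖ₑ ^ 2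
      ≤ ∫⁻ x in V, ∫⁻ y in U, ENNReal.ofReal (ρ.normed volume (x - y)) * ‖D y - a‖ₑ ^ 2 :=
        setLIntegral_mono' hV fun x hx =>
          enorm_gradient_mollify_sub_sq_le hΩ ρ hw hD hwD hU hUΩ (hVU x hx) a
    _ ≤ ∫⁻ x, ∫⁻ y in U, ENNReal.ofReal (ρ.normed volume (x - y)) * ‖D y - a‖ₑ ^ 2 :=
        setLIntegral_le_lintegral _ _
    _ = ∫⁻ y in U, ∫⁻ x, ENNReal.ofReal (ρ.normed volume (x - y)) * ‖D y - a‖ₑ ^ 2 := by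
        have h1 : Continuous fun p : E n × E n =>
          ENNReal.ofReal (ρ.normed volume (p.1 - p.2)) :=
          ENNReal.continuous_ofReal.comp (by fun_prop)
        exact lintegral_lintegral_swap (h1.aemeasurable.mul
          (hDm.comp_quasiMeasurePreserving Measure.quasiMeasurePreserving_snd))
    _ = _ := by
        refine lintegral_congr fun y => ?_
        rw [lintegral_mul_const _ (by fun_prop), lintegral_normed', one_mul]

/-- The points of `U` with a ball of radius larger than `η` around them contained in `U`. -/
def erosion (U : Set (E n)) (η : ℝ) : Set (E n) := {x | ∃ s > η, Metric.ball x s ⊆ U}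

theorem isOpen_erosion (U : Set (E n)) (η : ℝ) : IsOpen (erosion U η) := by
  refine Metric.isOpen_iff.2 ?_
  rintro x ⟨s, hs, hsU⟩
  refine ⟨(s - η) / 2, by linarith [show η < s from hs], fun y hy =>
    ⟨(s + η) / 2, by show η < _; linarith [show η < s from hs], fun z hz => hsU ?_⟩⟩
  rw [Metric.mem_ball] at *
  linarith [dist_triangle z y x]

theorem convex_erosion {U : Set (E n)} (hU : Convex ℝ U) (η : ℝ) : Convex ℝ (erosion U η) := by
  rintro x ⟨s, hs, hsU⟩ y ⟨t, ht, htU⟩ a b ha hb hab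
  refine ⟨min s t, lt_min hs ht, fun z hz => ?_⟩
  set v := z - (a • x + b • y) with hv
  have hvn : ‖v‖ < min s t := by rwa [Metric.mem_ball, dist_eq_norm] at hz
  have h1 : x + v ∈ U := hsU (by simpa using hvn.trans_le (min_le_left _ _))
  have h2 : y + v ∈ U := htU (by simpa using hvn.trans_le (min_le_right _ _))
  have := hU h1 h2 ha hb hab
  convert this using 1
  have : z = v + (a • x + b • y) := by rw [hv]; abel
  rw [this]
  conv_lhs => rw [← one_smul ℝ v, ← hab]
  module

theorem erosion_subset {U : Set (E n)} {η : ℝ} (hη : 0 ≤ η) : erosion U η ⊆ U := by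
  rintro x ⟨s, hs, hsU⟩
  exact hsU (Metric.mem_ball_self (hη.trans_lt hs))

/-- Poincaré inequality on a convex open set, for functions with a square integrable weak
gradient; an affine function may be subtracted. -/
theorem lintegral_lintegral_enorm_sub_affine_sq_le (hΩ : MeasurableSet Ω)
    (hw : MemLp w 2 (volume.restrict Ω)) (hD : MemLp D 2 (volume.restrict Ω))
    (hwD : HasWeakGradient Ω w D) {U : Set (E n)} (hU : IsOpen U) (hc : Convex ℝ U)
    (hUΩ : U ⊆ Ω) {d : ℝ} (hd : ∀ x ∈ U, ∀ y ∈ U, dist x y ≤ d) (a : E n) :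
    ∫⁻ x in U, ∫⁻ y in U, ‖w y - w x - inner ℝ a (y - x)‖ₑ ^ 2
      ≤ volume (Metric.closedBall (0 : E n) d) * ENNReal.ofReal d ^ 2 *
        ∫⁻ x in U, ‖D x - a‖ₑ ^ 2 := by
  set η : ℕ → ℝ := fun k => 1 / (k + 1) with hη
  have hη0 : ∀ k, 0 < η k := fun k => by positivity
  let ρ : ℕ → ContDiffBump (0 : E n) := fun k => ⟨η k / 2, η k, by linarith [hη0 k],
    by linarith [hη0 k]⟩
  have hηt : Tendsto η atTop (𝓝 0) := tendsto_one_div_add_atTop_nhds_zero_nat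
  have hlim : ∀ᵐ x, Tendsto (fun k => mollify Ω (ρ k) w x) atTop (𝓝 (Ω.indicator w x)) :=
    ContDiffBump.ae_convolution_tendsto_right_of_locallyIntegrable (K := 2) hηt
      (Eventually.of_forall fun k => by simp only [ρ]; linarith)
      (locallyIntegrable_indicator hΩ hw)
  -- The gradient bound for the mollification holds only where the kernel ball fits into U. The
  -- erosions are convex, so the smooth Poincaré inequality applies on them, and they exhaust the
  -- open set U.
  set V : ℕ → Set (E n) := fun k => erosion U (η k) with hV
  have hVm : ∀ k, MeasurableSet (V k) := fun k => (isOpen_erosion U _).measurableSet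
  have hVU : ∀ k, V k ⊆ U := fun k => erosion_subset (hη0 k).le
  set φ : ℕ → E n → ℝ := fun k x => mollify Ω (ρ k) w x - inner ℝ a x with hφ
  have hφs : ∀ k, ContDiff ℝ ∞ (φ k) := fun k =>
    (contDiff_mollify hΩ (ρ k) hw).sub (contDiff_const.inner ℝ contDiff_id)
  set F : ℕ → E n → E n → ℝ≥0∞ := fun k x y =>
    (V k).indicator 1 x * ((V k).indicator 1 y * ‖φ k y - φ k x‖ₑ ^ 2) with hF
  have hFm : ∀ k, Measurable (Function.uncurry (F k)) := by
    intro k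
    have h1 : Measurable ((V k).indicator (1 : E n → ℝ≥0∞)) := measurable_one.indicator (hVm k)
    have h0 := (hφs k).continuous
    have h2 : Continuous fun p : E n × E n => ‖φ k p.2 - φ k p.1‖ₑ ^ 2 := by fun_prop
    exact (h1.comp measurable_fst).mul ((h1.comp measurable_snd).mul h2.measurable)
  have hevent : ∀ x ∈ U, ∀ᶠ k in atTop, x ∈ V k := by
    intro x hx
    obtain ⟨s, hs, hsU⟩ := Metric.isOpen_iff.1 hU x hx
    filter_upwards [hηt.eventually_lt_const hs] with k hk
    exact ⟨s, hk, hsU⟩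
  have hpt : ∀ x ∈ U, Tendsto (fun k => mollify Ω (ρ k) w x) atTop (𝓝 (Ω.indicator w x)) →
      ∀ y ∈ U, Tendsto (fun k => mollify Ω (ρ k) w y) atTop (𝓝 (Ω.indicator w y)) →
      Tendsto (fun k => F k x y) atTop (𝓝 (‖w y - w x - inner ℝ a (y - x)‖ₑ ^ 2)) := by
    intro x hx hxt y hy hyt
    rw [Set.indicator_of_mem (hUΩ hx)] at hxt
    rw [Set.indicator_of_mem (hUΩ hy)] at hyt
    have h1 : Tendsto (fun k => φ k y - φ k x) atTop (𝓝 (w y - w x - inner ℝ a (y - x))) := by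
      have := (hyt.sub_const (inner ℝ a y)).sub (hxt.sub_const (inner ℝ a x))
      convert this using 2
      rw [inner_sub_right]; ring
    have h2 := ENNReal.Tendsto.pow (n := 2) ((continuous_enorm.tendsto _).comp h1)
    refine h2.congr' ?_
    filter_upwards [hevent x hx, hevent y hy] with k hk1 hk2
    simp [hF, hk1, hk2]
  have hbound : ∀ k, ∫⁻ x in U, ∫⁻ y in U, F k x y
      ≤ volume (Metric.closedBall (0 : E n) d) * ENNReal.ofReal d ^ 2 *
        ∫⁻ x in U, ‖D x - a‖ₑ ^ 2 := by
    intro k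
    have e1 : ∫⁻ x in U, ∫⁻ y in U, F k x y = ∫⁻ x in V k, ∫⁻ y in V k, ‖φ k y - φ k x‖ₑ ^ 2 := by
      rw [← lintegral_indicator hU.measurableSet, ← lintegral_indicator (hVm k)]
      refine lintegral_congr fun x => ?_
      by_cases hx : x ∈ V k
      · rw [Set.indicator_of_mem hx, Set.indicator_of_mem (hVU k hx),
          ← lintegral_indicator hU.measurableSet, ← lintegral_indicator (hVm k)]
        refine lintegral_congr fun y => ?_
        by_cases hy : y ∈ V k
        · simp [hF, hx, hy, hVU k hy]
        · by_cases hyU : y ∈ U <;> simp [hF, hx, hy, hyU]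
      · by_cases hxU : x ∈ U <;> simp [hF, hx, hxU]
    rw [e1]
    refine (lintegral_lintegral_enorm_sub_sq_le ((hφs k).of_le (by norm_cast)) (hVm k)
      (convex_erosion hc _) (fun x hx y hy => hd x (hVU k hx) y (hVU k hy))).trans ?_
    refine mul_le_mul_right ?_ _
    refine le_trans (le_of_eq ?_) (setLIntegral_enorm_gradient_mollify_le hΩ (ρ k) hw hD hwD
      hU.measurableSet hUΩ (hVm k) ?_ a)
    · refine lintegral_congr fun x => ?_
      congr 2
      have h1 : DifferentiableAt ℝ (mollify Ω (ρ k) w) x :=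
        (contDiff_mollify hΩ (ρ k) hw).differentiable (by simp) x
      have h2 : HasFDerivAt (fun x : E n => inner ℝ a x) (innerSL ℝ a) x :=
        (innerSL ℝ a).hasFDerivAt
      simp only [gradient, hφ]
      have h3 : fderiv ℝ (fun x => mollify Ω (ρ k) w x - inner ℝ a x) x
          = fderiv ℝ (mollify Ω (ρ k) w) x - innerSL ℝ a := (h1.hasFDerivAt.sub h2).fderiv
      rw [h3, map_sub]
      congr 1
      exact (InnerProductSpace.toDual ℝ (E n)).symm_apply_apply a
    · rintro x ⟨s, hs, hsU⟩
      exact (Metric.closedBall_subset_ball hs).trans hsU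
  calc ∫⁻ x in U, ∫⁻ y in U, ‖w y - w x - inner ℝ a (y - x)‖ₑ ^ 2
      = ∫⁻ x in U, ∫⁻ y in U, liminf (fun k => F k x y) atTop := by
        refine lintegral_congr_ae ?_
        filter_upwards [ae_restrict_of_ae hlim, ae_restrict_mem hU.measurableSet] with x hx hxU
        refine lintegral_congr_ae ?_
        filter_upwards [ae_restrict_of_ae hlim, ae_restrict_mem hU.measurableSet] with y hy hyU
        exact (hpt x hxU hx y hyU hy).liminf_eq.symm
    -- Fatou, once in each variable: only almost everywhere convergence of the mollifications is
    -- needed.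
    _ ≤ ∫⁻ x in U, liminf (fun k => ∫⁻ y in U, F k x y) atTop :=
        lintegral_mono fun x => lintegral_liminf_le fun k => (hFm k).of_uncurry_left
    _ ≤ liminf (fun k => ∫⁻ x in U, ∫⁻ y in U, F k x y) atTop :=
        lintegral_liminf_le fun k => (hFm k).lintegral_prod_right
    _ ≤ _ := by
        refine liminf_le_of_le (by isBoundedDefault) fun b hb => ?_
        obtain ⟨k, hk⟩ := hb.exists
        exact hk.trans (hbound k)

end WeakGradient

/-! ### Mean values and square integrals -/

section Averages

variable {X F : Type*} [MeasurableSpace X] [NormedAddCommGroup F] [NormedSpace ℝ F]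

theorem enorm_average_sq_le (ν : Measure X) [IsFiniteMeasure ν] {f : X → F}
    (hf : AEStronglyMeasurable f ν) :
    ‖⨍ x, f x ∂ν‖ₑ ^ 2 ≤ (ν Set.univ)⁻¹ * ∫⁻ x, ‖f x‖ₑ ^ 2 ∂ν := by
  rcases eq_or_ne ν 0 with rfl | h0
  · simp
  have : NeZero ν := ⟨h0⟩
  rw [average_eq']
  calc ‖∫ x, f x ∂(ν Set.univ)⁻¹ • ν‖ₑ ^ 2
      ≤ (∫⁻ x, ‖f x‖ₑ ∂(ν Set.univ)⁻¹ • ν) ^ 2 := by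
        gcongr
        exact enorm_integral_le_lintegral_enorm _
    _ ≤ _ := sq_lintegral_le _ (hf.enorm.smul_measure _)
    _ = _ := by rw [measure_univ, one_mul, lintegral_smul_measure, smul_eq_mul]

/-- The deviation of f(x) from the mean is minus the mean over y of f(y) − f(x), so Jensen applies
inside the outer integral. -/
theorem lintegral_enorm_sub_average_sq_le [CompleteSpace F] (ν : Measure X) [IsFiniteMeasure ν]
    {f : X → F} (hf : Integrable f ν) :
    ∫⁻ x, ‖f x - ⨍ y, f y ∂ν‖ₑ ^ 2 ∂ν
      ≤ (ν Set.univ)⁻¹ * ∫⁻ x, ∫⁻ y, ‖f y - f x‖ₑ ^ 2 ∂ν ∂ν := by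
  rcases eq_or_ne ν 0 with rfl | h0
  · simp
  have : NeZero ν := ⟨h0⟩
  rw [← lintegral_const_mul' _ _ (by simpa using h0)]
  refine lintegral_mono fun x => ?_
  have : f x - ⨍ y, f y ∂ν = -⨍ y, (f y - f x) ∂ν := by
    simp only [average]
    rw [integral_sub (hf.smul_measure (by simpa using h0)) (integrable_const _)]
    simp
  rw [this, enorm_neg]
  exact enorm_average_sq_le ν (hf.1.sub aestronglyMeasurable_const)

end Averages

/-! ### Affine approximation of functions in H^r -/

section Regularity

variable {n : ℕ} {Ω : Set (E n)}

theorem volume_closedBall_eq (d : ℝ) (hd : 0 ≤ d) :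
    volume (Metric.closedBall (0 : E n) d)
      = ENNReal.ofReal (d ^ n) * volume (Metric.closedBall (0 : E n) 1) := by
  rw [Measure.addHaar_closedBall' volume (0 : E n) hd, finrank_euclideanSpace_fin]

/-- For `u ∈ H^r`, the oscillation of the gradient on convex sets is governed by a finite
measure. -/
theorem exists_regularity_measure (hΩ : MeasurableSet Ω) {r : ℝ} (hr1 : 1 < r) (hr2 : r ≤ 2)
    {u : H1 Ω} (hur : MemHr r u) :
    ∃ μ : Measure (E n), IsFiniteMeasure μ ∧ ∀ U : Set (E n), IsOpen U → Convex ℝ U → U ⊆ Ω →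
      ∀ d : ℝ, 0 < d → (∀ x ∈ U, ∀ y ∈ U, dist x y ≤ d) →
        ∫⁻ x in U, ∫⁻ y in U, ‖u.grad y - u.grad x‖ₑ ^ 2
          ≤ ENNReal.ofReal (d ^ ((n : ℝ) + 2 * (r - 1))) * μ U := by
  rcases hr2.lt_or_eq with hr2 | rfl
  -- For r < 2 the density of μ is the inner Slobodeckij integral; the power of d comes from |x − y|
  -- ≤ d in the denominator.
  · set k : E n → E n → ℝ≥0∞ := fun x y => ENNReal.ofReal
      (‖u.grad x - u.grad y‖ ^ 2 / ‖x - y‖ ^ ((n : ℝ) + 2 * (r - 1))) with hk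
    refine ⟨(volume.restrict Ω).withDensity fun x => ∫⁻ y in Ω, k x y,
      isFiniteMeasure_withDensity (hur.2 hr2).ne, fun U hU _ hUΩ d hd hdU => ?_⟩
    rw [withDensity_apply _ hU.measurableSet, Measure.restrict_restrict hU.measurableSet,
      Set.inter_eq_self_of_subset_left hUΩ, ← lintegral_const_mul' _ _ (by simp)]
    refine setLIntegral_mono' hU.measurableSet fun x hx => ?_
    rw [← lintegral_const_mul' _ _ (by simp)]
    refine le_trans (setLIntegral_mono' hU.measurableSet fun y hy => ?_) (lintegral_mono_set hUΩ)
    rcases eq_or_ne x y with rfl | hxy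
    · simp
    have hpos : 0 < ‖x - y‖ := norm_pos_iff.2 (sub_ne_zero.2 hxy)
    have hle : ‖x - y‖ ≤ d := by rw [← dist_eq_norm]; exact hdU x hx y hy
    have hp : 0 ≤ (n : ℝ) + 2 * (r - 1) := by
      have : (0 : ℝ) ≤ n := n.cast_nonneg
      linarith
    have h1 : ‖x - y‖ ^ ((n : ℝ) + 2 * (r - 1)) ≤ d ^ ((n : ℝ) + 2 * (r - 1)) :=
      Real.rpow_le_rpow hpos.le hle hp
    rw [hk, ← ENNReal.ofReal_mul (by positivity), enorm_sub_rev, ← ofReal_norm,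
      ← ENNReal.ofReal_pow (norm_nonneg _)]
    refine ENNReal.ofReal_le_ofReal ?_
    rw [mul_div_assoc', le_div_iff₀ (by positivity), mul_comm]
    gcongr
  -- For r = 2 the density is a multiple of the squared second derivatives. Poincaré is applied to
  -- each component of the gradient; the volume of a ball of radius d supplies the factor d^n.
  · choose D hD hGD using hur.1 rfl
    set β := volume (Metric.closedBall (0 : E n) 1) with hβ
    have hβt : β ≠ ⊤ := measure_closedBall_lt_top.ne
    set f : E n → ℝ≥0∞ := fun x => β * ∑ i, ‖D i x‖ₑ ^ 2 with hf
    have hDm : ∀ i, AEMeasurable (fun x => ‖D i x‖ₑ ^ 2) (volume.restrict Ω) := fun i =>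
      (hD i).1.enorm.pow_const 2
    have hDi : ∀ i, ∫⁻ x in Ω, ‖D i x‖ₑ ^ 2 ≠ ⊤ := fun i => by
      have := (hD i).2
      rw [eLpNorm_lt_top_iff_lintegral_rpow_enorm_lt_top (by simp) (by simp)] at this
      simpa using this.ne
    refine ⟨(volume.restrict Ω).withDensity f, isFiniteMeasure_withDensity ?_,
      fun U hU hUc hUΩ d hd hdU => ?_⟩
    · rw [hf, lintegral_const_mul' _ _ hβt, lintegral_finsetSum' _ fun i _ => hDm i]
      exact ENNReal.mul_ne_top hβt (ENNReal.sum_ne_top.2 fun i _ => hDi i)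
    rw [withDensity_apply _ hU.measurableSet, Measure.restrict_restrict hU.measurableSet,
      Set.inter_eq_self_of_subset_left hUΩ]
    have hmU : ∀ i, AEMeasurable (fun x => ‖D i x‖ₑ ^ 2) (volume.restrict U) := fun i =>
      (hDm i).mono_measure (Measure.restrict_mono_set _ hUΩ)
    have hGm : AEStronglyMeasurable u.grad (volume.restrict U) :=
      u.memLp_grad.1.mono_measure (Measure.restrict_mono_set _ hUΩ)
    have hGi : ∀ i, AEStronglyMeasurable (fun x => u.grad x i) (volume.restrict U) := fun i =>
      (EuclideanSpace.proj (𝕜 := ℝ) i).continuous.comp_aestronglyMeasurable hGm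
    have hGi2 : ∀ i, MemLp (fun x => u.grad x i) 2 (volume.restrict Ω) := fun i =>
      (EuclideanSpace.proj (𝕜 := ℝ) i).comp_memLp' u.memLp_grad
    have hnorm : ∀ v : E n, ‖v‖ₑ ^ 2 = ∑ i, ‖v i‖ₑ ^ 2 := by
      intro v
      rw [← ofReal_norm, ← ENNReal.ofReal_pow (norm_nonneg _), EuclideanSpace.norm_sq_eq,
        ENNReal.ofReal_sum_of_nonneg (fun i _ => by positivity)]
      refine Finset.sum_congr rfl fun i _ => ?_
      rw [ENNReal.ofReal_pow (norm_nonneg _), ofReal_norm]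
    have hpair : ∀ i, AEMeasurable (Function.uncurry fun x y => ‖u.grad y i - u.grad x i‖ₑ ^ 2)
        ((volume.restrict U).prod (volume.restrict U)) := fun i =>
      (((hGi i).comp_quasiMeasurePreserving Measure.quasiMeasurePreserving_snd).sub
        ((hGi i).comp_quasiMeasurePreserving Measure.quasiMeasurePreserving_fst)).enorm.pow_const 2
    calc ∫⁻ x in U, ∫⁻ y in U, ‖u.grad y - u.grad x‖ₑ ^ 2
        = ∑ i, ∫⁻ x in U, ∫⁻ y in U, ‖u.grad y i - u.grad x i‖ₑ ^ 2 := by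
          have hm : ∀ i, AEMeasurable (fun x => ∫⁻ y in U, ‖u.grad y i - u.grad x i‖ₑ ^ 2)
              (volume.restrict U) := fun i => (hpair i).lintegral_prod_right'
          rw [← lintegral_finsetSum' _ fun i _ => hm i]
          refine lintegral_congr fun x => ?_
          have hm' : ∀ i, AEMeasurable (fun y => ‖u.grad y i - u.grad x i‖ₑ ^ 2)
              (volume.restrict U) := fun i =>
            ((hGi i).sub aestronglyMeasurable_const).enorm.pow_const 2
          rw [← lintegral_finsetSum' _ fun i _ => hm' i]
          exact lintegral_congr fun y => hnorm _
      _ ≤ ∑ i, volume (Metric.closedBall (0 : E n) d) * ENNReal.ofReal d ^ 2 *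
            ∫⁻ x in U, ‖D i x‖ₑ ^ 2 := by
          refine Finset.sum_le_sum fun i _ => ?_
          simpa using lintegral_lintegral_enorm_sub_affine_sq_le hΩ (hGi2 i) (hD i) (hGD i)
            hU hUc hUΩ hdU 0
      _ = _ := by
          have e1 : ENNReal.ofReal (d ^ ((n : ℝ) + 2 * (2 - 1)))
              = ENNReal.ofReal (d ^ n) * ENNReal.ofReal d ^ 2 := by
            rw [← ENNReal.ofReal_pow hd.le, ← ENNReal.ofReal_mul (by positivity), ← pow_add,
              ← Real.rpow_natCast]
            norm_num
          rw [hf, ← Finset.mul_sum, ← lintegral_finsetSum' _ fun i _ => hmU i,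
            lintegral_const_mul' _ _ hβt, volume_closedBall_eq d hd.le, e1]
          ring

/-- Approximation of `u ∈ H^r` by an affine function on a convex set. -/
theorem exists_affine_approx (hΩ : MeasurableSet Ω) {r : ℝ} {u : H1 Ω} {μ : Measure (E n)}
    [IsFiniteMeasure μ] (hμ : ∀ U : Set (E n), IsOpen U → Convex ℝ U → U ⊆ Ω →
      ∀ d : ℝ, 0 < d → (∀ x ∈ U, ∀ y ∈ U, dist x y ≤ d) →
        ∫⁻ x in U, ∫⁻ y in U, ‖u.grad y - u.grad x‖ₑ ^ 2
          ≤ ENNReal.ofReal (d ^ ((n : ℝ) + 2 * (r - 1))) * μ U)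
    {c : ℝ} (hc : 0 < c) {U : Set (E n)} (hU : IsOpen U) (hUc : Convex ℝ U) (hUΩ : U ⊆ Ω)
    {d : ℝ} (hd : 0 < d) (hdU : ∀ x ∈ U, ∀ y ∈ U, dist x y ≤ d)
    (hcU : c * d ^ n ≤ volume.real U) :
    ∃ (k : ℝ) (a : E n),
      ∫⁻ x in U, ‖u.grad x - a‖ₑ ^ 2 ≤ ENNReal.ofReal (c⁻¹ * d ^ (2 * (r - 1)) * μ.real U) ∧
      ∫⁻ x in U, ‖u.val x - (k + inner ℝ a x)‖ₑ ^ 2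
        ≤ ENNReal.ofReal (volume.real (Metric.closedBall (0 : E n) 1) * (c⁻¹) ^ 2 *
            d ^ (2 * r) * μ.real U) := by
  have hbU : Bornology.IsBounded U := Metric.isBounded_iff.2 ⟨d, fun x hx y hy => hdU x hx y hy⟩
  have hUf : volume U ≠ ⊤ := hbU.measure_lt_top.ne
  have : IsFiniteMeasure (volume.restrict U) := ⟨by simpa using hUf.lt_top⟩
  have hUpos : 0 < volume.real U := lt_of_lt_of_le (by positivity) hcU
  set β := volume.real (Metric.closedBall (0 : E n) 1) with hβ
  have hinv : (volume.restrict U Set.univ)⁻¹ ≤ ENNReal.ofReal ((c * d ^ n)⁻¹) := by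
    rw [Measure.restrict_apply_univ, ENNReal.ofReal_inv_of_pos (by positivity),
      ENNReal.inv_le_inv, ← ENNReal.ofReal_toReal hUf]
    exact ENNReal.ofReal_le_ofReal hcU
  have hGint : Integrable u.grad (volume.restrict U) :=
    (u.memLp_grad.mono_measure (Measure.restrict_mono_set _ hUΩ)).integrable (by norm_num)
  have huint : Integrable u.val (volume.restrict U) :=
    (u.memLp_val.mono_measure (Measure.restrict_mono_set _ hUΩ)).integrable (by norm_num)
  -- The slope is the mean gradient, and the constant below is the mean of u minus its linear part;
  -- both deviations are then controlled by double integrals.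
  set a := ⨍ x in U, u.grad x with ha
  have hμU : μ U = ENNReal.ofReal (μ.real U) := (ofReal_measureReal (by finiteness)).symm
  have hgrad : ∫⁻ x in U, ‖u.grad x - a‖ₑ ^ 2
      ≤ ENNReal.ofReal (c⁻¹ * d ^ (2 * (r - 1)) * μ.real U) := by
    refine (lintegral_enorm_sub_average_sq_le _ hGint).trans ?_
    refine (mul_le_mul' hinv (hμ U hU hUc hUΩ d hd hdU)).trans (le_of_eq ?_)
    rw [hμU, ← ENNReal.ofReal_mul (by positivity), ← ENNReal.ofReal_mul (by positivity),
      Real.rpow_add hd, Real.rpow_natCast]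
    congr 1
    field_simp
  set f : E n → ℝ := fun x => u.val x - inner ℝ a x with hf
  have hfint : Integrable f (volume.restrict U) := by
    refine huint.sub ?_
    have hcont : Continuous fun x : E n => (inner ℝ a x : ℝ) := by fun_prop
    exact (hcont.continuousOn.integrableOn_compact hbU.isCompact_closure).mono_set subset_closure
  refine ⟨⨍ x in U, f x, a, hgrad, ?_⟩
  calc ∫⁻ x in U, ‖u.val x - ((⨍ x in U, f x) + inner ℝ a x)‖ₑ ^ 2
      = ∫⁻ x in U, ‖f x - ⨍ y in U, f y‖ₑ ^ 2 := by
        refine lintegral_congr fun x => ?_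
        congr 2
        rw [← sub_sub, sub_right_comm]
    _ ≤ (volume.restrict U Set.univ)⁻¹ * ∫⁻ x in U, ∫⁻ y in U, ‖f y - f x‖ₑ ^ 2 :=
        lintegral_enorm_sub_average_sq_le _ hfint
    _ = (volume.restrict U Set.univ)⁻¹ *
          ∫⁻ x in U, ∫⁻ y in U, ‖u.val y - u.val x - inner ℝ a (y - x)‖ₑ ^ 2 := by
        congr 1
        refine lintegral_congr fun x => lintegral_congr fun y => ?_
        congr 2
        simp only [hf, inner_sub_right]
        ring
    _ ≤ ENNReal.ofReal ((c * d ^ n)⁻¹) * (volume (Metric.closedBall (0 : E n) d) *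
          ENNReal.ofReal d ^ 2 * ENNReal.ofReal (c⁻¹ * d ^ (2 * (r - 1)) * μ.real U)) :=
        mul_le_mul' hinv ((lintegral_lintegral_enorm_sub_affine_sq_le hΩ u.memLp_val u.memLp_grad
          u.hasWeakGradient hU hUc hUΩ hdU a).trans (by gcongr))
    _ = _ := by
        rw [volume_closedBall_eq d hd.le, ← ofReal_measureReal measure_closedBall_lt_top.ne,
          ← hβ, ← ENNReal.ofReal_pow hd.le, ← ENNReal.ofReal_mul (by positivity),
          ← ENNReal.ofReal_mul (by positivity), ← ENNReal.ofReal_mul (by positivity),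
          ← ENNReal.ofReal_mul (by positivity)]
        congr 1
        have : d ^ (2 * r) = d ^ (2 * (r - 1)) * d ^ 2 := by
          rw [← Real.rpow_natCast d 2, ← Real.rpow_add hd]
          congr 1
          push_cast
          ring
        rw [this]
        field_simp

end Regularity

/-! ### Point values as limits of extrapolated averages -/

section PointValues

variable {n : ℕ} {Ω : Set (E n)}

/-- The set `U` shrunk towards the point `z` by the factor `2⁻ᵏ`. -/
def shrink (z : E n) (U : Set (E n)) (k : ℕ) : Set (E n) :=
  AffineMap.homothety z ((1 / 2 : ℝ) ^ k) '' U

theorem isOpen_shrink (z : E n) {U : Set (E n)} (hU : IsOpen U) (k : ℕ) :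
    IsOpen (shrink z U k) :=
  AffineMap.homothety_isOpenMap z _ (by positivity) _ hU

theorem convex_shrink (z : E n) {U : Set (E n)} (hU : Convex ℝ U) (k : ℕ) :
    Convex ℝ (shrink z U k) :=
  hU.affine_image _

theorem shrink_subset {z : E n} {U : Set (E n)} (hU : IsOpen U) (hc : Convex ℝ U)
    (hz : z ∈ closure U) (k : ℕ) : shrink z U k ⊆ U := by
  rintro _ ⟨x, hx, rfl⟩
  have := hc.add_smul_sub_mem_interior' hz (hU.interior_eq.symm ▸ hx : x ∈ interior U)
    (t := (1 / 2 : ℝ) ^ k) ⟨by positivity, pow_le_one₀ (by norm_num) (by norm_num)⟩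
  rw [hU.interior_eq] at this
  simpa [AffineMap.homothety_apply, add_comm] using this

theorem shrink_mono (z : E n) {U W : Set (E n)} (h : U ⊆ W) (k : ℕ) :
    shrink z U k ⊆ shrink z W k :=
  Set.image_mono h

theorem shrink_succ_subset {z : E n} {U : Set (E n)} (hU : IsOpen U) (hc : Convex ℝ U)
    (hz : z ∈ closure U) (k : ℕ) : shrink z U (k + 1) ⊆ shrink z U k := by
  rintro _ ⟨x, hx, rfl⟩
  refine ⟨AffineMap.homothety z (1 / 2 : ℝ) x, ?_, ?_⟩
  · exact shrink_subset hU hc hz 1 ⟨x, hx, by simp⟩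
  · simp [AffineMap.homothety_apply, smul_smul, pow_succ]

theorem volume_real_shrink (z : E n) (U : Set (E n)) (k : ℕ) :
    volume.real (shrink z U k) = ((1 / 2 : ℝ) ^ k) ^ n * volume.real U := by
  rw [measureReal_def, shrink, Measure.addHaar_image_homothety, finrank_euclideanSpace_fin,
    ENNReal.toReal_mul, ENNReal.toReal_ofReal (by positivity), abs_of_nonneg (by positivity),
    measureReal_def]

theorem dist_le_of_mem_shrink {z : E n} {U : Set (E n)} {d : ℝ}
    (hd : ∀ x ∈ U, ∀ y ∈ U, dist x y ≤ d) (k : ℕ) :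
    ∀ x ∈ shrink z U k, ∀ y ∈ shrink z U k, dist x y ≤ (1 / 2 : ℝ) ^ k * d := by
  rintro _ ⟨x, hx, rfl⟩ _ ⟨y, hy, rfl⟩
  have : AffineMap.homothety z ((1 / 2 : ℝ) ^ k) x - AffineMap.homothety z ((1 / 2 : ℝ) ^ k) y
      = (1 / 2 : ℝ) ^ k • (x - y) := by
    simp only [AffineMap.homothety_apply, vsub_eq_sub, vadd_eq_add]
    module
  rw [dist_eq_norm, this, norm_smul, Real.norm_of_nonneg (by positivity), ← dist_eq_norm]
  exact mul_le_mul_of_nonneg_left (hd x hx y hy) (by positivity)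

theorem setAverage_shrink (z : E n) {U : Set (E n)} (hU : MeasurableSet U) (k : ℕ) (f : E n → ℝ) :
    ⨍ x in shrink z U k, f x = ⨍ x in U, f (AffineMap.homothety z ((1 / 2 : ℝ) ^ k) x) := by
  set s := (1 / 2 : ℝ) ^ k with hs
  have hs0 : 0 < s := by positivity
  have hder : ∀ x ∈ U, HasFDerivWithinAt (AffineMap.homothety z s)
      (s • ContinuousLinearMap.id ℝ (E n)) U x := by
    intro x _
    have : HasFDerivAt (fun x : E n => s • (x - z) + z) (s • ContinuousLinearMap.id ℝ (E n)) x :=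
      (((hasFDerivAt_id x).sub_const z).const_smul s).add_const z
    exact this.hasFDerivWithinAt
  have hinj : Set.InjOn (AffineMap.homothety z s) U := by
    intro x _ y _ hxy
    simpa [AffineMap.homothety_apply, hs0.ne'] using hxy
  set c := |(s • ContinuousLinearMap.id ℝ (E n)).det| with hc
  have hdet : c = s ^ n := by
    rw [hc]
    change |LinearMap.det (s • LinearMap.id : E n →ₗ[ℝ] E n)| = s ^ n
    rw [LinearMap.det_smul, LinearMap.det_id, finrank_euclideanSpace_fin, mul_one,
      abs_of_nonneg (by positivity)]
  have h1 := integral_image_eq_integral_abs_det_fderiv_smul volume hU hder hinj f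
  rw [setAverage_eq, setAverage_eq, volume_real_shrink, shrink, h1, ← hs, ← hc, hdet,
    integral_smul]
  simp only [smul_eq_mul]
  have : s ^ n ≠ 0 := by positivity
  field_simp

/-- Extrapolation to the point `z` of the averages of `u` over the sets shrinking to `z`. It
reproduces the value at `z` of affine functions. -/
noncomputable def extrapolate (u : E n → ℝ) (z : E n) (U : Set (E n)) (k : ℕ) : ℝ :=
  2 * (⨍ x in shrink z U (k + 1), u x) - ⨍ x in shrink z U k, u x

theorem integrableOn_affine {U : Set (E n)} (hb : Bornology.IsBounded U) (κ : ℝ) (a : E n) :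
    IntegrableOn (fun x : E n => κ + inner ℝ a x) U volume :=
  ((by fun_prop : Continuous fun x : E n => κ + inner ℝ a x).continuousOn.integrableOn_compact
    hb.isCompact_closure).mono_set subset_closure

/-- After both averages are rescaled to U, the identity holds pointwise: the displacement from z
enters with coefficient 2 · 2^-(k+1) − 2^-k = 0. -/
theorem extrapolate_affine (κ : ℝ) (a z : E n) {U : Set (E n)} (hU : MeasurableSet U)
    (hb : Bornology.IsBounded U) (h0 : 0 < volume.real U) (k : ℕ) :
    extrapolate (fun x => κ + inner ℝ a x) z U k = κ + inner ℝ a z := by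
  have hcomp : ∀ j : ℕ, IntegrableOn
      (fun x => κ + inner ℝ a (AffineMap.homothety z ((1 / 2 : ℝ) ^ j) x)) U volume := fun j => by
    have : Continuous fun x => κ + inner ℝ a (AffineMap.homothety z ((1 / 2 : ℝ) ^ j) x) := by
      have : Continuous (AffineMap.homothety z ((1 / 2 : ℝ) ^ j)) :=
        AffineMap.homothety_continuous z _
      fun_prop
    exact (this.continuousOn.integrableOn_compact hb.isCompact_closure).mono_set subset_closure
  rw [extrapolate, setAverage_shrink z hU, setAverage_shrink z hU, setAverage_eq, setAverage_eq,
    smul_eq_mul, smul_eq_mul, mul_left_comm, ← mul_sub, ← integral_const_mul,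
    ← integral_sub ((hcomp (k + 1)).const_mul 2) (hcomp k)]
  have : ∀ x : E n, 2 * (κ + inner ℝ a (AffineMap.homothety z ((1 / 2 : ℝ) ^ (k + 1)) x))
      - (κ + inner ℝ a (AffineMap.homothety z ((1 / 2 : ℝ) ^ k) x)) = κ + inner ℝ a z := by
    intro x
    simp only [AffineMap.homothety_apply, vsub_eq_sub, vadd_eq_add, inner_add_right,
      inner_smul_right, pow_succ]
    ring
  simp_rw [this]
  rw [integral_const, measureReal_restrict_apply_univ, smul_eq_mul, inv_mul_cancel_left₀ h0.ne']

theorem abs_setAverage_le {f : E n → ℝ} {V W : Set (E n)} (hVW : V ⊆ W)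
    (hf : AEStronglyMeasurable f (volume.restrict W)) {S v : ℝ} (hS : 0 ≤ S)
    (hfS : ∫⁻ x in W, ‖f x‖ₑ ^ 2 ≤ ENNReal.ofReal S) (hv : 0 < v) (hvV : v ≤ volume.real V) :
    |⨍ x in V, f x| ≤ √(S / v) := by
  have hVf : volume V ≠ ⊤ := fun h => by
    rw [measureReal_def, h, ENNReal.toReal_top] at hvV
    exact absurd hv (not_lt.2 hvV)
  have : IsFiniteMeasure (volume.restrict V) := ⟨by simpa using hVf.lt_top⟩
  have h1 := enorm_average_sq_le (volume.restrict V)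
    (hf.mono_measure (Measure.restrict_mono_set _ hVW))
  have h2 : (volume.restrict V Set.univ)⁻¹ ≤ ENNReal.ofReal v⁻¹ := by
    rw [Measure.restrict_apply_univ, ENNReal.ofReal_inv_of_pos hv, ENNReal.inv_le_inv,
      ← ENNReal.ofReal_toReal hVf]
    exact ENNReal.ofReal_le_ofReal hvV
  have h3 := h1.trans (mul_le_mul' h2 ((lintegral_mono_set hVW).trans hfS))
  rw [← ofReal_norm, ← ENNReal.ofReal_pow (norm_nonneg _), ← ENNReal.ofReal_mul (by positivity),
    ENNReal.ofReal_le_ofReal_iff (by positivity), Real.norm_eq_abs, sq_abs] at h3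
  refine Real.abs_le_sqrt (h3.trans (le_of_eq ?_))
  rw [div_eq_inv_mul]

/-- By exactness on affine functions only averages of the error remain, with weights 2 and −1; hence
the factor 3. The volume bound for the smaller set also serves for the larger one. -/
theorem abs_extrapolate_sub_le {u : E n → ℝ} {z : E n} {U W : Set (E n)} (hU : IsOpen U)
    (hc : Convex ℝ U) (hb : Bornology.IsBounded U) (hz : z ∈ closure U) {j : ℕ}
    (hUW : shrink z U j ⊆ W) (hWb : Bornology.IsBounded W) (hu : IntegrableOn u W volume)
    {κ : ℝ} {a : E n} {S v : ℝ} (hS : 0 ≤ S)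
    (huS : ∫⁻ x in W, ‖u x - (κ + inner ℝ a x)‖ₑ ^ 2 ≤ ENNReal.ofReal S) (hv : 0 < v)
    (hvU : v ≤ volume.real (shrink z U (j + 1))) :
    |extrapolate u z U j - (κ + inner ℝ a z)| ≤ 3 * √(S / v) := by
  have hsub := shrink_succ_subset hU hc hz j
  have haff := integrableOn_affine hWb κ a
  have hbj : Bornology.IsBounded (shrink z U j) := hWb.subset hUW
  have hv' : v ≤ volume.real (shrink z U j) :=
    hvU.trans (measureReal_mono hsub hbj.measure_lt_top.ne)
  have h0 : 0 < volume.real U := by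
    have := hv.trans_le hvU
    rw [volume_real_shrink] at this
    exact pos_of_mul_pos_right this (by positivity)
  have hdiff : ∀ V ⊆ W, ⨍ x in V, (u x - (κ + inner ℝ a x))
      = (⨍ x in V, u x) - ⨍ x in V, (κ + inner ℝ a x) := by
    intro V hV
    simp only [setAverage_eq]
    rw [integral_sub (hu.mono_set hV) (haff.mono_set hV), smul_sub]
  have e : extrapolate u z U j - (κ + inner ℝ a z)
      = 2 * (⨍ x in shrink z U (j + 1), (u x - (κ + inner ℝ a x)))
        - ⨍ x in shrink z U j, (u x - (κ + inner ℝ a x)) := by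
    rw [← extrapolate_affine κ a z hU.measurableSet hb h0 j, hdiff _ hUW,
      hdiff _ (hsub.trans hUW), extrapolate, extrapolate]
    ring
  have hm := (hu.sub haff).1
  have b1 := abs_setAverage_le (hsub.trans hUW) hm hS huS hv hvU
  have b2 := abs_setAverage_le hUW hm hS huS hv hv'
  rw [e]
  rw [abs_le] at b1 b2 ⊢
  simp only [Pi.sub_apply] at b1 b2
  constructor <;> linarith [b1.1, b1.2, b2.1, b2.2]

/-- An extrapolation subtracts an average and may be negative, so positivity is not inherited
termwise. If ℓ < 0, eventually 2 m(k+1) − m(k) < ℓ/2, so the excess of the averages m over ℓ/2 is at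
least halved at each step; the averages would then become negative. -/
theorem extrapolate_limit_nonneg {u : E n → ℝ} {z : E n} {U : Set (E n)} {ℓ : ℝ}
    (hu : ∀ k, 0 ≤ ⨍ x in shrink z U k, u x)
    (hℓ : Tendsto (extrapolate u z U) atTop (𝓝 ℓ)) : 0 ≤ ℓ := by
  by_contra! hneg
  obtain ⟨N, hN⟩ := eventually_atTop.1 (hℓ.eventually_lt_const (show ℓ < ℓ / 2 by linarith))
  set m := fun k => ⨍ x in shrink z U k, u x with hm
  have hstep : ∀ i, m (N + i) - ℓ / 2 ≤ (m N - ℓ / 2) * (1 / 2) ^ i := by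
    intro i
    induction i with
    | zero => simp
    | succ i ih =>
      have := hN (N + i) (by omega)
      simp only [extrapolate] at this
      change 2 * m (N + i + 1) - m (N + i) < ℓ / 2 at this
      rw [pow_succ, ← add_assoc]
      linarith
  have hlim : Tendsto (fun i : ℕ => (m N - ℓ / 2) * (1 / 2 : ℝ) ^ i) atTop (𝓝 0) := by
    simpa using (tendsto_pow_atTop_nhds_zero_of_lt_one (by norm_num : (0 : ℝ) ≤ 1 / 2)
      (by norm_num)).const_mul (m N - ℓ / 2)
  obtain ⟨i, hi⟩ := (hlim.eventually_lt_const (show 0 < -ℓ / 2 by linarith)).exists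
  linarith [hstep i, hu (N + i)]

/-- On convex open subsets of `Ω` with volume at least `c dⁿ`, where `d` bounds the diameter, the
function `u` is close to an affine function. -/
def AffineApprox (Ω : Set (E n)) (μ : Measure (E n)) (u : E n → ℝ) (r c S : ℝ) : Prop :=
  ∀ U : Set (E n), IsOpen U → Convex ℝ U → U ⊆ Ω → ∀ d : ℝ, 0 < d →
    (∀ x ∈ U, ∀ y ∈ U, dist x y ≤ d) → c * d ^ n ≤ volume.real U →
      ∃ (κ : ℝ) (a : E n), ∫⁻ x in U, ‖u x - (κ + inner ℝ a x)‖ₑ ^ 2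
        ≤ ENNReal.ofReal (S * d ^ (2 * r) * μ.real U)

variable {μ : Measure (E n)} {u : E n → ℝ} {r c S : ℝ}

theorem isBounded_of_dist_le {U : Set (E n)} {d : ℝ} (hd : ∀ x ∈ U, ∀ y ∈ U, dist x y ≤ d) :
    Bornology.IsBounded U :=
  Metric.isBounded_iff.2 ⟨d, fun x hx y hy => hd x hx y hy⟩

/-- At scale D = 2^-k d, a squared error of order D^(2r) divided by a volume of order D^n leaves
D^(r-n/2) after the root. The affine function lives on the larger set W so that U and W can be
compared, and j may be k or k + 1 so that consecutive extrapolations can be compared. -/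
theorem abs_extrapolate_sub_le_of_approx (hc : 0 < c) (hS : 0 ≤ S)
    (hu : MemLp u 2 (volume.restrict Ω)) {U W : Set (E n)} (hU : IsOpen U) (hUc : Convex ℝ U)
    (hW : IsOpen W) (hWc : Convex ℝ W) (hWΩ : W ⊆ Ω) (hUW : U ⊆ W) {d : ℝ} (hd : 0 < d)
    (hdW : ∀ x ∈ W, ∀ y ∈ W, dist x y ≤ d) (hcU : c * d ^ n ≤ volume.real U) {z : E n}
    (hz : z ∈ closure U) {k j : ℕ} (hkj : k ≤ j) (hjk : j ≤ k + 1) {κ : ℝ} {a : E n} {m : ℝ}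
    (hm : 0 ≤ m) (happ : ∫⁻ x in shrink z W k, ‖u x - (κ + inner ℝ a x)‖ₑ ^ 2
        ≤ ENNReal.ofReal (S * ((1 / 2 : ℝ) ^ k * d) ^ (2 * r) * m)) :
    |extrapolate u z U j - (κ + inner ℝ a z)|
      ≤ 3 * √(S * 4 ^ n / c) * √m * ((1 / 2 : ℝ) ^ k * d) ^ (r - n / 2) := by
  have hbW := isBounded_of_dist_le hdW
  have hzW : z ∈ closure W := closure_mono hUW hz
  have hWk : shrink z W k ⊆ W := shrink_subset hW hWc hzW k
  have hanti : Antitone (shrink z U) := antitone_nat_of_succ_le (shrink_succ_subset hU hUc hz)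
  set D := (1 / 2 : ℝ) ^ k * d with hD
  have hD0 : 0 < D := by positivity
  have hUj : shrink z U j ⊆ shrink z W k := (hanti hkj).trans (shrink_mono z hUW k)
  have hui : IntegrableOn u (shrink z W k) volume := by
    have hbk := hbW.subset hWk
    have : IsFiniteMeasure (volume.restrict (shrink z W k)) :=
      ⟨by simpa using hbk.measure_lt_top⟩
    exact (hu.mono_measure (Measure.restrict_mono_set _ (hWk.trans hWΩ))).integrable (by norm_num)
  -- The extrapolation at j uses the copy with index j + 1 ≤ k + 2, that is, two halvings beyond
  -- scale k.
  have hv : c * (D / 4) ^ n ≤ volume.real (shrink z U (j + 1)) := by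
    calc c * (D / 4) ^ n = ((1 / 2 : ℝ) ^ (k + 2)) ^ n * (c * d ^ n) := by
          rw [hD, mul_left_comm, ← mul_pow]
          congr 2
          ring
      _ ≤ ((1 / 2 : ℝ) ^ (j + 1)) ^ n * volume.real U := by
          refine mul_le_mul (pow_le_pow_left₀ (by positivity) ?_ _) hcU (by positivity)
            (by positivity)
          exact pow_le_pow_of_le_one (by norm_num) (by norm_num) (by omega)
      _ = _ := (volume_real_shrink z U (j + 1)).symm
  refine (abs_extrapolate_sub_le hU hUc (hbW.subset hUW) hz hUj (hbW.subset hWk) hui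
    (by positivity) happ (by positivity) hv).trans (le_of_eq ?_)
  have e : S * D ^ (2 * r) * m / (c * (D / 4) ^ n)
      = (S * 4 ^ n / c) * m * (D ^ (r - n / 2)) ^ 2 := by
    have h1 : (D ^ (r - n / 2 : ℝ)) ^ 2 = D ^ (2 * r) / D ^ n := by
      rw [← Real.rpow_natCast (D ^ (r - n / 2 : ℝ)) 2, ← Real.rpow_mul hD0.le,
        ← Real.rpow_natCast D n, ← Real.rpow_sub hD0]
      congr 1
      push_cast
      ring
    rw [h1, div_pow]
    field_simp
  rw [e, Real.sqrt_mul (by positivity), Real.sqrt_mul (by positivity),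
    Real.sqrt_sq (by positivity)]
  ring

/-- Consecutive extrapolations are both compared with the affine function of scale k, so they differ
by a multiple of q^k with q = 2^-(r-n/2). The hypothesis n < 2r says exactly that q < 1. -/
theorem exists_tendsto_extrapolate [IsFiniteMeasure μ] (hn : (n : ℝ) < 2 * r) (hc : 0 < c)
    (hS : 0 ≤ S) (hu : MemLp u 2 (volume.restrict Ω)) (happ : AffineApprox Ω μ u r c S) :
    ∃ A : ℝ, 0 ≤ A ∧ ∀ U : Set (E n), IsOpen U → Convex ℝ U → U ⊆ Ω → ∀ d : ℝ, 0 < d →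
      (∀ x ∈ U, ∀ y ∈ U, dist x y ≤ d) → c * d ^ n ≤ volume.real U → ∀ z ∈ closure U,
        ∃ ℓ, Tendsto (extrapolate u z U) atTop (𝓝 ℓ) ∧ ∀ (κ : ℝ) (a : E n),
          ∫⁻ x in U, ‖u x - (κ + inner ℝ a x)‖ₑ ^ 2
              ≤ ENNReal.ofReal (S * d ^ (2 * r) * μ.real U) →
            |ℓ - (κ + inner ℝ a z)| ≤ A * √(μ.real U) * d ^ (r - n / 2) := by
  set s := r - n / 2 with hs
  have hs0 : 0 < s := by rw [hs]; linarith
  set q := (1 / 2 : ℝ) ^ s with hq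
  have hq1 : q < 1 := Real.rpow_lt_one (by norm_num) (by norm_num) hs0
  set B := 3 * √(S * 4 ^ n / c) with hB
  have hB0 : 0 ≤ B := by positivity
  have hq' : 0 < 1 - q := by linarith
  -- The 1 is the error of the extrapolation at scale 0, and 2 / (1 − q) sums the geometric series
  -- from there to the limit.
  refine ⟨B * (1 + 2 / (1 - q)), by positivity, fun U hU hUc hUΩ d hd hdU hcU z hz => ?_⟩
  set m := μ.real U with hm
  have hm0 : 0 ≤ m := measureReal_nonneg
  have hpow : ∀ k : ℕ, ((1 / 2 : ℝ) ^ k * d) ^ s = d ^ s * q ^ k := by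
    intro k
    rw [Real.mul_rpow (by positivity) hd.le, hq, ← Real.rpow_natCast, ← Real.rpow_natCast,
      ← Real.rpow_mul (by norm_num), ← Real.rpow_mul (by norm_num), mul_comm (k : ℝ), mul_comm]
  have hex : ∀ k, ∃ (κ : ℝ) (a : E n), ∫⁻ x in shrink z U k, ‖u x - (κ + inner ℝ a x)‖ₑ ^ 2
      ≤ ENNReal.ofReal (S * ((1 / 2 : ℝ) ^ k * d) ^ (2 * r) * m) := by
    intro k
    obtain ⟨κ, a, h⟩ := happ (shrink z U k) (isOpen_shrink z hU k) (convex_shrink z hUc k)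
      ((shrink_subset hU hUc hz k).trans hUΩ) ((1 / 2 : ℝ) ^ k * d) (by positivity)
      (dist_le_of_mem_shrink hdU k) (by
        rw [volume_real_shrink, mul_pow, mul_left_comm]
        gcongr)
    refine ⟨κ, a, h.trans (ENNReal.ofReal_le_ofReal ?_)⟩
    have : μ.real (shrink z U k) ≤ m := measureReal_mono (shrink_subset hU hUc hz k)
    gcongr
  have hest : ∀ k j, k ≤ j → j ≤ k + 1 → ∀ (κ : ℝ) (a : E n),
      ∫⁻ x in shrink z U k, ‖u x - (κ + inner ℝ a x)‖ₑ ^ 2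
        ≤ ENNReal.ofReal (S * ((1 / 2 : ℝ) ^ k * d) ^ (2 * r) * m) →
      |extrapolate u z U j - (κ + inner ℝ a z)| ≤ B * √m * d ^ s * q ^ k := by
    intro k j hkj hjk κ a h
    have := abs_extrapolate_sub_le_of_approx hc hS hu hU hUc hU hUc hUΩ le_rfl hd hdU hcU hz
      hkj hjk hm0 h
    rw [hpow] at this
    exact this.trans (le_of_eq (by rw [hB]; ring))
  have hdist : ∀ k, dist (extrapolate u z U k) (extrapolate u z U (k + 1))
      ≤ 2 * (B * √m * d ^ s) * q ^ k := by
    intro k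
    obtain ⟨κ, a, h⟩ := hex k
    have h1 := hest k k le_rfl (by omega) κ a h
    have h2 := hest k (k + 1) (by omega) le_rfl κ a h
    rw [Real.dist_eq]
    rw [abs_le] at *
    constructor <;> linarith [h1.1, h1.2, h2.1, h2.2]
  obtain ⟨ℓ, hℓ⟩ := cauchySeq_tendsto_of_complete (cauchySeq_of_le_geometric q _ hq1 hdist)
  refine ⟨ℓ, hℓ, fun κ a h => ?_⟩
  have h1 := dist_le_of_le_geometric_of_tendsto₀ q _ hq1 hdist hℓ
  have h2 := hest 0 0 le_rfl (by omega) κ a (by simpa [shrink] using h)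
  rw [pow_zero, mul_one] at h2
  calc |ℓ - (κ + inner ℝ a z)|
      ≤ |extrapolate u z U 0 - (κ + inner ℝ a z)| + dist (extrapolate u z U 0) ℓ := by
        rw [dist_comm, Real.dist_eq]
        linarith [abs_sub_le ℓ (extrapolate u z U 0) (κ + inner ℝ a z)]
    _ ≤ B * √m * d ^ s + 2 * (B * √m * d ^ s) / (1 - q) := add_le_add h2 h1
    _ = _ := by ring

/-- At every scale both extrapolations are close to the same affine approximation on the shrunken
larger set W, so their difference tends to 0. No uniformity in U is needed, so c may be read off
from the volume of U. -/
theorem extrapolate_limit_unique [IsFiniteMeasure μ] (hn : (n : ℝ) < 2 * r)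
    (hu : MemLp u 2 (volume.restrict Ω))
    (happ : ∀ c, 0 < c → ∃ S, 0 ≤ S ∧ AffineApprox Ω μ u r c S) {U W : Set (E n)}
    (hU : IsOpen U) (hUc : Convex ℝ U) (hUne : U.Nonempty) (hW : IsOpen W) (hWc : Convex ℝ W)
    (hWΩ : W ⊆ Ω) (hWb : Bornology.IsBounded W) (hUW : U ⊆ W) {z : E n} (hz : z ∈ closure U)
    {ℓ ℓ' : ℝ} (hℓ : Tendsto (extrapolate u z U) atTop (𝓝 ℓ))
    (hℓ' : Tendsto (extrapolate u z W) atTop (𝓝 ℓ')) : ℓ = ℓ' := by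
  obtain ⟨d₀, hd₀⟩ := Metric.isBounded_iff.1 hWb
  set d := max d₀ 1 with hd
  have hd0 : 0 < d := lt_max_of_lt_right one_pos
  have hdW : ∀ x ∈ W, ∀ y ∈ W, dist x y ≤ d := fun x hx y hy =>
    (hd₀ hx hy).trans (le_max_left _ _)
  have hUpos : 0 < volume.real U := ENNReal.toReal_pos (hU.measure_pos volume hUne).ne'
    (hWb.subset hUW).measure_lt_top.ne
  have hUW' : volume.real U ≤ volume.real W := measureReal_mono hUW hWb.measure_lt_top.ne
  set c := volume.real U / d ^ n with hc
  have hc0 : 0 < c := by positivity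
  have hcU : c * d ^ n ≤ volume.real U := by rw [hc, div_mul_cancel₀ _ (by positivity)]
  obtain ⟨S, hS, happ⟩ := happ c hc0
  have hzW : z ∈ closure W := closure_mono hUW hz
  set m := μ.real W with hm
  set s := r - n / 2 with hs
  have hs0 : 0 < s := by rw [hs]; linarith
  set B := 3 * √(S * 4 ^ n / c) with hB
  have hle : ∀ k, |extrapolate u z U k - extrapolate u z W k|
      ≤ 2 * (B * √m * ((1 / 2 : ℝ) ^ k * d) ^ s) := by
    intro k
    obtain ⟨κ, a, h⟩ := happ (shrink z W k) (isOpen_shrink z hW k) (convex_shrink z hWc k)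
      ((shrink_subset hW hWc hzW k).trans hWΩ) ((1 / 2 : ℝ) ^ k * d) (by positivity)
      (dist_le_of_mem_shrink hdW k) (by
        rw [volume_real_shrink, mul_pow, mul_left_comm]
        have := hcU.trans hUW'
        gcongr)
    have h' := h.trans (ENNReal.ofReal_le_ofReal (mul_le_mul_of_nonneg_left
      (measureReal_mono (μ := μ) (shrink_subset hW hWc hzW k)) (by positivity)))
    have h1 := abs_extrapolate_sub_le_of_approx hc0 hS hu hU hUc hW hWc hWΩ hUW hd0 hdW hcU hz
      le_rfl (Nat.le_succ k) measureReal_nonneg h'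
    have h2 := abs_extrapolate_sub_le_of_approx hc0 hS hu hW hWc hW hWc hWΩ le_rfl hd0 hdW
      (hcU.trans hUW') hzW le_rfl (Nat.le_succ k) measureReal_nonneg h'
    rw [abs_le] at *
    constructor <;> linarith [h1.1, h1.2, h2.1, h2.2]
  have hlim : Tendsto (fun k : ℕ => 2 * (B * √m * ((1 / 2 : ℝ) ^ k * d) ^ s)) atTop (𝓝 0) := by
    have h1 : Tendsto (fun k : ℕ => (1 / 2 : ℝ) ^ k * d) atTop (𝓝 0) := by
      simpa using (tendsto_pow_atTop_nhds_zero_of_lt_one (by norm_num : (0 : ℝ) ≤ 1 / 2)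
        (by norm_num)).mul_const d
    have h2 := h1.rpow_const (p := s) (Or.inr hs0.le)
    rw [Real.zero_rpow hs0.ne'] at h2
    simpa using (h2.const_mul (B * √m)).const_mul 2
  have h0 : Tendsto (fun k => extrapolate u z U k - extrapolate u z W k) atTop (𝓝 0) :=
    squeeze_zero_norm hle hlim
  exact sub_eq_zero.1 (tendsto_nhds_unique (hℓ.sub hℓ') h0)

end PointValues

/-! ### Interior cones and linking of convex sets -/

section Cone

open scoped Pointwise

variable {n : ℕ} {Ω : Set (E n)}

theorem IsChart.apply_add_le {x₀ e : E n} {δ : ℝ} {K : ℝ≥0} {ψ : E n → ℝ}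
    (h : IsChart Ω x₀ e δ K ψ) (y w : E n) :
    ψ (y + w) ≤ ψ y + K * ‖w - (inner ℝ e w : ℝ) • e‖ := by
  have h1 : ψ (y + w) = ψ (y + (w - (inner ℝ e w : ℝ) • e)) := by
    rw [← h.apply_add (y + (w - _)) (inner ℝ e w), add_assoc, sub_add_cancel]
  have h2 := h.lip.dist_le_mul (y + (w - (inner ℝ e w : ℝ) • e)) y
  rw [dist_eq_norm (y + _), add_sub_cancel_left, Real.dist_eq] at h2
  rw [h1]
  linarith [le_abs_self (ψ (y + (w - (inner ℝ e w : ℝ) • e)) - ψ y)]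

/-- Where this function is negative there is an open convex cone around e; displacements in it rise
faster than any K-Lipschitz graph, so inside a chart they do not leave Ω. -/
theorem convexOn_perp (e : E n) (K : ℝ≥0) :
    ConvexOn ℝ Set.univ fun w : E n => K * ‖w - (inner ℝ e w : ℝ) • e‖ - inner ℝ e w := by
  refine ⟨convex_univ, fun x _ y _ a b ha hb hab => ?_⟩
  have h1 : (a • x + b • y) - (inner ℝ e (a • x + b • y) : ℝ) • e
      = a • (x - (inner ℝ e x : ℝ) • e) + b • (y - (inner ℝ e y : ℝ) • e) := by
    rw [inner_add_right, inner_smul_right, inner_smul_right]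
    module
  have h2 := norm_add_le (a • (x - (inner ℝ e x : ℝ) • e)) (b • (y - (inner ℝ e y : ℝ) • e))
  rw [norm_smul, norm_smul, Real.norm_of_nonneg ha, Real.norm_of_nonneg hb] at h2
  have h3 := mul_le_mul_of_nonneg_left h2 K.2
  simp only [smul_eq_mul]
  rw [h1, inner_add_right, inner_smul_right, inner_smul_right]
  have : (K : ℝ) = K.1 := rfl
  rw [this]
  linarith

/-- Any two convex open subsets of a Lipschitz domain with a common point `z` in their closures
are, near `z`, contained in larger such sets that overlap near `z`. -/
theorem exists_convex_link (ho : IsOpen Ω) (hlip : HasLipschitzBoundary Ω) {z : E n}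
    (hz : z ∈ closure Ω) :
    ∃ D : Set (E n), IsOpen D ∧ Convex ℝ D ∧ D ⊆ Ω ∧ z ∈ closure D ∧
      ∀ U : Set (E n), IsOpen U → Convex ℝ U → U ⊆ Ω → z ∈ closure U →
        ∃ ε > 0, ∃ W : Set (E n), IsOpen W ∧ Convex ℝ W ∧ W ⊆ Ω ∧
          U ∩ Metric.ball z ε ⊆ W ∧ D ∩ Metric.ball z ε ⊆ W := by
  by_cases hzΩ : z ∈ Ω
  · obtain ⟨δ, hδ, hb⟩ := Metric.isOpen_iff.1 ho z hzΩ
    exact ⟨Metric.ball z δ, Metric.isOpen_ball, convex_ball _ _, hb,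
      subset_closure (Metric.mem_ball_self hδ), fun U _ _ _ _ => ⟨δ, hδ, Metric.ball z δ,
        Metric.isOpen_ball, convex_ball _ _, hb, Set.inter_subset_right, Set.inter_subset_right⟩⟩
  have hfr : z ∈ frontier Ω := by rw [ho.frontier_eq]; exact ⟨hz, hzΩ⟩
  obtain ⟨e, δ, K, ψ, h⟩ := exists_isChart hlip hfr
  have hδ := h.pos
  set p : E n → ℝ := fun w => K * ‖w - (inner ℝ e w : ℝ) • e‖ - inner ℝ e w with hp
  have hpc : Continuous p := by fun_prop
  have hpconv := convexOn_perp e K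
  have hpe : ∀ t : ℝ, p (t • e) = -t := by
    intro t
    have : (inner ℝ e (t • e) : ℝ) = t := by
      rw [inner_smul_right, real_inner_self_eq_norm_sq, h.norm_eq]; ring
    simp [hp, this]
  have hψz : ψ z ≤ inner ℝ e z := (h.mem_closure_iff (Metric.mem_ball_self hδ)).1 hz
  have habove : ∀ y w, ψ (y + w) - inner ℝ e (y + w) ≤ ψ y - inner ℝ e y + p w := by
    intro y w
    have := h.apply_add_le y w
    rw [inner_add_right]
    simp only [hp]
    linarith
  -- The reference set D is the truncated open cone with apex z.
  refine ⟨{x | p (x - z) < 0} ∩ Metric.ball z δ, ?_, ?_, ?_, ?_, ?_⟩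
  · exact (isOpen_lt (by fun_prop) continuous_const).inter Metric.isOpen_ball
  · refine Convex.inter ?_ (convex_ball _ _)
    set f : E n →ᵃ[ℝ] E n := AffineMap.id ℝ (E n) - AffineMap.const ℝ (E n) z with hf
    have h1 := (hpconv.convex_lt 0).affine_preimage f
    have h2 : f ⁻¹' {x | x ∈ Set.univ ∧ p x < 0} = {x | p (x - z) < 0} := by
      ext x
      simp [hf]
    rwa [← h2]
  · rintro x ⟨hx, hxb⟩
    rw [h.mem_iff x hxb]
    have := habove z (x - z)
    rw [add_sub_cancel] at this
    have hx' : p (x - z) < 0 := hx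
    linarith
  · have ht : Tendsto (fun t : ℝ => z + t • e) (𝓝[>] 0) (𝓝 z) := by
      have : Continuous fun t : ℝ => z + t • e := by fun_prop
      simpa using (this.tendsto 0).mono_left nhdsWithin_le_nhds
    refine mem_closure_of_tendsto ht ?_
    filter_upwards [ht (Metric.ball_mem_nhds z hδ), self_mem_nhdsWithin] with t ht1 ht2
    refine ⟨?_, ht1⟩
    have : 0 < t := ht2
    simp only [Set.mem_ofPred_eq, add_sub_cancel_left, hpe]
    linarith
  · intro U hU hUc hUΩ hzU
    -- The link W is the Minkowski sum of U near z with the truncated closed cone: convex as a sum,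
    -- inside Ω by the cone property, and containing U near z because 0 lies in the closed cone.
    refine ⟨δ / 2, by positivity, (U ∩ Metric.ball z (δ / 2)) +
      ({w | p w ≤ 0} ∩ Metric.ball 0 (δ / 2)), ?_, ?_, ?_, ?_, ?_⟩
    · exact (hU.inter Metric.isOpen_ball).add_right
    · refine (hUc.inter (convex_ball _ _)).add (Convex.inter ?_ (convex_ball _ _))
      have h1 := hpconv.convex_le 0
      simpa only [Set.mem_univ, true_and] using h1
    · rintro _ ⟨y, ⟨hyU, hyb⟩, w, ⟨hw, hwb⟩, rfl⟩
      have hyw : y + w ∈ Metric.ball z δ := by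
        rw [Metric.mem_ball, dist_eq_norm] at *
        have := norm_add_le (y - z) w
        rw [sub_zero] at hwb
        rw [add_sub_right_comm]
        linarith
      change y + w ∈ Ω
      rw [h.mem_iff _ hyw]
      have h1 := (h.mem_iff y (Metric.ball_subset_ball (by linarith) hyb)).1 (hUΩ hyU)
      have h2 := habove y w
      have hw' : p w ≤ 0 := hw
      linarith
    · intro y hy
      refine ⟨y, hy, 0, ⟨?_, Metric.mem_ball_self (by positivity)⟩, add_zero y⟩
      simp [hp]
    · rintro x ⟨⟨hx, -⟩, hxb⟩
      have hx' : p (x - z) < 0 := hx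
      -- A point x of D lies strictly inside the cone at z, hence also inside the cone at any y ∈ U
      -- close enough to z; then x = y + (x − y) is in the sum.
      have hopen : IsOpen ({y : E n | p (x - y) < 0} ∩ ({y | ‖x - y‖ < δ / 2} ∩
          {y | ‖y - z‖ < δ / 2})) :=
        (isOpen_lt (by fun_prop) continuous_const).inter
          ((isOpen_lt (by fun_prop) continuous_const).inter
            (isOpen_lt (by fun_prop) continuous_const))
      rw [Metric.mem_ball, dist_eq_norm] at hxb
      obtain ⟨y, ⟨hy1, hy2, hy3⟩, hyU⟩ := mem_closure_iff.1 hzU _ hopen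
        ⟨hx', hxb, by simpa using hδ⟩
      refine ⟨y, ⟨hyU, by rwa [Metric.mem_ball, dist_eq_norm]⟩, x - y, ⟨show p (x - y) ≤ 0 from le_of_lt hy1, ?_⟩,
        add_sub_cancel _ _⟩
      simpa using hy2

end Cone

/-! ### Nodal values independent of the approximating set -/

section NodalValues

variable {n : ℕ} {Ω : Set (E n)} {μ : Measure (E n)} {u : E n → ℝ} {r : ℝ}

theorem mem_closure_inter_ball {z : E n} {U : Set (E n)} (hz : z ∈ closure U) {ε : ℝ}
    (hε : 0 < ε) : z ∈ closure (U ∩ Metric.ball z ε) := by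
  rw [Set.inter_comm]
  exact Metric.isOpen_ball.inter_closure ⟨Metric.mem_ball_self hε, hz⟩

/-- A function that is close to affine functions has a well-defined value at each point of the
closure of a Lipschitz domain, namely the limit of extrapolated averages. -/
theorem exists_point_value [IsFiniteMeasure μ] (ho : IsOpen Ω) (hb : Bornology.IsBounded Ω)
    (hlip : HasLipschitzBoundary Ω) (hn : (n : ℝ) < 2 * r) (hu : MemLp u 2 (volume.restrict Ω))
    (happ : ∀ c, 0 < c → ∃ S, 0 ≤ S ∧ AffineApprox Ω μ u r c S) {z : E n} (hz : z ∈ closure Ω) :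
    ∃ ℓ, (∀ U : Set (E n), IsOpen U → Convex ℝ U → U ⊆ Ω → z ∈ closure U →
      Tendsto (extrapolate u z U) atTop (𝓝 ℓ)) ∧
      ((∀ᵐ x ∂(volume.restrict Ω), 0 ≤ u x) → 0 ≤ ℓ) := by
  have hlim : ∀ U : Set (E n), IsOpen U → Convex ℝ U → U ⊆ Ω → z ∈ closure U →
      ∃ ℓ, Tendsto (extrapolate u z U) atTop (𝓝 ℓ) := by
    intro U hU hUc hUΩ hzU
    have hUne : U.Nonempty := closure_nonempty_iff.1 ⟨z, hzU⟩
    obtain ⟨d₀, hd₀⟩ := Metric.isBounded_iff.1 (hb.subset hUΩ)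
    set d := max d₀ 1 with hd
    have hd0 : 0 < d := lt_max_of_lt_right one_pos
    have hdU : ∀ x ∈ U, ∀ y ∈ U, dist x y ≤ d := fun x hx y hy =>
      (hd₀ hx hy).trans (le_max_left _ _)
    have hUpos : 0 < volume.real U := ENNReal.toReal_pos (hU.measure_pos volume hUne).ne'
      (hb.subset hUΩ).measure_lt_top.ne
    obtain ⟨S, hS, h⟩ := happ (volume.real U / d ^ n) (by positivity)
    obtain ⟨A, -, hA⟩ := exists_tendsto_extrapolate hn (by positivity) hS hu h
    obtain ⟨ℓ, hℓ, -⟩ := hA U hU hUc hUΩ d hd0 hdU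
      (by rw [div_mul_cancel₀ _ (by positivity)]) z hzU
    exact ⟨ℓ, hℓ⟩
  have huniq : ∀ U W : Set (E n), IsOpen U → Convex ℝ U → z ∈ closure U → IsOpen W →
      Convex ℝ W → W ⊆ Ω → U ⊆ W → ∀ ℓ ℓ', Tendsto (extrapolate u z U) atTop (𝓝 ℓ) →
      Tendsto (extrapolate u z W) atTop (𝓝 ℓ') → ℓ = ℓ' :=
    fun U W hU hUc hzU hW hWc hWΩ hUW ℓ ℓ' h h' => extrapolate_limit_unique hn hu happ hU hUc
      (closure_nonempty_iff.1 ⟨z, hzU⟩) hW hWc hWΩ (hb.subset hWΩ) hUW hzU h h'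
  obtain ⟨D, hD, hDc, hDΩ, hzD, hlink⟩ := exists_convex_link ho hlip hz
  obtain ⟨ℓ, hℓ⟩ := hlim D hD hDc hDΩ hzD
  refine ⟨ℓ, fun U hU hUc hUΩ hzU => ?_, fun hu0 => ?_⟩
  · obtain ⟨ε, hε, W, hW, hWc, hWΩ, hUW, hDW⟩ := hlink U hU hUc hUΩ hzU
    -- Only the part of V near z lies in W, so V and W are compared through this part, which is
    -- contained in both.
    have aux : ∀ V : Set (E n), IsOpen V → Convex ℝ V → V ⊆ Ω → z ∈ closure V →
        V ∩ Metric.ball z ε ⊆ W → ∀ ℓ₁ ℓ₂, Tendsto (extrapolate u z V) atTop (𝓝 ℓ₁) →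
        Tendsto (extrapolate u z W) atTop (𝓝 ℓ₂) → ℓ₁ = ℓ₂ := by
      intro V hV hVc hVΩ hzV hVW ℓ₁ ℓ₂ h₁ h₂
      have ho' := hV.inter (Metric.isOpen_ball (x := z) (ε := ε))
      have hc' := hVc.inter (convex_ball z ε)
      have hz' := mem_closure_inter_ball hzV hε
      obtain ⟨ℓ₃, h₃⟩ := hlim _ ho' hc' (Set.inter_subset_left.trans hVΩ) hz'
      rw [← huniq _ V ho' hc' hz' hV hVc hVΩ Set.inter_subset_left ℓ₃ ℓ₁ h₃ h₁]
      exact huniq _ W ho' hc' hz' hW hWc hWΩ hVW ℓ₃ ℓ₂ h₃ h₂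
    obtain ⟨ℓU, hℓU⟩ := hlim U hU hUc hUΩ hzU
    obtain ⟨ℓW, hℓW⟩ := hlim W hW hWc hWΩ (closure_mono hUW (mem_closure_inter_ball hzU hε))
    rw [aux D hD hDc hDΩ hzD hDW ℓ ℓW hℓ hℓW, ← aux U hU hUc hUΩ hzU hUW ℓU ℓW hℓU hℓW]
    exact hℓU
  · refine extrapolate_limit_nonneg (fun k => ?_) hℓ
    rw [setAverage_eq]
    refine smul_nonneg (by positivity) (setIntegral_nonneg_of_ae_restrict ?_)
    exact ae_restrict_of_ae_restrict_of_subset ((shrink_subset hD hDc hzD k).trans hDΩ) hu0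

/-- The function w is fixed before c, S and any triangulation, so cells that share a vertex use the
same value there, while the constant A depends on the shape only through c and S. -/
theorem exists_nodal_values [IsFiniteMeasure μ] (ho : IsOpen Ω) (hb : Bornology.IsBounded Ω)
    (hlip : HasLipschitzBoundary Ω) (hn : (n : ℝ) < 2 * r) (hu : MemLp u 2 (volume.restrict Ω))
    (hu0 : ∀ᵐ x ∂(volume.restrict Ω), 0 ≤ u x)
    (happ : ∀ c, 0 < c → ∃ S, 0 ≤ S ∧ AffineApprox Ω μ u r c S) :
    ∃ w : E n → ℝ, (∀ z ∈ closure Ω, 0 ≤ w z) ∧ ∀ c S, 0 < c → 0 ≤ S →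
      AffineApprox Ω μ u r c S → ∃ A : ℝ, 0 ≤ A ∧ ∀ U : Set (E n), IsOpen U → Convex ℝ U →
        U ⊆ Ω → ∀ d : ℝ, 0 < d → (∀ x ∈ U, ∀ y ∈ U, dist x y ≤ d) →
          c * d ^ n ≤ volume.real U → ∀ z ∈ closure U, ∀ (κ : ℝ) (a : E n),
            ∫⁻ x in U, ‖u x - (κ + inner ℝ a x)‖ₑ ^ 2
                ≤ ENNReal.ofReal (S * d ^ (2 * r) * μ.real U) →
              |w z - (κ + inner ℝ a z)| ≤ A * √(μ.real U) * d ^ (r - n / 2) := by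
  have hex := fun z (hz : z ∈ closure Ω) => exists_point_value ho hb hlip hn hu happ hz
  choose! w hw hw0 using hex
  refine ⟨w, fun z hz => hw0 z hz hu0, fun c S hc hS h => ?_⟩
  obtain ⟨A, hA0, hA⟩ := exists_tendsto_extrapolate hn hc hS hu h
  refine ⟨A, hA0, fun U hU hUc hUΩ d hd hdU hcU z hz κ a hp => ?_⟩
  obtain ⟨ℓ, hℓ, hℓp⟩ := hA U hU hUc hUΩ d hd hdU hcU z hz
  rw [tendsto_nhds_unique (hw z (closure_mono hUΩ hz) U hU hUc hUΩ hz) hℓ]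
  exact hℓp κ a hp

end NodalValues

/-! ### Lipschitz continuity of piecewise Lipschitz functions -/

section PiecewiseLipschitz

variable {n : ℕ} {Ω : Set (E n)}

/-- A continuous function that is Lipschitz on each of finitely many closed sets is Lipschitz along
segments contained in their union. -/
theorem abs_sub_le_of_segment_subset {𝒞 : Set (Set (E n))} (hfin : 𝒞.Finite)
    (hcl : ∀ C ∈ 𝒞, IsClosed C) {f : E n → ℝ} (hf : ContinuousOn f (⋃₀ 𝒞)) {L : ℝ}
    (hL : ∀ C ∈ 𝒞, ∀ x ∈ C, ∀ y ∈ C, |f x - f y| ≤ L * dist x y) {x y : E n}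
    (hxy : segment ℝ x y ⊆ ⋃₀ 𝒞) : |f y - f x| ≤ L * dist x y := by
  set p : ℝ → E n := ⇑(AffineMap.lineMap x y : ℝ →ᵃ[ℝ] E n) with hp
  have hpc : Continuous p := AffineMap.lineMap_continuous
  have hpS : ∀ t ∈ Set.Icc (0 : ℝ) 1, p t ∈ ⋃₀ 𝒞 := fun t ht =>
    hxy (by rw [segment_eq_image_lineMap]; exact ⟨t, ht, rfl⟩)
  have hfp : ContinuousOn (fun t => f (p t)) (Set.Icc 0 1) :=
    hf.comp hpc.continuousOn hpS
  -- Continuous induction along the segment: Z is closed in [0, 1], contains 0, and is shown to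
  -- continue to the right of each of its points.
  set Z : Set ℝ := {t | |f (p t) - f x| ≤ L * (t * dist x y)} with hZ
  have hclosed : IsClosed (Z ∩ Set.Icc 0 1) := by
    rw [Set.inter_comm]
    have h1 : ContinuousOn (fun t => |f (p t) - f x| - L * (t * dist x y)) (Set.Icc 0 1) :=
      ((hfp.sub continuousOn_const).abs).sub (by fun_prop)
    have := h1.preimage_isClosed_of_isClosed isClosed_Icc (isClosed_Iic (a := 0))
    convert! this using 2
    ext t
    simp [hZ]
  have h0 : (0 : ℝ) ∈ Z := by simp [hZ, hp]
  have hsub : Set.Icc (0 : ℝ) 1 ⊆ Z := by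
    refine hclosed.Icc_subset_of_forall_exists_gt h0 ?_
    rintro t ⟨htZ, ht0, ht1⟩ s hs
    have hts : t < s := hs
    -- Pigeonhole: one of the finitely many sets contains points of the segment arbitrarily close to
    -- p t on the right, and by closedness p t itself, so its own Lipschitz bound advances the
    -- estimate.
    have hfreq : ∃ C ∈ 𝒞, ∃ᶠ τ in 𝓝[>] t, p τ ∈ C := by
      by_contra! hcon
      have hall : ∀ᶠ τ in 𝓝[>] t, ∀ C ∈ 𝒞, p τ ∉ C :=
        (eventually_all_finite hfin).2 fun C hC => by simpa using hcon C hC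
      obtain ⟨τ, hτ1, hτ2⟩ := (hall.and (Ioo_mem_nhdsGT ht1)).exists
      obtain ⟨C, hC, hτC⟩ := hpS τ ⟨ht0.trans hτ2.1.le, hτ2.2.le⟩
      exact hτ1 C hC hτC
    obtain ⟨C, hC, hfr⟩ := hfreq
    have htC : p t ∈ C := by
      by_contra htC
      have : ∀ᶠ τ in 𝓝[>] t, p τ ∉ C :=
        nhdsWithin_le_nhds (hpc.continuousAt.eventually ((hcl C hC).isOpen_compl.mem_nhds htC))
      exact hfr this
    obtain ⟨τ, hτC, hτ1, hτ2⟩ := (hfr.and_eventually (Ioo_mem_nhdsGT hts)).exists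
    refine ⟨τ, ?_, hτ1, hτ2.le⟩
    have h1 := hL C hC (p τ) hτC (p t) htC
    have h2 : dist (p τ) (p t) = (τ - t) * dist x y := by
      rw [hp, dist_lineMap_lineMap, Real.dist_eq, abs_of_pos (sub_pos.2 hτ1)]
    have h3 : |f (p t) - f x| ≤ L * (t * dist x y) := htZ
    change |f (p τ) - f x| ≤ L * (τ * dist x y)
    rw [h2] at h1
    have h4 := abs_sub_le (f (p τ)) (f (p t)) (f x)
    nlinarith
  have := hsub (Set.right_mem_Icc.2 zero_le_one)
  simpa [hZ, hp] using this

/-- A function on the closure of a bounded Lipschitz domain that is Lipschitz along segments is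
Lipschitz. -/
theorem exists_lipschitzOnWith_closure (ho : IsOpen Ω) (hb : Bornology.IsBounded Ω)
    (hlip : HasLipschitzBoundary Ω) {f : E n → ℝ} {L : ℝ≥0}
    (hL : ∀ x y, segment ℝ x y ⊆ closure Ω → |f y - f x| ≤ L * dist x y) :
    ∃ L' : ℝ≥0, LipschitzOnWith L' f (closure Ω) := by
  refine LocallyLipschitzOn.exists_lipschitzOnWith_of_compact hb.isCompact_closure ?_
  intro x₀ hx₀
  by_cases hxΩ : x₀ ∈ Ω
  · obtain ⟨ε, hε, hball⟩ := Metric.isOpen_iff.1 ho x₀ hxΩ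
    refine ⟨L, Metric.ball x₀ ε, mem_nhdsWithin_of_mem_nhds (Metric.ball_mem_nhds _ hε), ?_⟩
    refine LipschitzOnWith.of_dist_le_mul fun x hx y hy => ?_
    rw [dist_comm (f x), Real.dist_eq]
    exact hL x y (((convex_ball x₀ ε).segment_subset hx hy).trans (hball.trans subset_closure))
  have hfr : x₀ ∈ frontier Ω := by rw [ho.frontier_eq]; exact ⟨hx₀, hxΩ⟩
  obtain ⟨e, δ, K, ψ, h⟩ := exists_isChart hlip hfr
  have hδ := h.pos
  -- Chosen so that η + (K + 1) · 2η = δ: points of the small ball are less than 2η apart, so the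
  -- lift below keeps them in the chart.
  set η := δ / (2 * K + 3) with hη
  have hK : (0 : ℝ) ≤ K := K.2
  have hη0 : 0 < η := by positivity
  have hηδ : η + (K + 1) * (2 * η) = δ := by rw [hη]; field_simp; ring
  refine ⟨L * (2 * (K + 1) + 1), closure Ω ∩ Metric.ball x₀ η,
    inter_mem_nhdsWithin _ (Metric.ball_mem_nhds _ hη0), ?_⟩
  refine LipschitzOnWith.of_dist_le_mul ?_
  rintro x ⟨hxc, hxb⟩ y ⟨hyc, hyb⟩
  -- The points are joined by going up by t, across, and down. Along the crossing the graph rises by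
  -- at most K dist x y and the height drops by at most dist x y, so this t keeps the path in the
  -- closure of Ω.
  set t := (K + 1) * dist x y with ht
  have ht0 : 0 ≤ t := by positivity
  have hxy : dist x y ≤ 2 * η := by
    rw [Metric.mem_ball] at hxb hyb
    linarith [dist_triangle_right x y x₀]
  have htη : η + t ≤ δ := by
    rw [← hηδ, ht]
    gcongr
  have hηle : η ≤ δ := by linarith
  have hvert : ∀ z ∈ closure Ω, z ∈ Metric.ball x₀ η → segment ℝ z (z + t • e) ⊆ closure Ω := by
    intro z hzc hzb w hw
    rw [segment_eq_image_lineMap] at hw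
    obtain ⟨s, ⟨hs0, hs1⟩, rfl⟩ := hw
    have e1 : AffineMap.lineMap z (z + t • e) s = z + (s * t) • e := by
      simp [AffineMap.lineMap_apply, smul_smul, add_comm]
    have hst : s * t ≤ t := by nlinarith
    have hst0 : 0 ≤ s * t := by positivity
    rw [e1, h.mem_closure_iff (h.add_smul_mem_ball hzb hst0 (by linarith)), h.apply_add,
      h.inner_add_smul]
    have := (h.mem_closure_iff (Metric.ball_subset_ball hηle hzb)).1 hzc
    linarith
  have hhor : segment ℝ (x + t • e) (y + t • e) ⊆ closure Ω := by
    intro w hw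
    have hwb : w ∈ Metric.ball x₀ δ := (convex_ball x₀ δ).segment_subset
      (h.add_smul_mem_ball hxb ht0 htη) (h.add_smul_mem_ball hyb ht0 htη) hw
    rw [segment_eq_image_lineMap] at hw
    obtain ⟨s, ⟨hs0, hs1⟩, rfl⟩ := hw
    have e1 : AffineMap.lineMap (x + t • e) (y + t • e) s = (x + s • (y - x)) + t • e := by
      simp only [AffineMap.lineMap_apply, vsub_eq_sub, vadd_eq_add]
      module
    rw [e1] at hwb ⊢
    rw [h.mem_closure_iff hwb, h.apply_add, h.inner_add_smul, inner_add_right, inner_smul_right]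
    have h1 := (h.mem_closure_iff (Metric.ball_subset_ball hηle hxb)).1 hxc
    have h2 := h.lip.dist_le_mul (x + s • (y - x)) x
    rw [dist_eq_norm (x + _), add_sub_cancel_left, norm_smul, Real.norm_of_nonneg hs0,
      ← dist_eq_norm, dist_comm y x, Real.dist_eq] at h2
    have h3 := abs_le.1 (abs_real_inner_le_norm e (y - x))
    rw [h.norm_eq, one_mul, ← dist_eq_norm, dist_comm y x] at h3
    have h4 : (K : ℝ) * (s * dist x y) ≤ K * dist x y := by
      gcongr
      nlinarith [dist_nonneg (x := x) (y := y)]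
    have h5 : -dist x y ≤ s * inner ℝ e (y - x) := by
      nlinarith [dist_nonneg (x := x) (y := y)]
    have h6 := le_abs_self (ψ (x + s • (y - x)) - ψ x)
    rw [ht]
    linarith
  have hdist : ∀ z : E n, dist z (z + t • e) = t := by
    intro z
    rw [dist_self_add_right, norm_smul, h.norm_eq, mul_one, Real.norm_of_nonneg ht0]
  have b1 := hL _ _ (hvert x hxc hxb)
  have b2 := hL _ _ hhor
  have b3 := hL _ _ (hvert y hyc hyb)
  rw [hdist] at b1 b3
  rw [dist_add_right] at b2
  rw [Real.dist_eq]
  push_cast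
  have : (L : ℝ) * (2 * (K + 1) + 1) * dist x y = L * t + L * dist x y + L * t := by
    rw [ht]; ring
  rw [this]
  rw [abs_le] at *
  constructor <;> linarith [b1.1, b1.2, b2.1, b2.2, b3.1, b3.2]

end PiecewiseLipschitz

/-! ### Piecewise affine Lipschitz functions belong to H¹ -/

section LipschitzH1

variable {n : ℕ} {Ω : Set (E n)}

theorem eLpNorm_two_eq {X F : Type*} [MeasurableSpace X] [NormedAddCommGroup F] (f : X → F)
    (μ : Measure X) : eLpNorm f 2 μ = (∫⁻ x, ‖f x‖ₑ ^ 2 ∂μ) ^ (1 / 2 : ℝ) := by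
  rw [eLpNorm_eq_lintegral_rpow_enorm_toReal (by simp) (by simp)]
  simp

theorem eLpNorm_two_sq {X F : Type*} [MeasurableSpace X] [NormedAddCommGroup F] (f : X → F)
    (μ : Measure X) : eLpNorm f 2 μ ^ 2 = ∫⁻ x, ‖f x‖ₑ ^ 2 ∂μ := by
  rw [eLpNorm_two_eq, ← ENNReal.rpow_two, ← ENNReal.rpow_mul]
  norm_num

/-- A Lipschitz function that is locally affine almost everywhere belongs to `H¹(Ω)`. -/
theorem exists_H1_of_lipschitz (ho : IsOpen Ω) (hb : Bornology.IsBounded Ω)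
    (hsurf : surf n (frontier Ω) < ⊤) {w : E n → ℝ} {L : ℝ≥0} (hw : LipschitzWith L w)
    (hloc : ∀ᵐ x ∂(volume.restrict Ω), ∃ A : E n →ᵃ[ℝ] ℝ, w =ᶠ[𝓝 x] A) :
    ∃ v : H1 Ω, v.val = w ∧ v.grad = gradient w ∧ v.trace = w := by
  have hwc := hw.continuous
  set η : ℕ → ℝ := fun k => 1 / (k + 1) with hη
  have hη0 : ∀ k, 0 < η k := fun k => by positivity
  have hη1 : ∀ k, η k ≤ 1 := fun k => by
    rw [hη]
    exact div_le_one_of_le₀ (by linarith [(k.cast_nonneg : (0 : ℝ) ≤ k)]) (by positivity)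
  have hηt : Tendsto η atTop (𝓝 0) := tendsto_one_div_add_atTop_nhds_zero_nat
  let ρ : ℕ → ContDiffBump (0 : E n) := fun k => ⟨η k / 2, η k, by linarith [hη0 k],
    by linarith [hη0 k]⟩
  set φ : ℕ → E n → ℝ := fun k x => ∫ t, (ρ k).normed volume t * w (x - t) with hφ
  have hφeq : ∀ k, φ k = MeasureTheory.convolution ((ρ k).normed volume) w
      (ContinuousLinearMap.lsmul ℝ ℝ) volume := fun k => by
    ext x
    simp [hφ, convolution_def]
  have hφs : ∀ k, ContDiff ℝ ∞ (φ k) := fun k => by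
    rw [hφeq]
    exact (ρ k).hasCompactSupport_normed.contDiff_convolution_left (ContinuousLinearMap.lsmul ℝ ℝ)
      (ρ k).contDiff_normed hwc.locallyIntegrable
  have hint : ∀ k (f : E n → ℝ), Continuous f →
      Integrable (fun t => (ρ k).normed volume t * f t) volume := fun k f hf =>
    ((ρ k).continuous_normed.mul hf).integrable_of_hasCompactSupport
      (ρ k).hasCompactSupport_normed.mul_right
  have hφL : ∀ k, LipschitzWith L (φ k) := by
    intro k
    refine LipschitzWith.of_dist_le_mul fun x y => ?_
    rw [Real.dist_eq, hφ]
    simp only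
    rw [← integral_sub (hint k (fun t => w (x - t)) (by fun_prop))
      (hint k (fun t => w (y - t)) (by fun_prop))]
    calc ‖∫ t, ((ρ k).normed volume t * w (x - t) - (ρ k).normed volume t * w (y - t))‖
        ≤ ∫ t, (ρ k).normed volume t * (L * dist x y) := by
          refine norm_integral_le_of_norm_le (hint k (fun _ => L * dist x y) continuous_const)
            (Eventually.of_forall fun t => ?_)
          rw [← mul_sub, norm_mul, Real.norm_of_nonneg ((ρ k).nonneg_normed t)]
          refine mul_le_mul_of_nonneg_left ?_ ((ρ k).nonneg_normed t)
          have := hw.dist_le_mul (x - t) (y - t)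
          rwa [dist_sub_right] at this
      _ = L * dist x y := by
          rw [integral_mul_const, (ρ k).integral_normed (μ := volume), one_mul]
  have hφw : ∀ k x, ‖φ k x - w x‖ ≤ L * η k := by
    intro k x
    rw [← dist_eq_norm, hφeq]
    refine ContDiffBump.dist_normed_convolution_le hwc.aestronglyMeasurable fun y hy => ?_
    refine (hw.dist_le_mul y x).trans ?_
    have : dist y x < η k := hy
    gcongr
  have hgradbound : ∀ k x, ‖gradient (φ k) x‖ ≤ L := by
    intro k x
    rw [gradient, LinearIsometryEquiv.norm_map]
    exact norm_fderiv_le_of_lipschitz ℝ (hφL k)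
  have hgradw : ∀ x, ‖gradient w x‖ ≤ L := by
    intro x
    rw [gradient, LinearIsometryEquiv.norm_map]
    exact norm_fderiv_le_of_lipschitz ℝ hw
  -- Where w is affine near x, averaging with a sufficiently small kernel changes w near x only by a
  -- constant, so the gradients at x agree exactly from some k on.
  have hgradlim : ∀ᵐ x ∂(volume.restrict Ω), ∀ᶠ k in atTop, gradient (φ k) x = gradient w x := by
    filter_upwards [hloc] with x hx
    obtain ⟨A, hA⟩ := hx
    have hAc : Continuous A := A.continuous_of_finiteDimensional
    have hAl : Continuous A.linear := A.linear.continuous_of_finiteDimensional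
    obtain ⟨ε, hε, hball⟩ := Metric.eventually_nhds_iff_ball.1 hA
    filter_upwards [hηt.eventually_lt_const (half_pos hε)] with k hk
    have hφA : φ k =ᶠ[𝓝 x] fun y => A y - ∫ t, (ρ k).normed volume t * A.linear t := by
      filter_upwards [Metric.ball_mem_nhds x (half_pos hε)] with y hy
      have e1 : φ k y = ∫ t, ((ρ k).normed volume t * A y
          - (ρ k).normed volume t * A.linear t) := by
        refine integral_congr_ae (Eventually.of_forall fun t => ?_)
        simp only
        rw [← mul_sub]
        by_cases ht : t ∈ Function.support ((ρ k).normed (volume : Measure (E n)))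
        · rw [(ρ k).support_normed_eq, mem_ball_zero_iff] at ht
          have ht' : ‖t‖ < η k := ht
          rw [hball (y - t) (by
            rw [Metric.mem_ball, dist_eq_norm] at *
            have := norm_sub_le (y - x) t
            rw [sub_right_comm]
            linarith)]
          have := A.map_vadd y (-t)
          simp only [vadd_eq_add, map_neg] at this
          rw [sub_eq_neg_add, this]
          ring
        · rw [Function.notMem_support.1 ht, zero_mul, zero_mul]
      rw [e1, integral_sub (hint k (fun _ => A y) continuous_const) (hint k _ hAl),
        integral_mul_const, (ρ k).integral_normed, one_mul]
    rw [gradient, gradient, hφA.fderiv_eq, fderiv_sub_const, hA.fderiv_eq]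
  have hΩf : volume Ω < ⊤ := hb.measure_lt_top
  have hfin1 : IsFiniteMeasure (volume.restrict Ω) := ⟨by simpa using hΩf⟩
  have hfin2 : IsFiniteMeasure ((surf n).restrict (frontier Ω)) := ⟨by simpa using hsurf⟩
  have hgm : Measurable (gradient w) :=
    (InnerProductSpace.toDual ℝ (E n)).symm.continuous.measurable.comp (measurable_fderiv ℝ w)
  obtain ⟨M, hM⟩ := hb.isCompact_closure.exists_bound_of_continuousOn hwc.continuousOn
  have hunif : ∀ ν : Measure (E n), IsFiniteMeasure ν →
      Tendsto (fun k => eLpNorm (fun x => φ k x - w x) 2 ν) atTop (𝓝 0) := by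
    intro ν hν
    have hle : ∀ k, eLpNorm (fun x => φ k x - w x) 2 ν
        ≤ ν Set.univ ^ (2 : ℝ≥0∞).toReal⁻¹ * ENNReal.ofReal (L * η k) := fun k =>
      eLpNorm_le_of_ae_bound (Eventually.of_forall (hφw k))
    refine tendsto_of_tendsto_of_tendsto_of_le_of_le tendsto_const_nhds ?_ (fun _ => zero_le) hle
    have h1 : Tendsto (fun k => ENNReal.ofReal (L * η k)) atTop (𝓝 0) := by
      have := ENNReal.tendsto_ofReal (hηt.const_mul (L : ℝ))
      simpa using this
    have := ENNReal.Tendsto.const_mul (a := ν Set.univ ^ (2 : ℝ≥0∞).toReal⁻¹) h1 (Or.inr (by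
      exact ENNReal.rpow_ne_top_of_nonneg (by positivity) (measure_ne_top ν _)))
    simpa using this
  refine ⟨⟨w, gradient w, w, ?_, ?_, ?_, ?_, φ, hφs, hunif _ hfin1, ?_, hunif _ hfin2⟩,
    rfl, rfl, rfl⟩
  · refine MemLp.of_bound hwc.aestronglyMeasurable M ?_
    filter_upwards [ae_restrict_mem ho.measurableSet] with x hx using hM x (subset_closure hx)
  · exact MemLp.of_bound hgm.aestronglyMeasurable L (Eventually.of_forall hgradw)
  · refine MemLp.of_bound hwc.aestronglyMeasurable M ?_
    filter_upwards [ae_restrict_mem isClosed_frontier.measurableSet] with x hx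
      using hM x (frontier_subset_closure hx)
  -- Integration by parts holds for the smooth φ k, and both sides converge by dominated convergence
  -- with the uniform Lipschitz bound.
  · intro χ hχ hχc hχΩ i
    set ei : E n := EuclideanSpace.single i 1 with hei
    have hχd : Continuous fun x => fderiv ℝ χ x ei :=
      (hχ.continuous_fderiv (by simp)).clm_apply continuous_const
    have hχdc : HasCompactSupport fun x => fderiv ℝ χ x ei := hχc.fderiv_apply ℝ ei
    have hχdi : Integrable (fun x => fderiv ℝ χ x ei) volume :=
      hχd.integrable_of_hasCompactSupport hχdc
    have hχi : Integrable χ volume := hχ.continuous.integrable_of_hasCompactSupport hχc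
    have hibp : ∀ k, ∫ x in Ω, φ k x * fderiv ℝ χ x ei = -∫ x in Ω, gradient (φ k) x i * χ x := by
      intro k
      have hφc := (hφs k).continuous
      have hφd : Continuous fun x => fderiv ℝ (φ k) x ei :=
        ((hφs k).continuous_fderiv (by simp)).clm_apply continuous_const
      have h1 := integral_mul_fderiv_eq_neg_fderiv_mul_of_integrable (μ := volume) (f := φ k)
        (g := χ) (v := ei)
        ((hφd.mul hχ.continuous).integrable_of_hasCompactSupport hχc.mul_left)
        ((hφc.mul hχd).integrable_of_hasCompactSupport hχdc.mul_left)
        ((hφc.mul hχ.continuous).integrable_of_hasCompactSupport hχc.mul_left)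
        (fun x _ => (hφs k).differentiable (by simp) x) (fun x _ => hχ.differentiable (by simp) x)
      rw [setIntegral_eq_integral_of_forall_compl_eq_zero, h1, neg_inj,
        setIntegral_eq_integral_of_forall_compl_eq_zero]
      · exact integral_congr_ae (Eventually.of_forall fun x => by simp [gradient_apply, hei])
      · intro x hx
        rw [image_eq_zero_of_notMem_tsupport (fun h => hx (hχΩ h)), mul_zero]
      · intro x hx
        have : x ∉ tsupport (fderiv ℝ χ) := fun h => hx (hχΩ (tsupport_fderiv_subset ℝ h))
        rw [image_eq_zero_of_notMem_tsupport this]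
        simp
    have hL1 : Tendsto (fun k => ∫ x in Ω, φ k x * fderiv ℝ χ x ei) atTop
        (𝓝 (∫ x in Ω, w x * fderiv ℝ χ x ei)) := by
      refine tendsto_integral_of_dominated_convergence
        (fun x => (M + L) * ‖fderiv ℝ χ x ei‖)
        (fun k => ((hφs k).continuous.mul hχd).aestronglyMeasurable)
        ((hχdi.norm.const_mul _).restrict) (fun k => ?_) (Eventually.of_forall fun x => ?_)
      · filter_upwards [ae_restrict_mem ho.measurableSet] with x hx
        rw [norm_mul]
        gcongr
        have h1 := hφw k x
        have h2 := hM x (subset_closure hx)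
        have h3 : (L : ℝ) * η k ≤ L := mul_le_of_le_one_right L.2 (hη1 k)
        have h4 := norm_add_le (φ k x - w x) (w x)
        rw [sub_add_cancel] at h4
        linarith
      · refine Tendsto.mul_const _ ?_
        rw [tendsto_iff_norm_sub_tendsto_zero]
        refine squeeze_zero (fun k => norm_nonneg _) (fun k => hφw k x) ?_
        simpa using hηt.const_mul (L : ℝ)
    have hL2 : Tendsto (fun k => ∫ x in Ω, gradient (φ k) x i * χ x) atTop
        (𝓝 (∫ x in Ω, gradient w x i * χ x)) := by
      refine tendsto_integral_of_dominated_convergence (fun x => L * ‖χ x‖)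
        (fun k => ?_) ((hχi.norm.const_mul _).restrict)
        (fun k => Eventually.of_forall fun x => ?_) ?_
      · have := continuous_gradient ((hφs k).of_le (m := 1) (by norm_cast))
        have h2 := hχ.continuous
        exact Continuous.aestronglyMeasurable (by fun_prop)
      · rw [norm_mul]
        gcongr
        exact (PiLp.norm_apply_le _ i).trans (hgradbound k x)
      · filter_upwards [hgradlim] with x hx
        refine tendsto_const_nhds.congr' ?_
        filter_upwards [hx] with k hk
        rw [hk]
    refine tendsto_nhds_unique hL1 ?_
    simp_rw [hibp]
    exact hL2.neg
  · have h1 : Tendsto (fun k => ∫⁻ x in Ω, ‖gradient (φ k) x - gradient w x‖ₑ ^ 2) atTop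
        (𝓝 (∫⁻ x in Ω, 0)) := by
      refine tendsto_lintegral_of_dominated_convergence (fun _ => ENNReal.ofReal (L + L) ^ 2)
        (fun k => ?_) (fun k => Eventually.of_forall fun x => ?_) (by simp; finiteness) ?_
      · have := continuous_gradient ((hφs k).of_le (m := 1) (by norm_cast))
        exact (this.measurable.sub hgm).enorm.pow_const 2
      · simp only
        gcongr
        rw [← ofReal_norm]
        exact ENNReal.ofReal_le_ofReal ((norm_sub_le _ _).trans
          (add_le_add (hgradbound k x) (hgradw x)))
      · filter_upwards [hgradlim] with x hx
        refine tendsto_const_nhds.congr' ?_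
        filter_upwards [hx] with k hk
        simp [hk]
    rw [lintegral_zero] at h1
    have h2 := (ENNReal.continuous_rpow_const (y := (1 / 2 : ℝ))).tendsto 0 |>.comp h1
    simp only [eLpNorm_two_eq]
    simpa [Function.comp_def] using h2

end LipschitzH1

/-! ### Affine functions on simplices -/

section Simplices

variable {n : ℕ}

theorem affineSpan_eq_top_iff_card {s : Finset (E n)} (hs : AffineIndependent ℝ ((↑) : s → E n)) :
    affineSpan ℝ (s : Set (E n)) = ⊤ ↔ s.card = n + 1 := by
  have := hs.affineSpan_eq_top_iff_card_eq_finrank_add_one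
  simpa using this

theorem volume_convexHull_eq_zero {s : Finset (E n)}
    (hs : AffineIndependent ℝ ((↑) : s → E n)) (hcard : s.card ≠ n + 1) :
    volume (convexHull ℝ (s : Set (E n))) = 0 := by
  refine measure_mono_null (convexHull_subset_affineSpan _) (Measure.addHaar_affineSubspace _ _ ?_)
  rwa [Ne, affineSpan_eq_top_iff_card hs]

theorem nonempty_interior_convexHull {s : Finset (E n)}
    (hs : AffineIndependent ℝ ((↑) : s → E n)) (hcard : s.card = n + 1) :
    (interior (convexHull ℝ (s : Set (E n)))).Nonempty :=
  interior_convexHull_nonempty_iff_affineSpan_eq_top.2 ((affineSpan_eq_top_iff_card hs).2 hcard)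

/-- An affine function with prescribed values at the vertices of an `n`-simplex. -/
theorem exists_affineMap_eq {s : Finset (E n)} (hs : AffineIndependent ℝ ((↑) : s → E n))
    (hcard : s.card = n + 1) (v : E n → ℝ) : ∃ A : E n →ᵃ[ℝ] ℝ, ∀ z ∈ s, A z = v z := by
  classical
  let b : AffineBasis s ℝ (E n) := ⟨(↑), hs, by
    rw [Subtype.range_coe]
    exact (affineSpan_eq_top_iff_card hs).2 hcard⟩
  have key : ∀ t : Finset s, ∃ A : E n →ᵃ[ℝ] ℝ, ∀ x, A x = ∑ i ∈ t, b.coord i x * v i := by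
    intro t
    induction t using Finset.induction_on with
    | empty => exact ⟨0, by simp⟩
    | insert i t hi ih =>
      obtain ⟨A, hA⟩ := ih
      refine ⟨v i • b.coord i + A, fun x => ?_⟩
      rw [Finset.sum_insert hi, ← hA]
      simp [mul_comm]
  obtain ⟨A, hA⟩ := key Finset.univ
  refine ⟨A, fun z hz => ?_⟩
  have hb : b ⟨z, hz⟩ = z := rfl
  rw [hA]
  conv_lhs => rw [← hb]
  simp [AffineBasis.coord_apply]

theorem eqOn_convexHull {s : Set (E n)} {A B : E n →ᵃ[ℝ] ℝ} (h : Set.EqOn A B s) :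
    Set.EqOn A B (convexHull ℝ s) := by
  have : convexHull ℝ s ⊆ (A - B) ⁻¹' {0} :=
    convexHull_min (fun x hx => by simp [h hx]) ((convex_singleton 0).affine_preimage (A - B))
  intro x hx
  have := this hx
  simpa [sub_eq_zero] using this

theorem affineMap_nonneg_of_vertices {s : Set (E n)} {A : E n →ᵃ[ℝ] ℝ} (h : ∀ z ∈ s, 0 ≤ A z) :
    ∀ x ∈ convexHull ℝ s, 0 ≤ A x :=
  convexHull_min (t := A ⁻¹' Set.Ici 0) h ((convex_Ici 0).affine_preimage A)

theorem exists_eq_const_add_inner (A : E n →ᵃ[ℝ] ℝ) : ∃ k a, ∀ x, A x = k + inner ℝ a x := by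
  refine ⟨A 0, (InnerProductSpace.toDual ℝ (E n)).symm (LinearMap.toContinuousLinearMap A.linear),
    fun x => ?_⟩
  rw [InnerProductSpace.toDual_symm_apply]
  have := A.map_vadd 0 x
  simp only [vadd_eq_add, add_zero] at this
  rw [this]
  simp [add_comm]

theorem gradient_const_add_inner (k : ℝ) (a x : E n) :
    gradient (fun y => k + inner ℝ a y) x = a := by
  refine HasGradientAt.gradient ?_
  rw [hasGradientAt_iff_hasFDerivAt]
  exact ((InnerProductSpace.toDual ℝ (E n) a).hasFDerivAt).const_add k

end Simplices

/-- Directly below a boundary point in its chart there are points outside the closure of Ω, so no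
boundary point is interior to the closure. Hence the interiors of cells lie in Ω and not merely in
its closure. -/
theorem interior_closure_subset {n : ℕ} {Ω : Set (E n)} (ho : IsOpen Ω)
    (hlip : HasLipschitzBoundary Ω) : interior (closure Ω) ⊆ Ω := by
  intro x hx
  by_contra hxΩ
  have hfr : x ∈ frontier Ω := by rw [ho.frontier_eq]; exact ⟨interior_subset hx, hxΩ⟩
  obtain ⟨e, δ, K, ψ, h⟩ := exists_isChart hlip hfr
  have hc : ContinuousAt (fun t : ℝ => x - t • e) 0 := by fun_prop
  have hx' : interior (closure Ω) ∩ Metric.ball x δ ∈ 𝓝 (x - (0 : ℝ) • e) := by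
    rw [zero_smul, sub_zero]
    exact (isOpen_interior.inter Metric.isOpen_ball).mem_nhds ⟨hx, Metric.mem_ball_self h.pos⟩
  have hev : ∀ᶠ t in 𝓝[>] (0 : ℝ), x - t • e ∈ interior (closure Ω) ∩ Metric.ball x δ :=
    nhdsWithin_le_nhds (hc hx')
  obtain ⟨t, ht, ht0⟩ := (hev.and self_mem_nhdsWithin).exists
  have ht0 : 0 < t := ht0
  have h1 := (h.mem_closure_iff ht.2).1 (interior_subset ht.1)
  have h2 := h.eq_inner_of_mem_frontier ho (Metric.mem_ball_self h.pos) hfr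
  rw [sub_eq_add_neg, ← neg_smul, h.apply_add, h.inner_add_smul] at h1
  linarith

/-! ### Covering by cells and the interpolant -/

namespace Triangulation

variable {n : ℕ} {Ω : Set (E n)} (T : Triangulation Ω)

theorem finite_cells : T.cells.Finite := T.finite_faces.subset fun _ hs => hs.1

theorem isClosed_convexHull (s : Finset (E n)) : IsClosed (convexHull ℝ (s : Set (E n))) :=
  (s.finite_toSet.isCompact_convexHull ℝ).isClosed

variable {T} in
theorem convexHull_subset_closure {s : Finset (E n)} (hs : s ∈ T.cells) :
    convexHull ℝ (s : Set (E n)) ⊆ closure Ω :=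
  T.space_eq ▸ T.complex.convexHull_subset_space hs.1

/-- Faces with other than n + 1 vertices are null, so the open part of Ω missed by the closed union
of cells is null and therefore empty. -/
theorem biUnion_cells (ho : IsOpen Ω) :
    ⋃ s ∈ T.cells, convexHull ℝ (s : Set (E n)) = closure Ω := by
  refine Set.Subset.antisymm (Set.iUnion₂_subset fun s hs => convexHull_subset_closure hs) ?_
  have hcl : IsClosed (⋃ s ∈ T.cells, convexHull ℝ (s : Set (E n))) :=
    T.finite_cells.isClosed_biUnion fun s _ => isClosed_convexHull s
  refine closure_minimal ?_ hcl
  rw [← Set.sdiff_eq_empty, ← (ho.sdiff hcl).measure_eq_zero_iff volume]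
  refine measure_mono_null (t := ⋃ s ∈ T.complex.faces \ T.cells, convexHull ℝ (s : Set (E n)))
    ?_ ?_
  · rintro x ⟨hx, hxF⟩
    have := T.space_eq ▸ subset_closure hx
    obtain ⟨s, hs, hxs⟩ := Geometry.SimplicialComplex.mem_space_iff.1 this
    refine Set.mem_biUnion (⟨hs, fun hsc => hxF (Set.mem_biUnion hsc hxs)⟩ :
      s ∈ T.complex.faces \ T.cells) hxs
  · rw [measure_biUnion_null_iff (T.finite_faces.subset Set.sdiff_subset).countable]
    exact fun s hs => volume_convexHull_eq_zero (T.complex.indep hs.1) fun h => hs.2 ⟨hs.1, h⟩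

theorem cells_nonempty (ho : IsOpen Ω) (hne : Ω.Nonempty) : T.cells.Nonempty := by
  obtain ⟨x, hx⟩ := hne
  have := T.biUnion_cells ho ▸ subset_closure hx
  obtain ⟨s, hs, -⟩ := Set.mem_iUnion₂.1 this
  exact ⟨s, hs⟩

variable {T} in
theorem interior_convexHull_subset (ho : IsOpen Ω) (hlip : HasLipschitzBoundary Ω)
    {s : Finset (E n)} (hs : s ∈ T.cells) : interior (convexHull ℝ (s : Set (E n))) ⊆ Ω :=
  (interior_mono (convexHull_subset_closure hs)).trans (interior_closure_subset ho hlip)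

variable {T} in
theorem closure_interior_convexHull {s : Finset (E n)} (hs : s ∈ T.cells) :
    closure (interior (convexHull ℝ (s : Set (E n)))) = convexHull ℝ (s : Set (E n)) := by
  rw [(convex_convexHull ℝ _).closure_interior_eq_closure_of_nonempty_interior
    (nonempty_interior_convexHull (T.complex.indep hs.1) hs.2), (isClosed_convexHull s).closure_eq]

/-- Two cells meet in the hull of their common vertices, which has interior only if there are n + 1
of these, that is, if the cells coincide. -/
theorem pairwiseDisjoint_interior :
    T.cells.PairwiseDisjoint fun s => interior (convexHull ℝ (s : Set (E n))) := by
  classical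
  intro s hs t ht hst
  rw [Function.onFun, Set.disjoint_iff_inter_eq_empty, ← interior_inter,
    T.complex.convexHull_inter_convexHull hs.1 ht.1, ← Set.not_nonempty_iff_eq_empty,
    interior_convexHull_nonempty_iff_affineSpan_eq_top, ← Finset.coe_inter]
  have hind : AffineIndependent ℝ ((↑) : (s ∩ t : Finset (E n)) → E n) :=
    AffineIndependent.mono (t := (s : Set (E n))) (T.complex.indep hs.1)
      (by exact_mod_cast Finset.inter_subset_left)
  rw [affineSpan_eq_top_iff_card hind]
  intro h
  have h1 : s ∩ t = s := Finset.eq_of_subset_of_card_le Finset.inter_subset_left (by rw [h, hs.2])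
  have h2 : s ∩ t = t := Finset.eq_of_subset_of_card_le Finset.inter_subset_right (by rw [h, ht.2])
  exact hst (h1.symm.trans h2)

theorem ae_mem_interior (ho : IsOpen Ω) :
    ∀ᵐ x ∂(volume.restrict Ω), ∃ s ∈ T.cells, x ∈ interior (convexHull ℝ (s : Set (E n))) := by
  have h1 : ∀ᵐ x ∂(volume.restrict Ω), ∀ s ∈ T.cells, x ∉ frontier (convexHull ℝ (s : Set (E n))) :=
    ae_restrict_of_ae ((ae_ball_iff T.finite_cells.countable).2 fun s _ =>
      measure_eq_zero_iff_ae_notMem.1 (Convex.addHaar_frontier volume (convex_convexHull ℝ _)))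
  filter_upwards [h1, ae_restrict_mem ho.measurableSet] with x hx hxΩ
  have := T.biUnion_cells ho ▸ subset_closure hxΩ
  obtain ⟨s, hs, hxs⟩ := Set.mem_iUnion₂.1 this
  refine ⟨s, hs, ?_⟩
  by_contra hxi
  exact hx s hs (by
    rw [(isClosed_convexHull s).frontier_eq]
    exact ⟨hxs, hxi⟩)

/-- The piecewise affine interpolation of nodal values. -/
theorem exists_piecewise_affine (v : E n → ℝ) :
    ∃ f : E n → ℝ, ∀ s ∈ T.cells, ∃ A : E n →ᵃ[ℝ] ℝ,
      Set.EqOn f A (convexHull ℝ (s : Set (E n))) ∧ ∀ z ∈ s, A z = v z := by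
  classical
  have h1 : ∀ s : Finset (E n), ∃ A : E n →ᵃ[ℝ] ℝ, s ∈ T.cells → ∀ z ∈ s, A z = v z := by
    intro s
    by_cases hs : s ∈ T.cells
    · obtain ⟨A, hA⟩ := exists_affineMap_eq (T.complex.indep hs.1) hs.2 v
      exact ⟨A, fun _ => hA⟩
    · exact ⟨0, fun h => (hs h).elim⟩
  choose A hA using h1
  refine ⟨fun x => if h : ∃ s ∈ T.cells, x ∈ convexHull ℝ (s : Set (E n)) then A h.choose x else 0,
    fun s hs => ⟨A s, fun x hx => ?_, hA s hs⟩⟩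
  have hex : ∃ s ∈ T.cells, x ∈ convexHull ℝ (s : Set (E n)) := ⟨s, hs, hx⟩
  simp only [hex, dif_pos]
  obtain ⟨ht, hxt⟩ := hex.choose_spec
  set t := hex.choose
  -- The chosen cell does not matter: the two affine functions agree at the common vertices, hence
  -- on the hull of these, which contains the intersection of the cells.
  refine eqOn_convexHull (s := (t ∩ s : Set (E n))) (fun z hz => ?_)
    (T.complex.inter_subset_convexHull ht.1 hs.1 ⟨hxt, hx⟩)
  rw [hA t ht z hz.1, hA s hs z hz.2]

/-- The piecewise affine interpolation of nodal values, as an element of `V_h`. -/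
theorem exists_interpolant (hΩ : IsPolygonalDomain Ω) (v : E n → ℝ) :
    ∃ vh : H1 Ω, vh.grad = gradient vh.val ∧ vh ∈ Vh T ∧ ∀ s ∈ T.cells, ∃ A : E n →ᵃ[ℝ] ℝ,
      Set.EqOn vh.val A (convexHull ℝ (s : Set (E n))) ∧ ∀ z ∈ s, A z = v z := by
  have ho := hΩ.isOpen
  obtain ⟨f, hf⟩ := T.exists_piecewise_affine v
  have hlipA : ∀ A : E n →ᵃ[ℝ] ℝ, ∃ L : ℝ, ∀ x y, |A x - A y| ≤ L * dist x y := by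
    intro A
    obtain ⟨k, a, hA⟩ := exists_eq_const_add_inner A
    refine ⟨‖a‖, fun x y => ?_⟩
    rw [hA, hA, add_sub_add_left_eq_sub, ← inner_sub_right, dist_eq_norm]
    exact abs_real_inner_le_norm _ _
  have h1 : ∀ s : Finset (E n), ∃ L : ℝ, s ∈ T.cells → ∀ x ∈ convexHull ℝ (s : Set (E n)),
      ∀ y ∈ convexHull ℝ (s : Set (E n)), |f x - f y| ≤ L * dist x y := by
    intro s
    by_cases hs : s ∈ T.cells
    · obtain ⟨A, hA, -⟩ := hf s hs
      obtain ⟨L, hL⟩ := hlipA A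
      exact ⟨L, fun _ x hx y hy => by rw [hA hx, hA hy]; exact hL x y⟩
    · exact ⟨0, fun h => (hs h).elim⟩
  choose L hL using h1
  obtain ⟨L₀, hL₀⟩ := (T.finite_cells.image L).bddAbove
  set 𝒞 : Set (Set (E n)) := (fun s : Finset (E n) => convexHull ℝ (s : Set (E n))) '' T.cells
    with h𝒞
  have hU : ⋃₀ 𝒞 = closure Ω := by rw [h𝒞, Set.sUnion_image, T.biUnion_cells ho]
  have hcont : ContinuousOn f (closure Ω) := by
    have : Finite T.cells := T.finite_cells
    rw [← T.biUnion_cells ho, Set.biUnion_eq_iUnion]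
    refine LocallyFinite.continuousOn_iUnion (locallyFinite_of_finite _)
      (fun s => isClosed_convexHull s.1) fun s => ?_
    obtain ⟨A, hA, -⟩ := hf s.1 s.2
    exact (A.continuous_of_finiteDimensional).continuousOn.congr hA
  have hseg : ∀ x y, segment ℝ x y ⊆ closure Ω → |f y - f x| ≤ (L₀.toNNReal : ℝ) * dist x y := by
    intro x y hxy
    rw [← hU] at hxy hcont
    refine abs_sub_le_of_segment_subset (T.finite_cells.image _) ?_ hcont ?_ hxy
    · rintro _ ⟨s, -, rfl⟩
      exact isClosed_convexHull s
    · rintro _ ⟨s, hs, rfl⟩ x hx y hy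
      refine (hL s hs x hx y hy).trans ?_
      gcongr
      exact (hL₀ (Set.mem_image_of_mem L hs)).trans (Real.le_coe_toNNReal _)
  obtain ⟨L', hL'⟩ := exists_lipschitzOnWith_closure ho hΩ.isBounded hΩ.lipschitz hseg
  -- A global Lipschitz extension is needed to mollify; its values off the closure of Ω are
  -- irrelevant.
  obtain ⟨w, hw, hfw⟩ := hL'.extend_real
  obtain ⟨vh, hval, hgrad, -⟩ := exists_H1_of_lipschitz ho hΩ.isBounded
    (surf_frontier_lt_top ho hΩ.isBounded hΩ.lipschitz) hw (by
      filter_upwards [T.ae_mem_interior ho] with x hx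
      obtain ⟨s, hs, hxs⟩ := hx
      obtain ⟨A, hA, -⟩ := hf s hs
      refine ⟨A, ?_⟩
      filter_upwards [isOpen_interior.mem_nhds hxs] with y hy
      rw [← hA (interior_subset hy),
        hfw (convexHull_subset_closure hs (interior_subset hy))])
  have hall : ∀ s ∈ T.cells, ∃ A : E n →ᵃ[ℝ] ℝ,
      Set.EqOn vh.val A (convexHull ℝ (s : Set (E n))) ∧ ∀ z ∈ s, A z = v z := by
    intro s hs
    obtain ⟨A, hA, hAv⟩ := hf s hs
    refine ⟨A, fun x hx => ?_, hAv⟩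
    rw [hval, ← hfw (convexHull_subset_closure hs hx), hA hx]
  refine ⟨vh, by rw [hgrad, hval], ⟨by rw [hval]; exact hw.continuous.continuousOn, ?_⟩, hall⟩
  intro s hs
  obtain ⟨A, hA, -⟩ := hall s hs
  exact ⟨A, hA⟩

end Triangulation

/-! ### Interpolation error in H¹ -/

section InterpolationError

variable {n : ℕ} {Ω : Set (E n)}

/-- The centre is compared with the point at distance ρ/4 from it in direction a: the values differ
by (ρ/4)‖a‖ and by at most 2τ. -/
theorem norm_le_of_abs_le_on_ball {k τ ρ : ℝ} {a c : E n} (hρ : 0 < ρ)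
    (h : ∀ x ∈ Metric.ball c (ρ / 2), |k + inner ℝ a x| ≤ τ) : ‖a‖ ≤ 8 * τ / ρ := by
  have h1 := h c (Metric.mem_ball_self (by positivity))
  rcases eq_or_ne a 0 with rfl | ha
  · have hτ : 0 ≤ τ := (abs_nonneg _).trans h1
    simp only [norm_zero]
    positivity
  have ha' : 0 < ‖a‖ := norm_pos_iff.2 ha
  have h2 := h (c + (ρ / 4 / ‖a‖) • a) (by
    rw [Metric.mem_ball, dist_self_add_left, norm_smul, Real.norm_of_nonneg (by positivity),
      div_mul_cancel₀ _ ha'.ne']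
    linarith)
  rw [inner_add_right, inner_smul_right, real_inner_self_eq_norm_sq] at h2
  have e : ρ / 4 / ‖a‖ * ‖a‖ ^ 2 = ρ / 4 * ‖a‖ := by field_simp
  rw [e] at h2
  rw [le_div_iff₀ hρ]
  have := abs_le.1 h1
  have := abs_le.1 h2
  linarith

theorem lintegral_enorm_sub_sq_le_of_norm_sub_le {F : Type*} [NormedAddCommGroup F]
    {U : Set (E n)} (hU : MeasurableSet U) {f g h : E n → F} {X τ V : ℝ} (hX : 0 ≤ X)
    (hτ : 0 ≤ τ) (hV0 : volume U ≠ ⊤) (hfg : ∫⁻ x in U, ‖f x - g x‖ₑ ^ 2 ≤ ENNReal.ofReal X)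
    (hhg : ∀ x ∈ U, ‖h x - g x‖ ≤ τ) (hV : volume.real U ≤ V) :
    ∫⁻ x in U, ‖h x - f x‖ₑ ^ 2 ≤ ENNReal.ofReal (2 * X + 2 * (τ ^ 2 * V)) := by
  have hV' : 0 ≤ V := measureReal_nonneg.trans hV
  calc ∫⁻ x in U, ‖h x - f x‖ₑ ^ 2
      ≤ ∫⁻ x in U, (2 * ENNReal.ofReal (τ ^ 2) + 2 * ‖f x - g x‖ₑ ^ 2) := by
        refine setLIntegral_mono_ae' hU (Eventually.of_forall fun x hx => ?_)
        have h1 := enorm_add_sq_le (h x - g x) (g x - f x)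
        rw [sub_add_sub_cancel, ← enorm_neg (g x - f x), neg_sub] at h1
        refine h1.trans ?_
        have h2 : ‖h x - g x‖ₑ ≤ ENNReal.ofReal τ := by
          rw [← ofReal_norm]
          exact ENNReal.ofReal_le_ofReal (hhg x hx)
        rw [ENNReal.ofReal_pow hτ]
        gcongr
    _ = 2 * ENNReal.ofReal (τ ^ 2) * volume U + 2 * ∫⁻ x in U, ‖f x - g x‖ₑ ^ 2 := by
        rw [lintegral_add_left measurable_const, setLIntegral_const,
          lintegral_const_mul' _ _ (by simp)]
    _ ≤ 2 * ENNReal.ofReal (τ ^ 2) * ENNReal.ofReal V + 2 * ENNReal.ofReal X := by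
        gcongr
        rw [← ofReal_measureReal hV0]
        exact ENNReal.ofReal_le_ofReal hV
    _ = ENNReal.ofReal (2 * X + 2 * (τ ^ 2 * V)) := by
        rw [ENNReal.ofReal_add (by positivity) (by positivity),
          ENNReal.ofReal_mul (p := 2) (by positivity), ENNReal.ofReal_mul (p := 2) (by positivity),
          ENNReal.ofReal_mul (p := τ ^ 2) (by positivity), ENNReal.ofReal_ofNat]
        ring

/-- The error on one simplex of an affine function that is close to a good affine approximation at
the vertices. -/
theorem lintegral_sub_affine_simplex_le {s : Finset (E n)} {c : E n} {ρ σ d m r K₀ K₁ A : ℝ}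
    (hρ : 0 < ρ) (hball : Metric.ball c (ρ / 2) ⊆ convexHull ℝ (s : Set (E n)))
    (hdρ : d ≤ σ * ρ) (hσ : 0 < σ) (hd : 0 < d) (hm : 0 ≤ m) (hK₀ : 0 ≤ K₀) (hK₁ : 0 ≤ K₁)
    (hdiam : Metric.diam (s : Set (E n)) ≤ d) (hA : 0 ≤ A)
    {f : E n → ℝ} {G : E n → E n} {k k' : ℝ} {a a' : E n}
    (hf : ∫⁻ x in interior (convexHull ℝ (s : Set (E n))), ‖f x - (k + inner ℝ a x)‖ₑ ^ 2
      ≤ ENNReal.ofReal (K₀ * d ^ (2 * r) * m))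
    (hG : ∫⁻ x in interior (convexHull ℝ (s : Set (E n))), ‖G x - a‖ₑ ^ 2
      ≤ ENNReal.ofReal (K₁ * d ^ (2 * (r - 1)) * m))
    (hv : ∀ z ∈ s, |k' + inner ℝ a' z - (k + inner ℝ a z)| ≤ A * √m * d ^ (r - n / 2)) :
    (∫⁻ x in interior (convexHull ℝ (s : Set (E n))), ‖(k' + inner ℝ a' x) - f x‖ₑ ^ 2)
        + ∫⁻ x in interior (convexHull ℝ (s : Set (E n))), ‖a' - G x‖ₑ ^ 2
      ≤ ENNReal.ofReal (((2 * K₀ + 2 * A ^ 2 * volume.real (Metric.closedBall (0 : E n) 1)) * d ^ 2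
        + (2 * K₁ + 128 * A ^ 2 * σ ^ 2 * volume.real (Metric.closedBall (0 : E n) 1)))
          * d ^ (2 * (r - 1)) * m) := by
  set U := interior (convexHull ℝ (s : Set (E n))) with hU
  set β := volume.real (Metric.closedBall (0 : E n) 1) with hβ
  have hβ0 : 0 ≤ β := measureReal_nonneg
  set τ := A * √m * d ^ (r - n / 2) with hτ
  have hτ0 : 0 ≤ τ := by positivity
  have hall : ∀ x ∈ convexHull ℝ (s : Set (E n)),
      |k' + inner ℝ a' x - (k + inner ℝ a x)| ≤ τ := by
    have hconv : Convex ℝ {x : E n | |k' + inner ℝ a' x - (k + inner ℝ a x)| ≤ τ} := by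
      intro x hx y hy p q hp hq hpq
      simp only [Set.mem_ofPred_eq, abs_le, inner_add_right, inner_smul_right] at *
      have e : p * (k' - k) + q * (k' - k) = k' - k := by rw [← add_mul, hpq, one_mul]
      have e2 : p * τ + q * τ = τ := by rw [← add_mul, hpq, one_mul]
      constructor
      · nlinarith [mul_le_mul_of_nonneg_left hx.1 hp, mul_le_mul_of_nonneg_left hy.1 hq]
      · nlinarith [mul_le_mul_of_nonneg_left hx.2 hp, mul_le_mul_of_nonneg_left hy.2 hq]
    exact convexHull_min hv hconv
  -- Inverse estimate: the inscribed ball has diameter ρ ≥ d/σ, so the uniform bound τ becomes a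
  -- slope bound. This step uses shape regularity.
  have hgrad : ‖a' - a‖ ≤ 8 * τ * σ / d := by
    have h1 : ‖a' - a‖ ≤ 8 * τ / ρ := by
      refine norm_le_of_abs_le_on_ball (k := k' - k) (c := c) hρ fun x hx => ?_
      rw [inner_sub_left]
      have := hall x (hball hx)
      rwa [add_sub_add_comm] at this
    refine h1.trans ?_
    rw [div_le_div_iff₀ hρ hd, mul_assoc (8 * τ)]
    gcongr
  have hbdd : Bornology.IsBounded (convexHull ℝ (s : Set (E n))) :=
    (s.finite_toSet.isCompact_convexHull ℝ).isBounded
  have hvol : volume.real U ≤ β * d ^ n := by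
    have hsub : U ⊆ Metric.closedBall c d := by
      intro x hx
      rw [Metric.mem_closedBall]
      refine (Metric.dist_le_diam_of_mem hbdd (interior_subset hx)
        (hball (Metric.mem_ball_self (by positivity)))).trans ?_
      rwa [convexHull_diam]
    have h1 : volume.real U ≤ volume.real (Metric.closedBall c d) :=
      measureReal_mono hsub measure_closedBall_lt_top.ne
    refine h1.trans_eq ?_
    rw [measureReal_def, Measure.addHaar_closedBall_center, volume_closedBall_eq d hd.le,
      ENNReal.toReal_mul, ENNReal.toReal_ofReal (by positivity), mul_comm, hβ, measureReal_def]
  have hUtop : volume U ≠ ⊤ := (hbdd.subset interior_subset).measure_lt_top.ne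
  have hUm : MeasurableSet U := isOpen_interior.measurableSet
  -- The dimension cancels: the squared vertex error d^(2r-n) is multiplied by a volume of order
  -- d^n.
  have hpow1 : τ ^ 2 * (β * d ^ n) = A ^ 2 * β * d ^ 2 * d ^ (2 * (r - 1)) * m := by
    have e1 : (d ^ (r - (n : ℝ) / 2)) ^ 2 * d ^ n = d ^ 2 * d ^ (2 * (r - 1)) := by
      rw [← Real.rpow_natCast d n, ← Real.rpow_natCast d 2, ← Real.rpow_mul_natCast hd.le,
        ← Real.rpow_add hd, ← Real.rpow_add hd]
      congr 1
      push_cast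
      ring
    calc τ ^ 2 * (β * d ^ n)
        = A ^ 2 * β * (√m) ^ 2 * ((d ^ (r - (n : ℝ) / 2)) ^ 2 * d ^ n) := by rw [hτ]; ring
      _ = _ := by rw [e1, Real.sq_sqrt hm]; ring
  have hpow2 : d ^ (2 * r) = d ^ 2 * d ^ (2 * (r - 1)) := by
    rw [← Real.rpow_natCast d 2, ← Real.rpow_add hd]
    congr 1
    push_cast
    ring
  have i1 := lintegral_enorm_sub_sq_le_of_norm_sub_le (h := fun x => k' + inner ℝ a' x) hUm
    (by positivity) hτ0 hUtop hf (fun x hx => hall x (interior_subset hx)) hvol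
  have i2 := lintegral_enorm_sub_sq_le_of_norm_sub_le (h := fun _ => a') hUm
    (by positivity) (by positivity) hUtop hG (fun x _ => hgrad) hvol
  refine (add_le_add i1 i2).trans ?_
  rw [← ENNReal.ofReal_add (by positivity) (by positivity)]
  refine ENNReal.ofReal_le_ofReal (le_of_eq ?_)
  have e3 : (8 * τ * σ / d) ^ 2 * (β * d ^ n)
      = 64 * σ ^ 2 / d ^ 2 * (τ ^ 2 * (β * d ^ n)) := by ring
  rw [e3, hpow1, hpow2]
  field_simp
  ring

/-- Interpolation error for nonnegative functions in `H^r(Ω)`, with `r > n / 2`. -/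
theorem exists_discrete_approx (hΩ : IsPolygonalDomain Ω) (hn : n ≠ 0) {r : ℝ} (hr1 : 1 < r)
    (hr2 : r ≤ 2) (hnr : (n : ℝ) < 2 * r) {u : H1 Ω} (hu : u ∈ Kplus Ω) (hur : MemHr r u) (σ : ℝ) :
    ∃ C : ℝ, 0 ≤ C ∧ ∀ T : Triangulation Ω, T.IsShapeRegular σ → ∃ vh ∈ KplusH T,
      (∫⁻ x in Ω, ‖vh.val x - u.val x‖ₑ ^ 2) + ∫⁻ x in Ω, ‖vh.grad x - u.grad x‖ₑ ^ 2
        ≤ ENNReal.ofReal (C * T.meshSize ^ (2 * (r - 1))) := by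
  have ho := hΩ.isOpen
  have hdpos : ∀ T : Triangulation Ω, ∀ s ∈ T.cells, 0 < Metric.diam (s : Set (E n)) := by
    intro T s hs
    refine Metric.diam_pos ?_ s.finite_toSet.isBounded
    exact Finset.one_lt_card_iff_nontrivial.1 (by rw [hs.2]; omega)
  have hnt : Nontrivial (E n) := Module.nontrivial_of_finrank_pos (R := ℝ) (by
    rw [finrank_euclideanSpace_fin]
    omega)
  -- Cells have positive diameter, so no triangulation is shape regular with σ ≤ 0.
  rcases le_or_gt σ 0 with hσ | hσ
  · refine ⟨0, le_rfl, fun T hT => ?_⟩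
    obtain ⟨s, hs⟩ := T.cells_nonempty ho hΩ.isConnected.nonempty
    obtain ⟨c, ρ, hρ, -, hd⟩ := hT s hs
    have := hdpos T s hs
    nlinarith [mul_nonneg_of_nonpos_of_nonpos hσ (neg_nonpos.2 hρ.le)]
  obtain ⟨μ, hμf, hμ⟩ := exists_regularity_measure ho.measurableSet hr1 hr2 hur
  set β := volume.real (Metric.closedBall (0 : E n) 1) with hβ
  have hβ0 : 0 < β :=
    ENNReal.toReal_pos (Metric.measure_closedBall_pos volume _ one_pos).ne' measure_closedBall_lt_top.ne
  set S : ℝ → ℝ := fun c => β * c⁻¹ ^ 2 with hS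
  have happ : ∀ c, 0 < c → AffineApprox Ω μ u.val r c (S c) := by
    intro c hc U hU hUc hUΩ d hd hdU hcU
    obtain ⟨k, a, -, h⟩ := exists_affine_approx ho.measurableSet hμ hc hU hUc hUΩ hd hdU hcU
    exact ⟨k, a, h⟩
  have hS0 : ∀ c, 0 ≤ S c := fun c => by positivity
  obtain ⟨w, hw0, hw⟩ := exists_nodal_values ho hΩ.isBounded hΩ.lipschitz hnr u.memLp_val hu
    fun c hc => ⟨S c, hS0 c, happ c hc⟩
  -- Each cell contains a ball of radius at least d / (2σ), which gives this lower bound for its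
  -- volume relative to d^n.
  set c := β / (2 * σ) ^ n with hc
  have hc0 : 0 < c := by positivity
  obtain ⟨A, hA0, hA⟩ := hw c (S c) hc0 (hS0 c) (happ c hc0)
  -- The error in the values has an extra factor d² compared with that in the gradients; it is
  -- absorbed by D², so no smallness of h is required.
  set D := Metric.diam (closure Ω) with hD
  have hD0 : 0 ≤ D := Metric.diam_nonneg
  set C₀ := (2 * S c + 2 * A ^ 2 * β) * D ^ 2 + (2 * c⁻¹ + 128 * A ^ 2 * σ ^ 2 * β) with hC₀
  have hC₀0 : 0 ≤ C₀ := by have := hS0 c; positivity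
  refine ⟨C₀ * μ.real Set.univ, by positivity, fun T hT => ?_⟩
  obtain ⟨vh, hgrad, hvh, hvert⟩ := T.exists_interpolant hΩ w
  have hnode : ∀ s ∈ T.cells, (s : Set (E n)) ⊆ closure Ω := fun s hs =>
    (subset_convexHull ℝ _).trans (Triangulation.convexHull_subset_closure hs)
  refine ⟨vh, ⟨hvh, fun x hx => ?_⟩, ?_⟩
  · have := T.biUnion_cells ho ▸ subset_closure hx
    obtain ⟨s, hs, hxs⟩ := Set.mem_iUnion₂.1 this
    obtain ⟨B, hB, hBw⟩ := hvert s hs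
    rw [hB hxs]
    refine affineMap_nonneg_of_vertices (fun z hz => ?_) x hxs
    rw [hBw z hz]
    exact hw0 z (hnode s hs hz)
  have hbd : Bornology.IsBounded (closure Ω) := hΩ.isBounded.closure
  have hcell : ∀ s ∈ T.cells,
      (∫⁻ x in interior (convexHull ℝ (s : Set (E n))), ‖vh.val x - u.val x‖ₑ ^ 2)
        + ∫⁻ x in interior (convexHull ℝ (s : Set (E n))), ‖vh.grad x - u.grad x‖ₑ ^ 2
      ≤ ENNReal.ofReal (C₀ * T.meshSize ^ (2 * (r - 1)))
        * μ (interior (convexHull ℝ (s : Set (E n)))) := by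
    intro s hs
    set U := interior (convexHull ℝ (s : Set (E n))) with hU
    obtain ⟨z₀, ρ, hρ, hball, hdρ⟩ := hT s hs
    set d := Metric.diam (s : Set (E n)) with hd
    have hd0 : 0 < d := hdpos T s hs
    have hdh : d ≤ T.meshSize :=
      le_csSup (T.finite_cells.image _).bddAbove (Set.mem_image_of_mem _ hs)
    have hdD : d ≤ D := Metric.diam_mono (hnode s hs) hbd
    have hUΩ : U ⊆ Ω := Triangulation.interior_convexHull_subset ho hΩ.lipschitz hs
    have hUc : Convex ℝ U := (convex_convexHull ℝ _).interior
    have hbdd : Bornology.IsBounded (convexHull ℝ (s : Set (E n))) :=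
      (s.finite_toSet.isCompact_convexHull ℝ).isBounded
    have hdU : ∀ x ∈ U, ∀ y ∈ U, dist x y ≤ d := fun x hx y hy => by
      rw [hd, ← convexHull_diam]
      exact Metric.dist_le_diam_of_mem hbdd (interior_subset hx) (interior_subset hy)
    have hcU : c * d ^ n ≤ volume.real U := by
      have hbU : Metric.ball z₀ (ρ / 2) ⊆ U := interior_maximal hball Metric.isOpen_ball
      have h1 : volume.real (Metric.ball z₀ (ρ / 2)) ≤ volume.real U :=
        measureReal_mono hbU (hbdd.subset interior_subset).measure_lt_top.ne
      refine le_trans ?_ h1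
      rw [measureReal_def, ← Measure.addHaar_closedBall_eq_addHaar_ball,
        Measure.addHaar_closedBall_center, volume_closedBall_eq _ (by positivity),
        ENNReal.toReal_mul, ENNReal.toReal_ofReal (by positivity), ← measureReal_def, ← hβ]
      have h2 : d / (2 * σ) ≤ ρ / 2 := by
        rw [div_le_div_iff₀ (by positivity) (by positivity)]
        linarith
      calc c * d ^ n = (d / (2 * σ)) ^ n * β := by rw [hc, div_pow]; ring
        _ ≤ (ρ / 2) ^ n * β := by gcongr
    obtain ⟨k, a, hka1, hka2⟩ :=
      exists_affine_approx ho.measurableSet hμ hc0 isOpen_interior hUc hUΩ hd0 hdU hcU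
    obtain ⟨B, hB, hBw⟩ := hvert s hs
    obtain ⟨k', a', hBk⟩ := exists_eq_const_add_inner B
    have hval : ∀ x ∈ U, vh.val x = k' + inner ℝ a' x := fun x hx => by
      rw [hB (interior_subset hx), hBk]
    have hgr : ∀ x ∈ U, vh.grad x = a' := by
      intro x hx
      rw [hgrad, ← gradient_const_add_inner k' a' x]
      refine Filter.EventuallyEq.gradient_eq ?_
      filter_upwards [isOpen_interior.mem_nhds hx] with y hy using hval y hy
    have key := lintegral_sub_affine_simplex_le (K₀ := S c) (K₁ := c⁻¹) (m := μ.real U) (A := A)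
      (k' := k') (a' := a') hρ hball hdρ hσ hd0 measureReal_nonneg (hS0 c) (by positivity) le_rfl
      hA0 hka2 hka1 (fun z hz => by
        rw [← hBk, hBw z hz]
        refine hA U isOpen_interior hUc hUΩ d hd0 hdU hcU z ?_ k a hka2
        rw [Triangulation.closure_interior_convexHull hs]
        exact subset_convexHull ℝ _ hz)
    have e1 : ∫⁻ x in U, ‖vh.val x - u.val x‖ₑ ^ 2
        = ∫⁻ x in U, ‖(k' + inner ℝ a' x) - u.val x‖ₑ ^ 2 :=
      setLIntegral_congr_fun isOpen_interior.measurableSet fun x hx => by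
        simp only [hval x hx]
    have e2 : ∫⁻ x in U, ‖vh.grad x - u.grad x‖ₑ ^ 2 = ∫⁻ x in U, ‖a' - u.grad x‖ₑ ^ 2 :=
      setLIntegral_congr_fun isOpen_interior.measurableSet fun x hx => by
        simp only [hgr x hx]
    rw [e1, e2]
    refine key.trans ?_
    rw [ENNReal.ofReal_mul' measureReal_nonneg, ofReal_measureReal (measure_ne_top μ _)]
    have := hS0 c
    gcongr
    rw [hC₀]
    gcongr
  have hcov : (Ω : Set (E n)) ≤ᵐ[volume]
      ⋃ s ∈ T.finite_cells.toFinset, interior (convexHull ℝ (s : Set (E n))) := by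
    have := (ae_restrict_iff' ho.measurableSet).1 (T.ae_mem_interior ho)
    filter_upwards [this] with x hx hxΩ
    obtain ⟨s, hs, hxs⟩ := hx hxΩ
    exact Set.mem_biUnion (by simpa using hs) hxs
  have hdisj : (T.finite_cells.toFinset : Set (Finset (E n))).PairwiseDisjoint
      fun s => interior (convexHull ℝ (s : Set (E n))) := by
    rw [Set.Finite.coe_toFinset]
    exact T.pairwiseDisjoint_interior
  have hmeas : ∀ s ∈ T.finite_cells.toFinset,
      MeasurableSet (interior (convexHull ℝ (s : Set (E n)))) := fun s _ =>
    isOpen_interior.measurableSet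
  have hsplit : ∀ f : E n → ℝ≥0∞, ∫⁻ x in Ω, f x
      ≤ ∑ s ∈ T.finite_cells.toFinset, ∫⁻ x in interior (convexHull ℝ (s : Set (E n))), f x := by
    intro f
    rw [← lintegral_biUnion_finset hdisj hmeas]
    exact lintegral_mono_set' hcov
  refine (add_le_add (hsplit _) (hsplit _)).trans ?_
  rw [← Finset.sum_add_distrib]
  refine (Finset.sum_le_sum fun s hs => hcell s (by simpa using hs)).trans ?_
  -- The local bounds are multiples of μ of disjoint sets, so their sum is at most the total mass of
  -- μ, whatever the number of cells.
  rw [← Finset.mul_sum, ← measure_biUnion_finset hdisj hmeas, mul_right_comm,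
    ENNReal.ofReal_mul' (q := μ.real Set.univ) measureReal_nonneg,
    ofReal_measureReal (measure_ne_top μ _)]
  gcongr
  exact Set.subset_univ _

end InterpolationError

/-! ### Norm inequalities for elements of H¹ -/

section EnergyNorms

variable {n : ℕ} {Ω : Set (E n)} {μ ν : Measure (E n)}

theorem Controls.eLpNorm_le (h : Controls Ω μ ν) : ∃ K : ℝ≥0, ∀ φ : E n → ℝ, ContDiff ℝ ∞ φ →
    eLpNorm φ 2 μ ≤ K * (eLpNorm φ 2 ν + eLpNorm (gradient φ) 2 (volume.restrict Ω)) := by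
  obtain ⟨C, hC⟩ := h
  refine ⟨C + 1, fun φ hφ => ?_⟩
  have := hC φ hφ
  simp only [← eLpNorm_two_sq] at this
  refine (ENNReal.pow_le_pow_left_iff two_ne_zero).1 (this.trans ?_)
  rw [mul_pow]
  gcongr ?_ * ?_
  · have : (C : ℝ≥0) ≤ (C + 1) ^ 2 := by nlinarith [C.2, sq_nonneg (C : ℝ≥0)]
    exact_mod_cast this
  · rw [add_sq]
    gcongr
    exact le_self_add

/-- Passage to the limit from smooth functions. The limits a and b with respect to μ and ν are
separate functions, so that a may be the trace and b the interior values, or conversely. -/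
theorem Controls.eLpNorm_le_of_tendsto (h : Controls Ω μ ν) : ∃ K : ℝ≥0,
    ∀ (φ : ℕ → E n → ℝ) (a b : E n → ℝ) (G : E n → E n), (∀ k, ContDiff ℝ ∞ (φ k)) →
      AEStronglyMeasurable a μ → AEStronglyMeasurable b ν →
      AEStronglyMeasurable G (volume.restrict Ω) →
      Tendsto (fun k => eLpNorm (φ k - a) 2 μ) atTop (𝓝 0) →
      Tendsto (fun k => eLpNorm (φ k - b) 2 ν) atTop (𝓝 0) →
      Tendsto (fun k => eLpNorm (gradient (φ k) - G) 2 (volume.restrict Ω)) atTop (𝓝 0) →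
      eLpNorm a 2 μ ≤ K * (eLpNorm b 2 ν + eLpNorm G 2 (volume.restrict Ω)) := by
  obtain ⟨K, hK⟩ := h.eLpNorm_le
  refine ⟨K, fun φ a b G hφ ha hb hG hla hlb hlG => ?_⟩
  have hle : ∀ k, eLpNorm a 2 μ ≤
      K * ((eLpNorm (φ k - b) 2 ν + eLpNorm b 2 ν)
        + (eLpNorm (gradient (φ k) - G) 2 (volume.restrict Ω) + eLpNorm G 2 (volume.restrict Ω)))
      + eLpNorm (φ k - a) 2 μ := by
    intro k
    have hm := (hφ k).continuous
    have hgm := continuous_gradient ((hφ k).of_le (m := 1) (by norm_cast))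
    have h1 : eLpNorm a 2 μ ≤ eLpNorm (φ k) 2 μ + eLpNorm (φ k - a) 2 μ := by
      have := eLpNorm_sub_le (p := 2) (hm.aestronglyMeasurable (μ := μ))
        (hm.aestronglyMeasurable.sub ha) (by norm_num)
      rwa [sub_sub_cancel] at this
    have h2 : eLpNorm (φ k) 2 ν ≤ eLpNorm (φ k - b) 2 ν + eLpNorm b 2 ν := by
      have := eLpNorm_add_le (p := 2) ((hm.aestronglyMeasurable (μ := ν)).sub hb) hb (by norm_num)
      rwa [sub_add_cancel] at this
    have h3 : eLpNorm (gradient (φ k)) 2 (volume.restrict Ω)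
        ≤ eLpNorm (gradient (φ k) - G) 2 (volume.restrict Ω)
          + eLpNorm G 2 (volume.restrict Ω) := by
      have := eLpNorm_add_le (p := 2)
        ((hgm.aestronglyMeasurable (μ := volume.restrict Ω)).sub hG) hG (by norm_num)
      rwa [sub_add_cancel] at this
    refine h1.trans ?_
    gcongr
    exact (hK _ (hφ k)).trans (by gcongr)
  have hlim := ((ENNReal.Tendsto.const_mul (a := (K : ℝ≥0∞))
    ((hlb.add_const (eLpNorm b 2 ν)).add (hlG.add_const (eLpNorm G 2 (volume.restrict Ω))))
    (Or.inr ENNReal.coe_ne_top))).add hla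
  simp only [zero_add, add_zero] at hlim
  exact ge_of_tendsto' hlim hle

theorem H1.exists_approx_sub (v u : H1 Ω) : ∃ φ : ℕ → E n → ℝ, (∀ k, ContDiff ℝ ∞ (φ k)) ∧
    Tendsto (fun k => eLpNorm (φ k - (v.val - u.val)) 2 (volume.restrict Ω)) atTop (𝓝 0) ∧
    Tendsto (fun k => eLpNorm (gradient (φ k) - (v.grad - u.grad)) 2 (volume.restrict Ω))
      atTop (𝓝 0) ∧
    Tendsto (fun k => eLpNorm (φ k - (v.trace - u.trace)) 2 ((surf n).restrict (frontier Ω)))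
      atTop (𝓝 0) := by
  obtain ⟨φ, hφ, hφ1, hφ2, hφ3⟩ := v.hasTrace
  obtain ⟨χ, hχ, hχ1, hχ2, hχ3⟩ := u.hasTrace
  have key : ∀ {F : Type} [NormedAddCommGroup F] (ξ : Measure (E n)) (f g : ℕ → E n → F)
      (a b : E n → F), (∀ k, AEStronglyMeasurable (f k) ξ) → (∀ k, AEStronglyMeasurable (g k) ξ) →
      AEStronglyMeasurable a ξ → AEStronglyMeasurable b ξ →
      Tendsto (fun k => eLpNorm (f k - a) 2 ξ) atTop (𝓝 0) →
      Tendsto (fun k => eLpNorm (g k - b) 2 ξ) atTop (𝓝 0) →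
      Tendsto (fun k => eLpNorm ((f k - g k) - (a - b)) 2 ξ) atTop (𝓝 0) := by
    intro F _ ξ f g a b hf hg ha hb h1 h2
    have h3 := h1.add h2
    rw [add_zero] at h3
    refine tendsto_of_tendsto_of_tendsto_of_le_of_le tendsto_const_nhds h3 (fun _ => zero_le)
      fun k => ?_
    rw [sub_sub_sub_comm]
    exact eLpNorm_sub_le ((hf k).sub ha) ((hg k).sub hb) (by norm_num)
  have hc : ∀ {φ : E n → ℝ}, ContDiff ℝ ∞ φ → Continuous (gradient φ) := fun h =>
    continuous_gradient (h.of_le (m := 1) (by norm_cast))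
  refine ⟨fun k => φ k - χ k, fun k => (hφ k).sub (hχ k), ?_, ?_, ?_⟩
  · exact key _ _ _ _ _ (fun k => (hφ k).continuous.aestronglyMeasurable)
      (fun k => (hχ k).continuous.aestronglyMeasurable) v.memLp_val.1 u.memLp_val.1 hφ1 hχ1
  · have e : ∀ k, gradient (φ k - χ k) = gradient (φ k) - gradient (χ k) := fun k => by
      ext1 x
      simp only [gradient, Pi.sub_apply]
      rw [fderiv_sub ((hφ k).differentiable (by simp) x) ((hχ k).differentiable (by simp) x),
        map_sub]
    simp only [e]
    exact key _ _ _ _ _ (fun k => (hc (hφ k)).aestronglyMeasurable)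
      (fun k => (hc (hχ k)).aestronglyMeasurable) v.memLp_grad.1 u.memLp_grad.1 hφ2 hχ2
  · exact key _ _ _ _ _ (fun k => (hφ k).continuous.aestronglyMeasurable)
      (fun k => (hχ k).continuous.aestronglyMeasurable) v.memLp_trace.1 u.memLp_trace.1 hφ3 hχ3

theorem H1.memLp_trace_of_subset {Γ : Set (E n)} (hΓ : Γ ⊆ frontier Ω) (v : H1 Ω) :
    MemLp v.trace 2 ((surf n).restrict Γ) :=
  v.memLp_trace.mono_measure (Measure.restrict_mono hΓ le_rfl)

theorem norm_toLp_sub {X F : Type*} [MeasurableSpace X] [NormedAddCommGroup F] {μ : Measure X}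
    {f g : X → F} (hf : MemLp f 2 μ) (hg : MemLp g 2 μ) :
    ‖hf.toLp f - hg.toLp g‖ = (eLpNorm (f - g) 2 μ).toReal := by
  rw [← MemLp.toLp_sub, Lp.norm_toLp]

/-- The norm equivalences on `H¹(Ω)`: the norm in `L²(Ω)` is controlled by the norm of the gradient
and the norm of the trace on a part of the boundary of positive measure, and the trace is
controlled by the norm of `H¹(Ω)`. -/
theorem exists_norm_bounds (hΩ : IsPolygonalDomain Ω) {Γ₁ Γ₂ : Set (E n)}
    (h1 : Γ₁ ⊆ frontier Ω) (h2 : Γ₂ ⊆ frontier Ω) (hΓ₁m : MeasurableSet Γ₁)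
    (hΓ₁ : 0 < surf n Γ₁) : ∃ L : ℝ, 0 ≤ L ∧ ∀ v u : H1 Ω,
    ‖v.memLp_val.toLp v.val - u.memLp_val.toLp u.val‖
        ≤ L * (‖(v.memLp_trace_of_subset h1).toLp v.trace
            - (u.memLp_trace_of_subset h1).toLp u.trace‖
          + ‖v.memLp_grad.toLp v.grad - u.memLp_grad.toLp u.grad‖) ∧
      ‖(v.memLp_trace_of_subset h1).toLp v.trace - (u.memLp_trace_of_subset h1).toLp u.trace‖
        ≤ L * (‖v.memLp_val.toLp v.val - u.memLp_val.toLp u.val‖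
          + ‖v.memLp_grad.toLp v.grad - u.memLp_grad.toLp u.grad‖) ∧
      ‖(v.memLp_trace_of_subset h2).toLp v.trace - (u.memLp_trace_of_subset h2).toLp u.trace‖
        ≤ L * (‖v.memLp_val.toLp v.val - u.memLp_val.toLp u.val‖
          + ‖v.memLp_grad.toLp v.grad - u.memLp_grad.toLp u.grad‖) := by
  obtain ⟨K₁, hK₁⟩ := (controls_by_surf hΩ.isOpen hΩ.isConnected.isPreconnected hΩ.isBounded
    hΩ.lipschitz h1 hΓ₁m hΓ₁.ne').eLpNorm_le_of_tendsto
  obtain ⟨K₂, hK₂⟩ := (controls_surf_frontier hΩ.isOpen hΩ.isBounded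
    hΩ.lipschitz).eLpNorm_le_of_tendsto
  refine ⟨max K₁ K₂, le_max_of_le_left K₁.2, fun v u => ?_⟩
  obtain ⟨φ, hφ, hφ1, hφ2, hφ3⟩ := v.exists_approx_sub u
  have hmono : ∀ {Γ : Set (E n)}, Γ ⊆ frontier Ω → ∀ f : E n → ℝ,
      eLpNorm f 2 ((surf n).restrict Γ) ≤ eLpNorm f 2 ((surf n).restrict (frontier Ω)) :=
    fun hΓ f => eLpNorm_mono_measure f (Measure.restrict_mono hΓ le_rfl)
  have hφ4 : Tendsto (fun k => eLpNorm (φ k - (v.trace - u.trace)) 2 ((surf n).restrict Γ₁))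
      atTop (𝓝 0) :=
    tendsto_of_tendsto_of_tendsto_of_le_of_le tendsto_const_nhds hφ3 (fun _ => zero_le)
      fun k => hmono h1 _
  have ht1 := (v.memLp_trace_of_subset h1).sub (u.memLp_trace_of_subset h1)
  have htf := v.memLp_trace.sub u.memLp_trace
  have hG := v.memLp_grad.sub u.memLp_grad
  have ha := v.memLp_val.sub u.memLp_val
  have b1 := hK₁ φ _ _ _ hφ ha.1 ht1.1 hG.1 hφ1 hφ4 hφ2
  have b2 := hK₂ φ _ _ _ hφ htf.1 ha.1 hG.1 hφ3 hφ1 hφ2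
  have conv : ∀ {K : ℝ≥0} {x y z : ℝ≥0∞}, y ≠ ⊤ → z ≠ ⊤ → x ≤ K * (y + z) → (K : ℝ) ≤ max (K₁ : ℝ) K₂ →
      x.toReal ≤ max (K₁ : ℝ) K₂ * (y.toReal + z.toReal) := by
    intro K x y z hy hz hx hK
    have h3 := ENNReal.toReal_mono (ENNReal.mul_ne_top ENNReal.coe_ne_top
      (ENNReal.add_ne_top.2 ⟨hy, hz⟩)) hx
    rw [ENNReal.toReal_mul, ENNReal.toReal_add hy hz, ENNReal.coe_toReal] at h3
    refine h3.trans ?_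
    gcongr
  simp only [norm_toLp_sub]
  exact ⟨conv ht1.2.ne hG.2.ne b1 (le_max_left _ _),
    conv ha.2.ne hG.2.ne ((hmono h1 _).trans b2) (le_max_right _ _),
    conv ha.2.ne hG.2.ne ((hmono h2 _).trans b2) (le_max_right _ _)⟩

end EnergyNorms

/-! ### Abstract estimates for variational inequalities -/

section Falk

theorem integral_mul_eq_inner {X : Type*} [MeasurableSpace X] {μ : Measure X} {f g : X → ℝ}
    (hf : MemLp f 2 μ) (hg : MemLp g 2 μ) :
    ∫ x, f x * g x ∂μ = inner ℝ (hf.toLp f) (hg.toLp g) := by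
  rw [L2.inner_def]
  refine integral_congr_ae ?_
  filter_upwards [hf.coeFn_toLp, hg.coeFn_toLp] with x h1 h2
  rw [h1, h2]
  simp [mul_comm]

theorem integral_inner_eq_inner {X F : Type*} [MeasurableSpace X] [NormedAddCommGroup F]
    [InnerProductSpace ℝ F] {μ : Measure X} {f g : X → F} (hf : MemLp f 2 μ) (hg : MemLp g 2 μ) :
    ∫ x, inner ℝ (f x) (g x) ∂μ = inner ℝ (hf.toLp f) (hg.toLp g) := by
  rw [L2.inner_def]
  refine integral_congr_ae ?_
  filter_upwards [hf.coeFn_toLp, hg.coeFn_toLp] with x h1 h2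
  rw [h1, h2]

/-- The zero function belongs to every discrete cone. -/
theorem exists_zero_mem_KplusH {n : ℕ} {Ω : Set (E n)} (T : Triangulation Ω) :
    ∃ z ∈ KplusH T, z.val = 0 ∧ z.grad = 0 ∧ z.trace = 0 := by
  have hg : gradient (fun _ : E n => (0 : ℝ)) = fun _ => 0 := by
    ext1 x
    simp [gradient]
  refine ⟨⟨0, 0, 0, MemLp.zero, MemLp.zero, MemLp.zero, ?_, fun _ _ => 0, ?_, ?_, ?_, ?_⟩,
    ⟨⟨continuousOn_const, fun s _ => ⟨0, fun x _ => by simp⟩⟩, fun x _ => le_rfl⟩, rfl, rfl, rfl⟩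
  · intro φ _ _ _ i
    simp
  · exact fun _ => contDiff_const
  · simp
  · simp [hg]
  · simp

variable {V₁ V₂ V₃ V₄ : Type*} [NormedAddCommGroup V₁] [InnerProductSpace ℝ V₁]
  [NormedAddCommGroup V₂] [InnerProductSpace ℝ V₂] [NormedAddCommGroup V₃]
  [InnerProductSpace ℝ V₃] [NormedAddCommGroup V₄] [InnerProductSpace ℝ V₄]

/-- A priori bound for a solution of a coercive variational inequality. -/
theorem add_le_of_sq_le {G S A B α L γ₁ γ₂ γ₃ : ℝ} (hα : 0 < α) (hL : 0 ≤ L) (hG : 0 ≤ G)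
    (hS : 0 ≤ S) (h₁ : 0 ≤ γ₁) (h₂ : 0 ≤ γ₂) (h₃ : 0 ≤ γ₃) (hA : A ≤ L * (S + G))
    (hB : B ≤ L * (A + G)) (h : G ^ 2 + α * S ^ 2 ≤ γ₁ * A + γ₂ * B + γ₃ * S) :
    S + G ≤ 2 / min 1 α * (γ₁ * L + γ₂ * (L * (L + 1)) + γ₃) := by
  set m := min 1 α with hm
  have hm0 : 0 < m := lt_min one_pos hα
  set κ := γ₁ * L + γ₂ * (L * (L + 1)) + γ₃ with hκ
  have hκ0 : 0 ≤ κ := by positivity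
  have hN : 0 ≤ S + G := by positivity
  have h4 : G ^ 2 + α * S ^ 2 ≤ κ * (S + G) := by
    have e1 : γ₁ * A ≤ γ₁ * (L * (S + G)) := by gcongr
    have e2 : γ₂ * B ≤ γ₂ * (L * (L * (S + G) + (S + G))) := by
      refine mul_le_mul_of_nonneg_left (hB.trans ?_) h₂
      gcongr
      linarith
    have e3 : γ₃ * S ≤ γ₃ * (S + G) := by
      gcongr
      linarith
    calc G ^ 2 + α * S ^ 2 ≤ γ₁ * A + γ₂ * B + γ₃ * S := h
      _ ≤ γ₁ * (L * (S + G)) + γ₂ * (L * (L * (S + G) + (S + G))) + γ₃ * (S + G) := by linarith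
      _ = κ * (S + G) := by rw [hκ]; ring
  -- The factor 2 / min 1 α comes from (S + G)² ≤ 2S² + 2G² and from replacing both coefficients 1
  -- and α by their minimum.
  have h5 : m * (S + G) ^ 2 ≤ 2 * (κ * (S + G)) := by
    have e1 : m * G ^ 2 ≤ 1 * G ^ 2 := by gcongr; exact min_le_left _ _
    have e2 : m * S ^ 2 ≤ α * S ^ 2 := by gcongr; exact min_le_right _ _
    have e3 : m * (S + G) ^ 2 ≤ m * (2 * S ^ 2 + 2 * G ^ 2) := by
      gcongr
      nlinarith [sq_nonneg (S - G)]
    linarith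
  rw [div_mul_eq_mul_div, le_div_iff₀ hm0]
  rcases hN.eq_or_lt with h0 | h0
  · rw [← h0]
    simp only [zero_mul]
    positivity
  · refine le_of_mul_le_mul_right ?_ h0
    nlinarith

/-- Falk's error estimate. -/
theorem sq_add_sq_le_of_variational_inequalities {α : ℝ} {g a a' a'' : V₁} {G G' G'' : V₂}
    {b s s' s'' : V₃} {q t t' t'' : V₄} (hα : 0 < α)
    (h₁ : inner ℝ g (a' - a) - inner ℝ q (t' - t) + α * inner ℝ b (s' - s)
      ≤ inner ℝ G (G' - G) + α * inner ℝ s (s' - s))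
    (h₂ : inner ℝ g (a'' - a') - inner ℝ q (t'' - t') + α * inner ℝ b (s'' - s')
      ≤ inner ℝ G' (G'' - G') + α * inner ℝ s' (s'' - s')) :
    ‖G' - G‖ ^ 2 + α * ‖s' - s‖ ^ 2 ≤ ‖G'‖ * ‖G'' - G‖ + α * (‖s'‖ * ‖s'' - s‖)
      + ‖g‖ * ‖a'' - a‖ + ‖q‖ * ‖t'' - t‖ + α * (‖b‖ * ‖s'' - s‖) := by
  have i1 := real_inner_le_norm G' (G'' - G)
  have i2 := mul_le_mul_of_nonneg_left (real_inner_le_norm s' (s'' - s)) hα.le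
  have i3 := abs_le.1 (abs_real_inner_le_norm g (a'' - a))
  have i4 := real_inner_le_norm q (t'' - t)
  have i5 := mul_le_mul_of_nonneg_left (abs_le.1 (abs_real_inner_le_norm b (s'' - s))).1 hα.le
  -- Adding the two inequalities, the data terms telescope to differences between the doubly and the
  -- unprimed vectors, and ⟨G, G' − G⟩ + ⟨G', G'' − G'⟩ = ⟨G', G'' − G⟩ − ‖G' − G‖²; likewise for s.
  rw [← real_inner_self_eq_norm_sq, ← real_inner_self_eq_norm_sq]
  simp only [inner_sub_left, inner_sub_right, mul_sub] at *
  rw [real_inner_comm G G'] at i1 ⊢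
  rw [real_inner_comm s s'] at i2 ⊢
  linarith [i3.1]

/-- Falk's bound is quadratic in the errors E of the state on the left and linear in the
approximation errors D on the right, so a rate η for D becomes √η for E. -/
theorem sqrt_rate {E₁ E₂ E₃ D₁ D₂ D₃ D₄ α L B β γ κ η : ℝ} (hα : 0 < α) (hL : 0 ≤ L) (hB : 0 ≤ B)
    (hβ : 0 ≤ β) (hγ : 0 ≤ γ) (hκ : 0 ≤ κ) (hE : E₁ ≤ L * (E₃ + E₂)) (hD₁ : D₁ ≤ κ * η) (hD₂ : D₂ ≤ κ * η) (hD₃ : D₃ ≤ L * (D₁ + D₂))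
    (hD₄ : D₄ ≤ L * (D₁ + D₂))
    (h : E₂ ^ 2 + α * E₃ ^ 2 ≤ B * D₂ + α * (B * D₃) + γ * D₁ + γ * D₄ + α * (β * D₃)) :
    E₁ ≤ L * √(2 / min 1 α * (κ * (B + γ + 2 * L * (α * B + γ + α * β)))) * √η := by
  set m := min 1 α with hm
  have hm0 : 0 < m := lt_min one_pos hα
  set ξ := κ * (B + γ + 2 * L * (α * B + γ + α * β)) with hξ
  have hD3 : D₃ ≤ L * (2 * κ * η) := hD₃.trans (by gcongr; linarith)
  have hD4 : D₄ ≤ L * (2 * κ * η) := hD₄.trans (by gcongr; linarith)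
  have h4 : E₂ ^ 2 + α * E₃ ^ 2 ≤ ξ * η := by
    calc E₂ ^ 2 + α * E₃ ^ 2 ≤ B * D₂ + α * (B * D₃) + γ * D₁ + γ * D₄ + α * (β * D₃) := h
      _ ≤ B * (κ * η) + α * (B * (L * (2 * κ * η))) + γ * (κ * η) + γ * (L * (2 * κ * η))
          + α * (β * (L * (2 * κ * η))) := by gcongr
      _ = ξ * η := by rw [hξ]; ring
  have h5 : (E₃ + E₂) ^ 2 ≤ 2 / m * ξ * η := by
    rw [div_mul_eq_mul_div, div_mul_eq_mul_div, le_div_iff₀ hm0]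
    have e1 : m * E₂ ^ 2 ≤ 1 * E₂ ^ 2 := by gcongr; exact min_le_left _ _
    have e2 : m * E₃ ^ 2 ≤ α * E₃ ^ 2 := by gcongr; exact min_le_right _ _
    have e3 : m * (E₃ + E₂) ^ 2 ≤ m * (2 * E₃ ^ 2 + 2 * E₂ ^ 2) := by
      gcongr
      nlinarith [sq_nonneg (E₃ - E₂)]
    linarith
  have h6 : E₃ + E₂ ≤ √(2 / m * ξ * η) := Real.le_sqrt_of_sq_le h5
  have hξ0 : 0 ≤ ξ := by positivity
  rw [Real.sqrt_mul (by positivity)] at h6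
  rw [mul_assoc]
  exact hE.trans (mul_le_mul_of_nonneg_left h6 hL)

end Falk

/-! ### The inequalities in L² inner products, and the cost estimate -/

theorem SolvesVI.inner_le {n : ℕ} {Ω Γ₁ Γ₂ : Set (E n)} (h1 : Γ₁ ⊆ frontier Ω)
    (h2 : Γ₂ ⊆ frontier Ω) {α b : ℝ} {q g : E n → ℝ} (hq : MemLp q 2 ((surf n).restrict Γ₂))
    (hg : MemLp g 2 (volume.restrict Ω)) (hb : MemLp (fun _ => b) 2 ((surf n).restrict Γ₁))
    {K : Set (H1 Ω)} {u v : H1 Ω} (hu : SolvesVI Γ₁ Γ₂ α b q g K u) (hv : v ∈ K) :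
    inner ℝ (hg.toLp g) (v.memLp_val.toLp v.val - u.memLp_val.toLp u.val)
        - inner ℝ (hq.toLp q) ((v.memLp_trace_of_subset h2).toLp v.trace
          - (u.memLp_trace_of_subset h2).toLp u.trace)
        + α * inner ℝ (hb.toLp (fun _ => b)) ((v.memLp_trace_of_subset h1).toLp v.trace
          - (u.memLp_trace_of_subset h1).toLp u.trace)
      ≤ inner ℝ (u.memLp_grad.toLp u.grad)
          (v.memLp_grad.toLp v.grad - u.memLp_grad.toLp u.grad)
        + α * inner ℝ ((u.memLp_trace_of_subset h1).toLp u.trace)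
          ((v.memLp_trace_of_subset h1).toLp v.trace
            - (u.memLp_trace_of_subset h1).toLp u.trace) := by
  simp only [← MemLp.toLp_sub]
  rw [← integral_mul_eq_inner, ← integral_mul_eq_inner, ← integral_mul_eq_inner,
    ← integral_mul_eq_inner, ← integral_inner_eq_inner]
  exact hu.2 v hv

end VarIneqFEM

theorem lemma2p3 {n : ℕ} (Ω Γ₁ Γ₂ : Set (E n)) (hΩ : IsPolygonalDomain Ω)
    (hΓ : Γ₁ ∪ Γ₂ = frontier Ω) (hdisj : Disjoint Γ₁ Γ₂)
    (hΓ₁m : MeasurableSet Γ₁) (hΓ₂m : MeasurableSet Γ₂) (hΓ₁ : 0 < surf n Γ₁)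
    (α b M : ℝ) (hα : 0 < α) (hb : 0 < b) (hM : 0 < M)
    (q : E n → ℝ) (hq : MemLp q 2 ((surf n).restrict Γ₂))
    (r : ℝ) (hr1 : 1 < r) (hr2 : r ≤ 2) (hnr : (n : ℝ) < 2 * r)
    (σ : ℝ)
    (g : E n → ℝ) (hg : MemLp g 2 (volume.restrict Ω))
    (u : H1 Ω) (hu : SolvesVI Γ₁ Γ₂ α b q g (Kplus Ω) u) (hur : MemHr r u) :
    ∃ C : ℝ, 0 < C ∧ ∀ T : Triangulation Ω, T.IsShapeRegular σ →
      ∀ uh : H1 Ω, SolvesVI Γ₁ Γ₂ α b q g (KplusH T) uh →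
        |cost M g uh - cost M g u| ≤ C * T.meshSize ^ ((r - 1) / 2) := by
  have h1 : Γ₁ ⊆ frontier Ω := hΓ ▸ Set.subset_union_left
  have h2 : Γ₂ ⊆ frontier Ω := hΓ ▸ Set.subset_union_right
  -- A boundary chart carries a unit vector, which does not exist in dimension 0.
  have hn : n ≠ 0 := by
    obtain ⟨x₀, hx₀⟩ := nonempty_of_measure_ne_zero hΓ₁.ne'
    obtain ⟨e, δ, K, ψ, h⟩ := exists_isChart hΩ.lipschitz (h1 hx₀)
    exact (pos_of_norm_eq_one h.norm_eq).ne'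
  have hfin : IsFiniteMeasure ((surf n).restrict Γ₁) := ⟨by
    rw [Measure.restrict_apply_univ]
    exact (measure_mono h1).trans_lt (surf_frontier_lt_top hΩ.isOpen hΩ.isBounded hΩ.lipschitz)⟩
  have hbL : MemLp (fun _ => b) 2 ((surf n).restrict Γ₁) := memLp_const b
  obtain ⟨L, hL0, hL⟩ := exists_norm_bounds hΩ h1 h2 hΓ₁m hΓ₁
  obtain ⟨κ, hκ0, hκ⟩ := exists_discrete_approx hΩ hn hr1 hr2 hnr hu.1 hur σ
  set gL := hg.toLp g with hgL
  set qL := hq.toLp q with hqL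
  set bL := hbL.toLp (fun _ => b) with hbL'
  set uL := u.memLp_val.toLp u.val with huL
  set B := 2 / min 1 α * (‖gL‖ * L + ‖qL‖ * (L * (L + 1)) + α * ‖bL‖) with hB
  have hm0 : 0 < min 1 α := lt_min one_pos hα
  have hB0 : 0 ≤ B := by positivity
  set γ := max ‖gL‖ ‖qL‖ with hγ
  have hγ0 : 0 ≤ γ := le_max_of_le_left (norm_nonneg _)
  set C₁ := L * √(2 / min 1 α * (√κ * (B + γ + 2 * L * (α * B + γ + α * ‖bL‖)))) with hC₁
  have hC₁0 : 0 ≤ C₁ := by positivity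
  -- The added 1 only ensures that the constant is strictly positive.
  refine ⟨1 / 2 * C₁ * (L * B + ‖uL‖) + 1, by positivity, fun T hT uh huh => ?_⟩
  have hh0 : 0 ≤ T.meshSize := Real.sSup_nonneg (by
    rintro _ ⟨s, -, rfl⟩
    exact Metric.diam_nonneg)
  obtain ⟨vh, hvh, herr⟩ := hκ T hT
  -- Testing with 0 bounds the trace and gradient norms of the discrete state by B, which does not
  -- depend on T.
  obtain ⟨z, hz, hz1, hz2, hz3⟩ := exists_zero_mem_KplusH T
  have huhK : uh ∈ Kplus Ω := by
    filter_upwards [ae_restrict_mem hΩ.isOpen.measurableSet] with x hx using huh.1.2 x hx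
  have hzv : z.memLp_val.toLp z.val = 0 := by
    rw [← norm_eq_zero, Lp.norm_toLp, hz1, eLpNorm_zero, ENNReal.toReal_zero]
  have hzg : z.memLp_grad.toLp z.grad = 0 := by
    rw [← norm_eq_zero, Lp.norm_toLp, hz2, eLpNorm_zero, ENNReal.toReal_zero]
  have hzt : ∀ {Γ : Set (E n)} (h : Γ ⊆ frontier Ω),
      (z.memLp_trace_of_subset h).toLp z.trace = 0 := fun h => by
    rw [← norm_eq_zero, Lp.norm_toLp, hz3, eLpNorm_zero, ENNReal.toReal_zero]
  have hb1 := hL uh z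
  simp only [hzv, hzg, hzt h1, hzt h2, sub_zero] at hb1
  have hvi0 := huh.inner_le h1 h2 hq hg hbL hz
  simp only [hzv, hzg, hzt h1, hzt h2, zero_sub, inner_neg_right, real_inner_self_eq_norm_sq] at hvi0
  rw [← hgL, ← hqL, ← hbL'] at hvi0
  have hbound : ‖(uh.memLp_trace_of_subset h1).toLp uh.trace‖ + ‖uh.memLp_grad.toLp uh.grad‖ ≤ B := by
    refine add_le_of_sq_le hα hL0 (norm_nonneg _) (norm_nonneg _) (norm_nonneg gL)
      (norm_nonneg qL) (by positivity) hb1.1 hb1.2.2 ?_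
    have i1 := real_inner_le_norm gL (uh.memLp_val.toLp uh.val)
    have i2 := (abs_le.1 (abs_real_inner_le_norm qL
      ((uh.memLp_trace_of_subset h2).toLp uh.trace))).1
    have i3 := mul_le_mul_of_nonneg_left
      (real_inner_le_norm bL ((uh.memLp_trace_of_subset h1).toLp uh.trace)) hα.le
    linarith
  -- The continuous inequality is tested with the discrete state, admissible because it is
  -- nonnegative, and the discrete one with the interpolant.
  have hfalk := sq_add_sq_le_of_variational_inequalities hα
    (hu.inner_le h1 h2 hq hg hbL huhK) (huh.inner_le h1 h2 hq hg hbL hvh)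
  set η := T.meshSize ^ (r - 1) with hη
  have hη0 : 0 ≤ η := by positivity
  have hκη : κ * T.meshSize ^ (2 * (r - 1)) = (√κ * η) ^ 2 := by
    rw [mul_pow, Real.sq_sqrt hκ0, hη, ← Real.rpow_mul_natCast hh0]
    congr 2
    push_cast
    ring
  rw [hκη, ENNReal.ofReal_pow (by positivity)] at herr
  have hconv : ∀ {F : Type} [NormedAddCommGroup F] {f f' : E n → F}
      (hf : MemLp f 2 (volume.restrict Ω)) (hf' : MemLp f' 2 (volume.restrict Ω)),
      ∫⁻ x in Ω, ‖f x - f' x‖ₑ ^ 2 ≤ ENNReal.ofReal (√κ * η) ^ 2 →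
      ‖hf.toLp f - hf'.toLp f'‖ ≤ √κ * η := by
    intro F _ f f' hf hf' h
    rw [norm_toLp_sub]
    refine ENNReal.toReal_le_of_le_ofReal (by positivity) ?_
    refine (ENNReal.pow_le_pow_left_iff two_ne_zero).1 ?_
    simpa only [eLpNorm_two_sq, Pi.sub_apply] using h
  have hD₁ := hconv vh.memLp_val u.memLp_val (le_self_add.trans herr)
  have hD₂ := hconv vh.memLp_grad u.memLp_grad (le_add_self.trans herr)
  have hLv := hL vh u
  have hrate := sqrt_rate (B := B) (β := ‖bL‖) (γ := γ) hα hL0 hB0 (norm_nonneg _) hγ0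
    (Real.sqrt_nonneg κ) (hL uh u).1 hD₁ hD₂ hLv.2.1 hLv.2.2
    (hfalk.trans (by
      gcongr
      · linarith [norm_nonneg ((uh.memLp_trace_of_subset h1).toLp uh.trace)]
      · linarith [norm_nonneg (uh.memLp_grad.toLp uh.grad)]
      · exact le_max_left _ _
      · exact le_max_right _ _))
  have hsqrt : √η = T.meshSize ^ ((r - 1) / 2) := by
    rw [hη, Real.sqrt_eq_rpow, ← Real.rpow_mul hh0]
    congr 1
    ring
  rw [← hC₁, hsqrt] at hrate
  -- Both costs use the same control, so its term drops out.
  have hcost : cost M g uh - cost M g u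
      = 1 / 2 * (‖uh.memLp_val.toLp uh.val‖ ^ 2 - ‖uL‖ ^ 2) := by
    simp only [cost, innerH]
    rw [integral_mul_eq_inner uh.memLp_val uh.memLp_val,
      integral_mul_eq_inner u.memLp_val u.memLp_val, real_inner_self_eq_norm_sq,
      real_inner_self_eq_norm_sq]
    ring
  have hdiff := abs_norm_sub_norm_le (uh.memLp_val.toLp uh.val) uL
  have huhL : ‖uh.memLp_val.toLp uh.val‖ ≤ L * B :=
    hb1.1.trans (mul_le_mul_of_nonneg_left hbound hL0)
  rw [hcost, sq_sub_sq, abs_mul, abs_mul, abs_of_nonneg (by norm_num : (0 : ℝ) ≤ 1 / 2),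
    abs_of_nonneg (by positivity)]
  have hp : 0 ≤ T.meshSize ^ ((r - 1) / 2) := by positivity
  calc 1 / 2 * ((‖uh.memLp_val.toLp uh.val‖ + ‖uL‖) * |‖uh.memLp_val.toLp uh.val‖ - ‖uL‖|)
      ≤ 1 / 2 * ((L * B + ‖uL‖) * (C₁ * T.meshSize ^ ((r - 1) / 2))) := by
        gcongr
        exact hdiff.trans hrate
    _ = 1 / 2 * C₁ * (L * B + ‖uL‖) * T.meshSize ^ ((r - 1) / 2) := by ring
    _ ≤ (1 / 2 * C₁ * (L * B + ‖uL‖) + 1) * T.meshSize ^ ((r - 1) / 2) := by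
        gcongr
        linarith
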